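/- **Conventions.** Fix an o-minimal expansion of the real field; "definable" means definable in it with real parameters. For $x\in\mathbb R^\ell$ write $x_{1\dots i}=(x_1,\dots,x_i)$, and let $\pi_i$ be the projection to the first $i$ coordinates. A set $A$ is *compatible* with a set $X$ if $A\subset X$ or $A\cap X=\emptyset$. *Forts.* An integer cell of length $\ell\ge 1$ is a product of $\ell$ sets, each of the form $\{k\}$ or $(k,k+1)$ with $k\in\mathbb Z$. A fort of length $1$ is an interval $(0,n)$, $n\in\mathbb Z_{>0}$. A fort of length $\ell+1$ is a set $\{(x,y): x\in\mathscr B,\ 0<y<h(x)\}$, where $\mathscr B$ is a fort of length $\ell$ and $h:\mathscr B\to\mathbb Z_{>0}$ is constant on each integer cell contained in $\mathscr B$. A fort $\mathscr F$ is the disjoint union of the finite set $C(\mathscr F)$ of the integer cells contained in it; its size is $|C(\mathscr F)|$. *Morphisms.* A morphism $\phi:\mathscr F_1\to\mathscr F_2$ of forts of length $\ell$ is a definable surjective map such that: $\phi_i(x)$ depends only on $x_{1\dots i}$ and is strictly increasing in $x_i$ for fixed $x_{1\dots i-1}$ ($1\le i\le\ell$); and for every $\mathcal C_1\in C(\mathscr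 F_1)$ the restriction $\phi|_{\mathcal C_1}$ is continuous and $\phi(\mathcal C_1)\subset\mathcal C_2$ for some $\mathcal C_2\in C(\mathscr F_2)$. It is *natural* if moreover on each $\mathcal C_1\in C(\mathscr F_1)$, for all $i$ and all fixed $x_{1\dots i-1}$, the function $\phi_i(x_{1\dots i-1},\cdot)$ is affine. Given sets $X_{\mathcal C,j}\subset\mathcal C$ ($\mathcal C\in C(\mathscr F)$, $j\in J$), a morphism $\phi:\widetilde{\mathscr F}\to\mathscr F$ is *compatible* with them if $\phi(\widetilde{\mathcal C})$ is compatible with every $X_{\mathcal C,j}$, for all $\widetilde{\mathcal C}\in C(\widetilde{\mathscr F})$. *Sharp structures.* An FD-filtration is a family $\Omega=\{\Omega_{\mathcal F,D}\}_{\mathcal F,D\in\mathbb N}$ of collections of definable sets that exhausts the definable sets, with $\Omega_{\mathcal F,D}\subset\Omega_{\mathcal F+1,D}\cap\Omega_{\mathcal F,D+1}$. A set in $\Omega_{\mathcal F,D}$ is said to have format $\mathcal F$ and degree $D$; a map has the format and degree of its graph. The structure with $\Omega$ is *sharply o-minimal* if: (1) for each $\mathcal F$ there is a polynomial $P_{\mathcal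 F}$ with positive coefficients such that every $X\subset\mathbb R$ of format $\mathcal F$ and degree $D$ has at most $P_{\mathcal F}(D)$ connected components; (2) if $X\subset\mathbb R^\ell$ has format $\mathcal F$ and degree $D$, then $\mathcal F\ge\ell$, and $\mathbb R\times X$, $X\times\mathbb R$, $\mathbb R^\ell\setminus X$, $\pi_{\ell-1}(X)$ have format $\mathcal F+1$ and degree $D$; (3) if $X_1,\dots,X_k\subset\mathbb R^\ell$ ($k\ge1$) have formats $\mathcal F_i$ and degrees $D_i$, then with $\mathcal F=\max_i\mathcal F_i$, $D=\sum_iD_i$ the set $\bigcup_i X_i$ has format $\mathcal F$ and degree $D$, and $\bigcap_iX_i$ has format $\mathcal F+1$ and degree $D$; (4) the zero set in $\mathbb R^\ell$ of a real polynomial of degree $d$ has format $\ell$ and degree $d$ (with $d=0$ for the zero polynomial). $O_{\mathcal F}(1)$ denotes a constant depending only on $\mathcal F$, and $\mathrm{poly}_{\mathcal F}(\cdot)$ the value of a polynomial with positive coefficients depending only on $\mathcal F$ (the sharply o-minimal structure being fixed); a size "is $\mathrm{poly}_{\mathcal F}(\cdot)$" if it is bounded by such a value. *Cylindrical decompositions.*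 Cells of length $1$ are points and open intervals. A cell of length $\ell+1$ is the graph of a continuous definable function $f:C\to\mathbb R$ on a cell $C$ of length $\ell$, or a set $\{(x,y):x\in C,\ f(x)<y<g(x)\}$ for two such functions $f<g$. A cylindrical decomposition of $X\subset(0,1)^\ell$ is a finite partition $\Phi$ of $X$ into cells such that, if $\ell>1$, the set $\{\pi_{\ell-1}(C):C\in\Phi\}$ is a cylindrical decomposition of $\pi_{\ell-1}(X)$. The structure *has sharp cylindrical decomposition* if for all $\ell,s\ge1$ and all $X_1,\dots,X_s\subset(0,1)^\ell$ of format $\mathcal F$ and degree $D$ there is a cylindrical decomposition of $(0,1)^\ell$ into $\mathrm{poly}_{\mathcal F}(D,s)$ cells of format $O_{\mathcal F}(1)$ and degree $\mathrm{poly}_{\mathcal F}(D)$, each compatible with $X_1,\dots,X_s$. **Proposition.** Let $\mathscr F$ be a fort of length $\ell\ge1$, let $J$ be a finite set, and let $X_{\mathcal C,j}\subset\mathcal C$ be definable sets, for $\mathcal C\in C(\mathscr F)$ and $j\in J$. Then there exist a fort $\widetilde{\mathscr F}$ of length $\ell$ and a natural morphism $\phi:\widetilde{\mathscr F}\to\mathscr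 F$ compatible with $\{X_{\mathcal C,j}\}_{\mathcal C\in C(\mathscr F),\,j\in J}$. If in addition the structure is sharply o-minimal with sharp cylindrical decomposition, and all the sets $X_{\mathcal C,j}$ have format $\mathcal F$ and degree $D$, where $\mathcal F\ge\ell$ (automatic if $J\ne\emptyset$), then $\widetilde{\mathscr F}$ and $\phi$ can be chosen so that moreover $|C(\widetilde{\mathscr F})|=\mathrm{poly}_{\mathcal F}(D,|C(\mathscr F)|,|J|)$ and, for every $\widetilde{\mathcal C}\in C(\widetilde{\mathscr F})$, the restriction $\phi|_{\widetilde{\mathcal C}}$ has format $O_{\mathcal F}(1)$ and degree $\mathrm{poly}_{\mathcal F}(D)$. The constants and polynomials depend only on the sharply o-minimal structure and on $\mathcal F$. -/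

import Mathlib

universe u v w

namespace FortTheory

/-! ### O-minimal and sharply o-minimal structures on the real field

Points of `ℝ^ℓ` are functions `Fin ℓ → ℝ`. A first-order structure on `ℝ` is given by a language `L`
with an interpretation `[L.Structure ℝ]`; "definable" always means definable with real parameters. -/

/-- `X ⊆ ℝ^ℓ` is definable with parameters in the `L`-structure `ℝ`. -/
def Def (L : FirstOrder.Language.{u, v}) [L.Structure ℝ] {ℓ : ℕ} (X : Set (Fin ℓ → ℝ)) : Prop :=
  (Set.univ : Set ℝ).Definable L X

/-- The `L`-structure on `ℝ` is an o-minimal expansion of the real field: addition and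
multiplication are definable (hence so is the order, `x ≤ y ↔ ∃ z, y = x + z * z`), and every
definable subset of `ℝ` is a finite union of points and intervals. The order-connected subsets of
`ℝ` are exactly the intervals of all kinds, points and the empty set included. -/
structure IsOMinimalExpansion (L : FirstOrder.Language.{u, v}) [L.Structure ℝ] : Prop where
  definable_add : Def L {x : Fin 3 → ℝ | x 2 = x 0 + x 1}
  definable_mul : Def L {x : Fin 3 → ℝ | x 2 = x 0 * x 1}
  finite_union : ∀ S : Set ℝ, Def L {x : Fin 1 → ℝ | x 0 ∈ S} →
    ∃ T : Set (Set ℝ), T.Finite ∧ (∀ A ∈ T, A.OrdConnected) ∧ S = ⋃₀ T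

/-- The projection `ℝ^(ℓ+1) → ℝ^ℓ` on the first `ℓ` coordinates. -/
def proj {ℓ : ℕ} (x : Fin (ℓ + 1) → ℝ) : Fin ℓ → ℝ := fun i => x i.castSucc

/-- `Ω 𝓕 D ℓ` is the collection of subsets of `ℝ^ℓ` of format `𝓕` and degree `D`. -/
abbrev FDFamily : Type := ℕ → ℕ → (ℓ : ℕ) → Set (Set (Fin ℓ → ℝ))

/-- `Ω` is an FD-filtration on the collection of definable sets. -/
structure IsFDFiltration (L : FirstOrder.Language.{u, v}) [L.Structure ℝ] (Ω : FDFamily) : Prop where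
  definable : ∀ {𝓕 D ℓ : ℕ} {X : Set (Fin ℓ → ℝ)}, X ∈ Ω 𝓕 D ℓ → Def L X
  exhaustive : ∀ {ℓ : ℕ} {X : Set (Fin ℓ → ℝ)}, Def L X → ∃ 𝓕 D, X ∈ Ω 𝓕 D ℓ
  mono_format : ∀ {𝓕 D ℓ : ℕ}, Ω 𝓕 D ℓ ⊆ Ω (𝓕 + 1) D ℓ
  mono_degree : ∀ {𝓕 D ℓ : ℕ}, Ω 𝓕 D ℓ ⊆ Ω 𝓕 (D + 1) ℓ

/-- The pair of the `L`-structure `ℝ` and `Ω` is a sharply o-minimal structure. Polynomials with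
natural coefficients play the role of polynomials with positive coefficients: each real polynomial
with positive coefficients is bounded by one of these on `ℕ`. -/
structure IsSharplyOMinimal (L : FirstOrder.Language.{u, v}) [L.Structure ℝ] (Ω : FDFamily) : Prop extends
    IsOMinimalExpansion L, IsFDFiltration L Ω where
  components : ∀ 𝓕 : ℕ, ∃ P : Polynomial ℕ, ∀ (D : ℕ) (X : Set (Fin 1 → ℝ)), X ∈ Ω 𝓕 D 1 →
    ENat.card (ConnectedComponents X) ≤ ((P.eval D : ℕ) : ℕ∞)
  prod_left : ∀ {𝓕 D ℓ : ℕ} {X : Set (Fin ℓ → ℝ)}, X ∈ Ω 𝓕 D ℓ →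
    {x : Fin (ℓ + 1) → ℝ | (fun i : Fin ℓ => x i.succ) ∈ X} ∈ Ω (𝓕 + 1) D (ℓ + 1)
  prod_right : ∀ {𝓕 D ℓ : ℕ} {X : Set (Fin ℓ → ℝ)}, X ∈ Ω 𝓕 D ℓ →
    {x : Fin (ℓ + 1) → ℝ | proj x ∈ X} ∈ Ω (𝓕 + 1) D (ℓ + 1)
  compl : ∀ {𝓕 D ℓ : ℕ} {X : Set (Fin ℓ → ℝ)}, X ∈ Ω 𝓕 D ℓ → Xᶜ ∈ Ω (𝓕 + 1) D ℓ
  image_proj : ∀ {𝓕 D ℓ : ℕ} {X : Set (Fin (ℓ + 1) → ℝ)}, X ∈ Ω 𝓕 D (ℓ + 1) →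
    proj '' X ∈ Ω (𝓕 + 1) D ℓ
  le_format : ∀ {𝓕 D ℓ : ℕ} {X : Set (Fin ℓ → ℝ)}, X ∈ Ω 𝓕 D ℓ → ℓ ≤ 𝓕
  iUnion : ∀ {k ℓ : ℕ} (𝓕 D : Fin (k + 1) → ℕ) (X : Fin (k + 1) → Set (Fin ℓ → ℝ)),
    (∀ i, X i ∈ Ω (𝓕 i) (D i) ℓ) → (⋃ i, X i) ∈ Ω (Finset.univ.sup 𝓕) (∑ i, D i) ℓ
  iInter : ∀ {k ℓ : ℕ} (𝓕 D : Fin (k + 1) → ℕ) (X : Fin (k + 1) → Set (Fin ℓ → ℝ)),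
    (∀ i, X i ∈ Ω (𝓕 i) (D i) ℓ) → (⋂ i, X i) ∈ Ω (Finset.univ.sup 𝓕 + 1) (∑ i, D i) ℓ
  zeroSet : ∀ {ℓ : ℕ} (P : MvPolynomial (Fin ℓ) ℝ),
    {x : Fin ℓ → ℝ | MvPolynomial.eval x P = 0} ∈ Ω ℓ P.totalDegree ℓ

/-! ### Cells and cylindrical decompositions -/

/-- The part over `B` of the graph of `f : ℝ^m → ℝ^n`, as a subset of `ℝ^(m+n)`. -/
def graphOn {m n : ℕ} (f : (Fin m → ℝ) → (Fin n → ℝ)) (B : Set (Fin m → ℝ)) :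
    Set (Fin (m + n) → ℝ) :=
  {z | ∃ x ∈ B, z = Fin.append x (f x)}

/-- `f` is a continuous definable function `B → ℝ`. -/
def IsContDef (L : FirstOrder.Language.{u, v}) [L.Structure ℝ] {ℓ : ℕ} (B : Set (Fin ℓ → ℝ))
    (f : (Fin ℓ → ℝ) → ℝ) : Prop :=
  ContinuousOn f B ∧ Def L (graphOn (n := 1) (fun x _ => f x) B)

/-- Cells of length `ℓ`. The one-point space `ℝ^0` is taken as the only cell of length `0`, so that
the cells of length `1` are the points and the bounded open intervals. (Unbounded cells are not
needed: only cells contained in the open unit cube are used.) -/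
def IsCell (L : FirstOrder.Language.{u, v}) [L.Structure ℝ] : (ℓ : ℕ) → Set (Fin ℓ → ℝ) → Prop
  | 0, C => C = Set.univ
  | ℓ + 1, C => ∃ B : Set (Fin ℓ → ℝ), IsCell L ℓ B ∧
      ((∃ f, IsContDef L B f ∧
          C = {x | proj x ∈ B ∧ x (Fin.last ℓ) = f (proj x)}) ∨
        ∃ f g, IsContDef L B f ∧ IsContDef L B g ∧ (∀ x ∈ B, f x < g x) ∧
          C = {x | proj x ∈ B ∧ f (proj x) < x (Fin.last ℓ) ∧ x (Fin.last ℓ) < g (proj x)})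

/-- `Φ` is a cellular decomposition of `X`: a finite partition of `X` into cells. -/
def IsCellDecomp (L : FirstOrder.Language.{u, v}) [L.Structure ℝ] {ℓ : ℕ} (Φ : Set (Set (Fin ℓ → ℝ)))
    (X : Set (Fin ℓ → ℝ)) : Prop :=
  Φ.Finite ∧ (∀ C ∈ Φ, IsCell L ℓ C) ∧ Φ.PairwiseDisjoint id ∧ ⋃₀ Φ = X

/-- `Φ` is a cylindrical decomposition of `X`: a cellular decomposition whose projection to the
first `ℓ - 1` coordinates is again a cylindrical decomposition. -/
def IsCylDecomp (L : FirstOrder.Language.{u, v}) [L.Structure ℝ] :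
    (ℓ : ℕ) → Set (Set (Fin ℓ → ℝ)) → Set (Fin ℓ → ℝ) → Prop
  | 0, Φ, X => IsCellDecomp L Φ X
  | ℓ + 1, Φ, X => IsCellDecomp L Φ X ∧
      IsCylDecomp L ℓ ((fun C => proj '' C) '' Φ) (proj '' X)

/-- The open unit cube `(0,1)^ℓ`. -/
def openCube (ℓ : ℕ) : Set (Fin ℓ → ℝ) := {x | ∀ i, 0 < x i ∧ x i < 1}

/-- `A` is compatible with `X`: it is contained in `X` or disjoint from `X`. -/
def Compatible {ℓ : ℕ} (A X : Set (Fin ℓ → ℝ)) : Prop := A ⊆ X ∨ A ∩ X = ∅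

/-- Sharp cylindrical decomposition: any `s ≥ 1` subsets of `(0,1)^ℓ` of format `𝓕` and degree `D`
admit a compatible cylindrical decomposition of `(0,1)^ℓ` into `poly_𝓕(D, s)` cells of format
`O_𝓕(1)` and degree `poly_𝓕(D)`. -/
def HasSharpCD (L : FirstOrder.Language.{u, v}) [L.Structure ℝ] (Ω : FDFamily) : Prop :=
  ∃ (N : ℕ → MvPolynomial (Fin 2) ℕ) (c : ℕ → ℕ) (P : ℕ → Polynomial ℕ),
    ∀ (ℓ 𝓕 D s : ℕ), 1 ≤ ℓ → 1 ≤ s → ∀ X : Fin s → Set (Fin ℓ → ℝ),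
      (∀ i, X i ⊆ openCube ℓ ∧ X i ∈ Ω 𝓕 D ℓ) →
      ∃ Φ : Set (Set (Fin ℓ → ℝ)), IsCylDecomp L ℓ Φ (openCube ℓ) ∧
        Φ.ncard ≤ MvPolynomial.eval ![D, s] (N 𝓕) ∧
        ∀ C ∈ Φ, C ∈ Ω (c 𝓕) ((P 𝓕).eval D) ℓ ∧ ∀ i, Compatible C (X i)

/-! ### Forts -/

/-- Integer cells of length `1`: points `{k}` and intervals `(k, k+1)`. -/
def IsIntCell₁ (c : Set ℝ) : Prop := ∃ k : ℤ, c = {(k : ℝ)} ∨ c = Set.Ioo (k : ℝ) (k + 1)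

/-- Integer cells of length `ℓ`: products of `ℓ` integer cells of length `1`. -/
def IsIntCell {ℓ : ℕ} (C : Set (Fin ℓ → ℝ)) : Prop :=
  ∃ c : Fin ℓ → Set ℝ, (∀ i, IsIntCell₁ (c i)) ∧ C = {x | ∀ i, x i ∈ c i}

/-- `C(F)`, the integer cells contained in `F`. Distinct integer cells are disjoint and a fort is a
union of integer cells, so for a fort these are the parts of its natural partition. -/
def cells {ℓ : ℕ} (F : Set (Fin ℓ → ℝ)) : Set (Set (Fin ℓ → ℝ)) := {C | IsIntCell C ∧ C ⊆ F}

/-- Forts of length `ℓ`. The space `ℝ^0` serves as base of the recursion, so that the forts of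
length `1` are the intervals `(0, n)` with `n ≥ 1`; a fort of length `ℓ + 1` is
`{(x, y) : x ∈ B, 0 < y < h x}` for a fort `B` of length `ℓ` and a function `h` to the positive
integers that is constant on each cell of `B`. -/
def IsFort : (ℓ : ℕ) → Set (Fin ℓ → ℝ) → Prop
  | 0, F => F = Set.univ
  | ℓ + 1, F => ∃ (B : Set (Fin ℓ → ℝ)) (h : (Fin ℓ → ℝ) → ℕ), IsFort ℓ B ∧
      (∀ x ∈ B, 0 < h x) ∧ (∀ C ∈ cells B, ∀ x ∈ C, ∀ y ∈ C, h x = h y) ∧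
      F = {x | proj x ∈ B ∧ 0 < x (Fin.last ℓ) ∧ x (Fin.last ℓ) < h (proj x)}

/-- The integer cell of length `1` containing `t`. -/
def intCell₁ (t : ℝ) : Set ℝ :=
  open Classical in
  if t = (⌊t⌋ : ℝ) then {(⌊t⌋ : ℝ)} else Set.Ioo (⌊t⌋ : ℝ) (⌊t⌋ + 1)

theorem isIntCell₁_intCell₁ (t : ℝ) : IsIntCell₁ (intCell₁ t) := by
  refine ⟨⌊t⌋, ?_⟩
  unfold intCell₁
  split_ifs
  · exact Or.inl rfl
  · exact Or.inr rfl

theorem mem_intCell₁ (t : ℝ) : t ∈ intCell₁ t := by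
  unfold intCell₁
  split_ifs with h
  · exact h
  · exact ⟨lt_of_le_of_ne (Int.floor_le t) (Ne.symm h), Int.lt_floor_add_one t⟩

theorem intCell₁_bounds {t s : ℝ} {n : ℕ} (hs : s ∈ intCell₁ t) (h0 : 0 < t) (hn : t < n) :
    0 < s ∧ s < n := by
  unfold intCell₁ at hs
  split_ifs at hs with h
  · rw [Set.mem_singleton_iff, ← h] at hs
    exact hs ▸ ⟨h0, hn⟩
  · have h1 : (0 : ℤ) ≤ ⌊t⌋ := Int.floor_nonneg.2 h0.le
    have h2 : ⌊t⌋ < (n : ℤ) := Int.floor_lt.2 (by exact_mod_cast hn)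
    have h1' : (0 : ℝ) ≤ ⌊t⌋ := by exact_mod_cast h1
    have h2' : (⌊t⌋ : ℝ) + 1 ≤ n := by exact_mod_cast h2
    exact ⟨lt_of_le_of_lt h1' hs.1, lt_of_lt_of_le hs.2 h2'⟩

theorem IsIntCell₁.nonempty {c : Set ℝ} (h : IsIntCell₁ c) : c.Nonempty := by
  obtain ⟨k, rfl | rfl⟩ := h
  · exact ⟨k, rfl⟩
  · exact ⟨k + 1 / 2, by constructor <;> linarith⟩

theorem finite_intCell₁ (n : ℕ) : {c : Set ℝ | IsIntCell₁ c ∧ c ⊆ Set.Ioo 0 (n : ℝ)}.Finite := by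
  have hfin : (Set.Icc (0 : ℤ) n).Finite := Set.finite_Icc _ _
  refine ((hfin.image fun k : ℤ => ({(k : ℝ)} : Set ℝ)).union
    (hfin.image fun k : ℤ => Set.Ioo (k : ℝ) (k + 1))).subset ?_
  rintro c ⟨⟨k, rfl | rfl⟩, hc⟩
  · have h := hc rfl
    refine Or.inl ⟨k, ⟨?_, ?_⟩, rfl⟩
    · exact_mod_cast h.1.le
    · exact_mod_cast h.2.le
  · have h : ((k : ℝ) + 1 / 2) ∈ Set.Ioo 0 (n : ℝ) := hc ⟨by linarith, by linarith⟩
    have h1 : (-1 : ℝ) < k := by linarith [h.1]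
    have h2 : (k : ℝ) < n := by linarith [h.2]
    have h1' : -1 < k := by exact_mod_cast h1
    have h2' : k < n := by exact_mod_cast h2
    exact Or.inr ⟨k, ⟨by omega, h2'.le⟩, rfl⟩

/-- The integer cell of length `ℓ` containing `x`. -/
def intCell {ℓ : ℕ} (x : Fin ℓ → ℝ) : Set (Fin ℓ → ℝ) := {y | ∀ i, y i ∈ intCell₁ (x i)}

theorem isIntCell_intCell {ℓ : ℕ} (x : Fin ℓ → ℝ) : IsIntCell (intCell x) :=
  ⟨fun i => intCell₁ (x i), fun _ => isIntCell₁_intCell₁ _, rfl⟩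

theorem mem_intCell {ℓ : ℕ} (x : Fin ℓ → ℝ) : x ∈ intCell x := fun _ => mem_intCell₁ _

theorem finite_cells_of_bounded {ℓ : ℕ} {F : Set (Fin ℓ → ℝ)} {n : ℕ}
    (h : ∀ x ∈ F, ∀ i, 0 < x i ∧ x i < n) : (cells F).Finite := by
  classical
  refine ((Set.Finite.pi' fun _ : Fin ℓ => finite_intCell₁ n).image
    fun c : Fin ℓ → Set ℝ => {x : Fin ℓ → ℝ | ∀ i, x i ∈ c i}).subset ?_
  rintro C ⟨⟨c, hc, rfl⟩, hCF⟩
  refine ⟨c, fun i => ⟨hc i, fun t ht => ?_⟩, rfl⟩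
  choose p hp using fun j => (hc j).nonempty
  have := h (Function.update p i t) (hCF fun j => ?_) i
  · simpa using this
  · by_cases hj : j = i
    · subst hj; simpa using ht
    · simpa [hj] using hp j

theorem IsFort.aux : ∀ {ℓ : ℕ} {F : Set (Fin ℓ → ℝ)}, IsFort ℓ F →
    (∀ x ∈ F, intCell x ⊆ F) ∧ ∃ n : ℕ, ∀ x ∈ F, ∀ i, 0 < x i ∧ x i < n
  | 0, F, hF => by
    have hF : F = Set.univ := hF
    subst hF
    exact ⟨fun _ _ => Set.subset_univ _, 0, fun _ _ i => i.elim0⟩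
  | ℓ + 1, F, hF => by
    obtain ⟨B, h, hB, -, hconst, rfl⟩ := hF
    obtain ⟨hcell, n, hn⟩ := IsFort.aux hB
    have hfin : (h '' B).Finite := by
      refine ((finite_cells_of_bounded hn).biUnion (t := fun C => h '' C) fun C hC => ?_).subset ?_
      · refine Set.Subsingleton.finite ?_
        rintro _ ⟨x, hx, rfl⟩ _ ⟨y, hy, rfl⟩
        exact hconst C hC x hx y hy
      · rintro _ ⟨x, hx, rfl⟩
        exact Set.mem_biUnion (x := intCell x) ⟨isIntCell_intCell x, hcell x hx⟩
          ⟨x, mem_intCell x, rfl⟩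
    obtain ⟨m, hm⟩ := hfin.bddAbove
    refine ⟨fun x hx y hy => ?_, max n m, fun x hx i => ?_⟩
    · have hp : proj y ∈ intCell (proj x) := fun i => hy _
      have hpB := hcell _ hx.1
      have he : h (proj x) = h (proj y) :=
        hconst _ ⟨isIntCell_intCell _, hpB⟩ _ (mem_intCell _) _ hp
      exact ⟨hpB hp, by simpa only [he] using intCell₁_bounds (hy (Fin.last ℓ)) hx.2.1 hx.2.2⟩
    · refine Fin.lastCases ?_ (fun j => ?_) i
      · refine ⟨hx.2.1, hx.2.2.trans_le ?_⟩
        exact_mod_cast (hm ⟨_, hx.1, rfl⟩).trans (le_max_right n m)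
      · refine ⟨(hn _ hx.1 j).1, (hn _ hx.1 j).2.trans_le ?_⟩
        exact_mod_cast le_max_left n m

/-- A fort has finitely many cells, so that `(cells F).ncard` is their true number. -/
theorem IsFort.finite_cells {ℓ : ℕ} {F : Set (Fin ℓ → ℝ)} (hF : IsFort ℓ F) : (cells F).Finite :=
  let ⟨_, hn⟩ := hF.aux.2
  finite_cells_of_bounded hn

/-- The cells of a fort cover it. -/
theorem IsFort.sUnion_cells {ℓ : ℕ} {F : Set (Fin ℓ → ℝ)} (hF : IsFort ℓ F) : ⋃₀ cells F = F :=
  Set.Subset.antisymm (Set.sUnion_subset fun _ hC => hC.2) fun x hx =>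
    ⟨intCell x, ⟨isIntCell_intCell x, hF.aux.1 x hx⟩, mem_intCell x⟩

/-- `φ` is precellular on `X`: `φ_i` depends only on `x_1, …, x_i`, and is strictly increasing in
`x_i` when `x_1, …, x_{i-1}` are fixed. -/
def PrecellularOn {ℓ : ℕ} (φ : (Fin ℓ → ℝ) → (Fin ℓ → ℝ)) (X : Set (Fin ℓ → ℝ)) : Prop :=
  (∀ i, ∀ x ∈ X, ∀ y ∈ X, (∀ j ≤ i, x j = y j) → φ x i = φ y i) ∧
  (∀ i, ∀ x ∈ X, ∀ y ∈ X, (∀ j < i, x j = y j) → x i < y i → φ x i < φ y i)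

/-- `φ` restricts to a morphism of forts `F₁ → F₂`. -/
structure IsMorphism (L : FirstOrder.Language.{u, v}) [L.Structure ℝ] {ℓ : ℕ} (F₁ F₂ : Set (Fin ℓ → ℝ))
    (φ : (Fin ℓ → ℝ) → (Fin ℓ → ℝ)) : Prop where
  definable : Def L (graphOn φ F₁)
  image_eq : φ '' F₁ = F₂
  precellular : PrecellularOn φ F₁
  map_cell : ∀ C₁ ∈ cells F₁, ∃ C₂ ∈ cells F₂, φ '' C₁ ⊆ C₂
  continuousOn : ∀ C₁ ∈ cells F₁, ContinuousOn φ C₁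

/-- `φ_i(x_1, …, x_{i-1}, ·)` is affine on `C` for all `i` and all `x_1, …, x_{i-1}`. -/
def NaturalOn {ℓ : ℕ} (φ : (Fin ℓ → ℝ) → (Fin ℓ → ℝ)) (C : Set (Fin ℓ → ℝ)) : Prop :=
  ∀ i, ∀ x ∈ C, ∃ a b : ℝ, ∀ y ∈ C, (∀ j < i, y j = x j) → φ y i = a * y i + b

/-- `φ` restricts to a natural morphism of forts `F₁ → F₂`. -/
def IsNaturalMorphism (L : FirstOrder.Language.{u, v}) [L.Structure ℝ] {ℓ : ℕ} (F₁ F₂ : Set (Fin ℓ → ℝ))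
    (φ : (Fin ℓ → ℝ) → (Fin ℓ → ℝ)) : Prop :=
  IsMorphism L F₁ F₂ φ ∧ ∀ C₁ ∈ cells F₁, NaturalOn φ C₁

/-- The morphism `φ : F₁ → F₂` is compatible with the sets `X C j ⊆ C`, `C ∈ C(F₂)`, `j ∈ J`. -/
def MorphismCompatible {ℓ : ℕ} {J : Type w} (F₁ F₂ : Set (Fin ℓ → ℝ))
    (φ : (Fin ℓ → ℝ) → (Fin ℓ → ℝ)) (X : Set (Fin ℓ → ℝ) → J → Set (Fin ℓ → ℝ)) : Prop :=
  ∀ C₁ ∈ cells F₁, ∀ C ∈ cells F₂, ∀ j, Compatible (φ '' C₁) (X C j)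

end FortTheory

set_option linter.unusedSectionVars false

/-! A fort is bounded, so after division by a large `r` it lies in the open unit cube. Take a
cylindrical decomposition of the cube compatible with the rescaled integer cells and the rescaled
sets `X C j`, and keep the cells that lie in the rescaled fort. It is enough to parametrize this
decomposition by a fort whose integer cells go onto decomposition cells (`exists_fortChart`) and
then to multiply by `r` (`exists_naturalMorphism`).

The chart is built by induction on the length. Over a cell `B` of the projected decomposition the
cells form a stack: the graphs of functions `f 1 < ... < f k` and the bands between neighbours,
where `f 0 = 0` and `f (k + 1)` is the constant height over `B` (`exists_stack`). If the chart `ψ₁`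
of the base maps the integer cell `C₁` onto `B`, the new fort gets height `k + 1` over `C₁`, and the
new last coordinate is the piecewise linear interpolation of the values `f i (ψ₁ x)` placed at the
integers `i` (`FortChart.succ`). Integer levels go to graphs and unit intervals go affinely onto the
fibres of bands, which makes the map natural. Its graph over an integer cell is a projection of an
intersection of five sets of controlled complexity (`IsFDCalculus.graphOn_join`), so each induction
step changes formats and degrees in a controlled way. A precellular map is injective, so distinct
integer cells have distinct images and the size of the fort is at most the number of cells of the
decomposition.

In the sharp case the decomposition is part of the hypotheses. In the o-minimal case it is proved in
`hasCD` by a Baire category argument. The boundary points of the given sets in the fibres over `ℝ^m`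
form a family of finite sets. Every cell has a point near which this family consists of disjoint
continuous sections (`IsSections.regularOn_nonempty`), so the cells in the bad locus drop in
dimension and repeated refinement removes them. Over the resulting cells the sections cut the
cylinder into graphs and bands. Both cases then share one construction, written for `IsFDCalculus`;
the o-minimal case uses it for a trivial filtration. -/

namespace FortTheory

/-! ### Coordinates, and a calculus of definable sets and maps. -/

/-- The point of `ℝ^(ℓ+1)` with first coordinates `x` and last coordinate `t`. -/
def join {ℓ : ℕ} (x : Fin ℓ → ℝ) (t : ℝ) : Fin (ℓ + 1) → ℝ := Fin.snoc x t

@[simp] theorem proj_join {ℓ : ℕ} (x : Fin ℓ → ℝ) (t : ℝ) : proj (join x t) = x := by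
  ext i; simp [proj, join]

@[simp] theorem join_last {ℓ : ℕ} (x : Fin ℓ → ℝ) (t : ℝ) : join x t (Fin.last ℓ) = t := by
  simp [join]

@[simp] theorem join_castSucc {ℓ : ℕ} (x : Fin ℓ → ℝ) (t : ℝ) (i : Fin ℓ) :
    join x t i.castSucc = x i := by
  simp [join]

@[simp] theorem join_proj {ℓ : ℕ} (x : Fin (ℓ + 1) → ℝ) : join (proj x) (x (Fin.last ℓ)) = x :=
  Fin.snoc_init_self x

theorem join_eq_iff {ℓ : ℕ} {x : Fin ℓ → ℝ} {t : ℝ} {y : Fin (ℓ + 1) → ℝ} :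
    join x t = y ↔ x = proj y ∧ t = y (Fin.last ℓ) := by
  constructor
  · rintro rfl; simp
  · rintro ⟨rfl, rfl⟩; simp

@[fun_prop] theorem continuous_proj {ℓ : ℕ} :
    Continuous (proj : (Fin (ℓ + 1) → ℝ) → Fin ℓ → ℝ) :=
  continuous_pi fun _ => continuous_apply _

@[fun_prop] theorem continuous_join {X : Type*} [TopologicalSpace X] {ℓ : ℕ}
    {f : X → Fin ℓ → ℝ} {g : X → ℝ} (hf : Continuous f) (hg : Continuous g) :
    Continuous fun x => join (f x) (g x) :=
  Continuous.finSnoc hf hg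

@[fun_prop] theorem continuousOn_join {X : Type*} [TopologicalSpace X] {ℓ : ℕ}
    {f : X → Fin ℓ → ℝ} {g : X → ℝ} {s : Set X} (hf : ContinuousOn f s)
    (hg : ContinuousOn g s) : ContinuousOn (fun x => join (f x) (g x)) s :=
  ContinuousOn.finSnoc hf hg

/-- A type with a chosen bijection onto some `ι → ℝ`, `ι` finite. -/
class Coord (E : Type*) where
  ι : Type
  fin : Finite ι
  equiv : E ≃ (ι → ℝ)

attribute [instance] Coord.fin

instance : Coord ℝ := ⟨Unit, inferInstance, (Equiv.funUnique Unit ℝ).symm⟩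

/-- The chosen bijection is the identity, so that `Dfn` and `Def` agree by definition on `Fin n →
ℝ`. -/
instance (n : ℕ) : Coord (Fin n → ℝ) := ⟨Fin n, inferInstance, Equiv.refl _⟩

instance (E F : Type*) [Coord E] [Coord F] : Coord (E × F) :=
  ⟨Coord.ι E ⊕ Coord.ι F, inferInstance,
    (Equiv.prodCongr Coord.equiv Coord.equiv).trans (Equiv.sumArrowEquivProdArrow _ _ _).symm⟩

section Calculus

variable (L : FirstOrder.Language.{u, v}) [L.Structure ℝ]

/-- Definability of subsets of coordinate spaces. -/
def Dfn {E : Type*} [Coord E] (S : Set E) : Prop :=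
  (Set.univ : Set ℝ).Definable L {v : Coord.ι E → ℝ | Coord.equiv.symm v ∈ S}

/-- Definability of maps between coordinate spaces. -/
@[fun_prop]
def DefMap {E F : Type*} [Coord E] [Coord F] (f : E → F) : Prop :=
  Dfn L {p : E × F | p.2 = f p.1}

variable {L} {E F G : Type*} [Coord E] [Coord F] [Coord G]

theorem dfn_iff_def {ℓ : ℕ} {X : Set (Fin ℓ → ℝ)} : Dfn L X ↔ Def L X := Iff.rfl

theorem Dfn.and {P Q : E → Prop} (hP : Dfn L {x | P x}) (hQ : Dfn L {x | Q x}) :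
    Dfn L {x | P x ∧ Q x} := Set.Definable.inter hP hQ

theorem Dfn.or {P Q : E → Prop} (hP : Dfn L {x | P x}) (hQ : Dfn L {x | Q x}) :
    Dfn L {x | P x ∨ Q x} := Set.Definable.union hP hQ

theorem Dfn.not {P : E → Prop} (hP : Dfn L {x | P x}) : Dfn L {x | ¬ P x} :=
  Set.Definable.compl hP

theorem Dfn.imp {P Q : E → Prop} (hP : Dfn L {x | P x}) (hQ : Dfn L {x | Q x}) :
    Dfn L {x | P x → Q x} := by
  simpa only [imp_iff_not_or] using hP.not.or hQ

theorem Dfn.const (p : Prop) : Dfn L {_x : E | p} := by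
  by_cases h : p
  · simp only [h]; exact Set.definable_univ
  · simp only [h]; exact Set.definable_empty

theorem Dfn.forall_finite {κ : Type*} [Finite κ] {P : κ → E → Prop}
    (h : ∀ k, Dfn L {x | P k x}) : Dfn L {x | ∀ k, P k x} := by
  have := Set.definable_iInter_of_finite h
  unfold Dfn
  convert! this using 1
  ext v; simp

theorem Dfn.exists_finite {κ : Type*} [Finite κ] {P : κ → E → Prop}
    (h : ∀ k, Dfn L {x | P k x}) : Dfn L {x | ∃ k, P k x} := by
  have := Set.definable_iUnion_of_finite h
  unfold Dfn
  convert! this using 1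
  ext v; simp

/-- This is renaming of variables in a formula. It comes before general preimages and compositions
because their proofs move graphs into larger products by it. -/
theorem Dfn.coord {f : E → F} (h : ∀ k, ∃ j, ∀ x, Coord.equiv (f x) k = Coord.equiv x j)
    {S : Set F} (hS : Dfn L S) : Dfn L {x | f x ∈ S} := by
  choose σ hσ using h
  have := Set.Definable.preimage_comp σ hS
  unfold Dfn
  convert! this using 1
  ext v
  have : f (Coord.equiv.symm v) = Coord.equiv.symm (v ∘ σ) := by
    rw [Equiv.eq_symm_apply]
    ext k
    rw [hσ]; simp
  simp [this]

/-- Quantification over a whole coordinate space is a projection. Together with the Boolean lemmas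
it lets definability be read off from the shape of a defining formula. -/
theorem Dfn.exists {P : E → F → Prop} (h : Dfn L {p : E × F | P p.1 p.2}) :
    Dfn L {x | ∃ y, P x y} := by
  have := Set.Definable.image_comp h (Sum.inl : Coord.ι E → Coord.ι (E × F))
  unfold Dfn
  convert! this using 1
  ext v
  constructor
  · rintro ⟨y, hy⟩
    refine ⟨Coord.equiv (Coord.equiv.symm v, y), ?_, ?_⟩
    · simpa using hy
    · ext k
      change Coord.equiv (Coord.equiv.symm v) k = v k
      simp
  · rintro ⟨z, hz, rfl⟩
    exact ⟨_, hz⟩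

theorem Dfn.forall {P : E → F → Prop} (h : Dfn L {p : E × F | P p.1 p.2}) :
    Dfn L {x | ∀ y, P x y} := by
  have := (Dfn.exists (P := fun x y => ¬ P x y) h.not).not
  simpa only [not_exists, not_not] using this

theorem Dfn.eq_coords (i j : Coord.ι E) :
    Dfn L {x : E | Coord.equiv x i = Coord.equiv x j} := by
  refine ⟨(FirstOrder.Language.var i).equal (FirstOrder.Language.var j), ?_⟩
  ext v
  simp

theorem Dfn.diag : Dfn L {p : E × E | p.2 = p.1} := by
  have : {p : E × E | p.2 = p.1} =
      {p : E × E | ∀ k, Coord.equiv p (Sum.inr k) = Coord.equiv p (Sum.inl k)} := by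
    ext p
    constructor
    · intro h k
      change Coord.equiv p.2 k = Coord.equiv p.1 k
      rw [show p.2 = p.1 from h]
    · intro h
      exact Coord.equiv.injective (funext h)
  rw [this]
  exact Dfn.forall_finite fun k => Dfn.eq_coords _ _

theorem DefMap.of_coord {f : E → F} (h : ∀ k, ∃ j, ∀ x, Coord.equiv (f x) k = Coord.equiv x j) :
    DefMap L f := by
  refine Dfn.coord (f := fun p : E × F => (f p.1, p.2)) (S := {p : F × F | p.2 = p.1}) ?_ Dfn.diag
  rintro (k | k)
  · obtain ⟨j, hj⟩ := h k
    exact ⟨Sum.inl j, fun x => hj x.1⟩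
  · exact ⟨Sum.inr k, fun x => rfl⟩

theorem Dfn.preimage {f : E → F} (hf : DefMap L f) {S : Set F} (hS : Dfn L S) :
    Dfn L {x | f x ∈ S} := by
  have h : Dfn L {p : E × F | p.2 = f p.1 ∧ p.2 ∈ S} :=
    Dfn.and hf (Dfn.coord (f := Prod.snd) (fun k => ⟨Sum.inr k, fun x => rfl⟩) hS)
  simpa using Dfn.exists (P := fun x y => y = f x ∧ y ∈ S) h

@[fun_prop] theorem DefMap.id : DefMap L (fun x : E => x) :=
  DefMap.of_coord fun k => ⟨k, fun _ => rfl⟩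

@[fun_prop] theorem DefMap.fst' : DefMap L (fun p : E × F => p.1) :=
  DefMap.of_coord fun k => ⟨Sum.inl k, fun _ => rfl⟩

@[fun_prop] theorem DefMap.snd' : DefMap L (fun p : E × F => p.2) :=
  DefMap.of_coord fun k => ⟨Sum.inr k, fun _ => rfl⟩

@[fun_prop] theorem DefMap.comp {f : F → G} {g : E → F} (hf : DefMap L f) (hg : DefMap L g) :
    DefMap L (fun x => f (g x)) := by
  have h1 : Dfn L {p : (E × G) × F | p.2 = g p.1.1} :=
    Dfn.coord (f := fun p : (E × G) × F => (p.1.1, p.2)) (by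
      rintro (k | k)
      · exact ⟨Sum.inl (Sum.inl k), fun _ => rfl⟩
      · exact ⟨Sum.inr k, fun _ => rfl⟩) hg
  have h2 : Dfn L {p : (E × G) × F | p.1.2 = f p.2} :=
    Dfn.coord (f := fun p : (E × G) × F => (p.2, p.1.2)) (by
      rintro (k | k)
      · exact ⟨Sum.inr k, fun _ => rfl⟩
      · exact ⟨Sum.inl (Sum.inr k), fun _ => rfl⟩) hf
  have := Dfn.exists (P := fun (x : E × G) y => y = g x.1 ∧ x.2 = f y) (h1.and h2)
  simpa [DefMap] using this

@[fun_prop] theorem DefMap.prodMk {f : E → F} {g : E → G} (hf : DefMap L f) (hg : DefMap L g) :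
    DefMap L (fun x => (f x, g x)) := by
  have h1 : Dfn L {p : E × (F × G) | p.2.1 = f p.1} :=
    Dfn.coord (f := fun p : E × (F × G) => (p.1, p.2.1)) (by
      rintro (k | k)
      · exact ⟨Sum.inl k, fun _ => rfl⟩
      · exact ⟨Sum.inr (Sum.inl k), fun _ => rfl⟩) hf
  have h2 : Dfn L {p : E × (F × G) | p.2.2 = g p.1} :=
    Dfn.coord (f := fun p : E × (F × G) => (p.1, p.2.2)) (by
      rintro (k | k)
      · exact ⟨Sum.inl k, fun _ => rfl⟩
      · exact ⟨Sum.inr (Sum.inr k), fun _ => rfl⟩) hg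
  have := h1.and h2
  simpa only [DefMap, Prod.ext_iff] using this

@[fun_prop] theorem DefMap.fst {f : E → F × G} (hf : DefMap L f) : DefMap L (fun x => (f x).1) :=
  DefMap.comp DefMap.fst' hf

@[fun_prop] theorem DefMap.snd {f : E → F × G} (hf : DefMap L f) : DefMap L (fun x => (f x).2) :=
  DefMap.comp DefMap.snd' hf

@[fun_prop] theorem DefMap.apply {n : ℕ} (i : Fin n) : DefMap L (fun f : Fin n → ℝ => f i) :=
  DefMap.of_coord fun _ => ⟨i, fun _ => rfl⟩

@[fun_prop] theorem DefMap.pi {n : ℕ} {f : E → Fin n → ℝ} (h : ∀ i, DefMap L (fun x => f x i)) :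
    DefMap L f := by
  have h1 : ∀ i, Dfn L {p : E × (Fin n → ℝ) | p.2 i = f p.1 i} := fun i =>
    Dfn.coord (f := fun p : E × (Fin n → ℝ) => (p.1, p.2 i)) (by
      rintro (k | k)
      · exact ⟨Sum.inl k, fun _ => rfl⟩
      · exact ⟨Sum.inr i, fun _ => rfl⟩) (h i)
  have := Dfn.forall_finite h1
  simpa only [DefMap, funext_iff] using this

@[fun_prop] theorem DefMap.proj {n : ℕ} : DefMap L (proj : (Fin (n + 1) → ℝ) → Fin n → ℝ) :=
  DefMap.of_coord fun k => ⟨Fin.castSucc k, fun _ => rfl⟩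

@[fun_prop] theorem DefMap.join {n : ℕ} {f : E → Fin n → ℝ} {g : E → ℝ} (hf : DefMap L f)
    (hg : DefMap L g) : DefMap L (fun x => join (f x) (g x)) := by
  refine DefMap.pi fun i => ?_
  refine Fin.lastCases ?_ (fun j => ?_) i
  · simpa using hg
  · simpa using DefMap.comp (DefMap.apply j) hf

@[fun_prop] theorem DefMap.const (c : F) : DefMap L (fun _ : E => c) := by
  have h : Dfn L {p : F | p = c} := by
    have : {p : F | p = c} = {p : F | ∀ k, Coord.equiv p k = Coord.equiv c k} := by
      ext p
      rw [Set.mem_ofPred_eq, Set.mem_ofPred_eq, ← funext_iff, Coord.equiv.injective.eq_iff]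
    rw [this]
    refine Dfn.forall_finite fun k => ?_
    have := (Set.Definable.singleton_of_mem L (A := Set.univ)
      (Set.mem_univ (Coord.equiv c k))).preimage_comp (fun _ : Fin 1 => k)
    unfold Dfn
    convert! this using 1
    ext v; simp
  exact Dfn.preimage DefMap.snd' h

theorem Dfn.eq {f g : E → F} (hf : DefMap L f) (hg : DefMap L g) : Dfn L {x | f x = g x} :=
  Dfn.preimage (f := fun x => (g x, f x)) (by fun_prop) Dfn.diag

variable [hL : Fact (IsOMinimalExpansion L)]

@[fun_prop] theorem DefMap.add {f g : E → ℝ} (hf : DefMap L f) (hg : DefMap L g) :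
    DefMap L (fun x => f x + g x) := by
  have h := dfn_iff_def.2 hL.out.definable_add
  have h2 : Dfn L {p : E × ℝ | ![f p.1, g p.1, p.2] ∈ {x : Fin 3 → ℝ | x 2 = x 0 + x 1}} :=
    Dfn.preimage (DefMap.pi fun i => by fin_cases i <;> simp <;> fun_prop) h
  simpa [DefMap] using h2

@[fun_prop] theorem DefMap.mul {f g : E → ℝ} (hf : DefMap L f) (hg : DefMap L g) :
    DefMap L (fun x => f x * g x) := by
  have h := dfn_iff_def.2 hL.out.definable_mul
  have h2 : Dfn L {p : E × ℝ | ![f p.1, g p.1, p.2] ∈ {x : Fin 3 → ℝ | x 2 = x 0 * x 1}} :=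
    Dfn.preimage (DefMap.pi fun i => by fin_cases i <;> simp <;> fun_prop) h
  simpa [DefMap] using h2

@[fun_prop] theorem DefMap.neg {f : E → ℝ} (hf : DefMap L f) : DefMap L (fun x => - f x) := by
  simpa using (DefMap.const (-1)).mul hf

@[fun_prop] theorem DefMap.sub {f g : E → ℝ} (hf : DefMap L f) (hg : DefMap L g) :
    DefMap L (fun x => f x - g x) := by
  simp only [sub_eq_add_neg]; fun_prop

theorem Dfn.le {f g : E → ℝ} (hf : DefMap L f) (hg : DefMap L g) : Dfn L {x | f x ≤ g x} := by
  have : {x | f x ≤ g x} = {x | ∃ z : ℝ, g x = f x + z * z} := by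
    ext x
    constructor
    · intro h
      refine ⟨√(g x - f x), ?_⟩
      rw [Real.mul_self_sqrt (sub_nonneg.2 h)]; ring
    · rintro ⟨z, hz⟩
      have := mul_self_nonneg z
      simp only [Set.mem_ofPred_eq]; linarith
  rw [this]
  exact Dfn.exists (Dfn.eq (by fun_prop) (by fun_prop))

theorem Dfn.lt {f g : E → ℝ} (hf : DefMap L f) (hg : DefMap L g) : Dfn L {x | f x < g x} := by
  simpa only [not_le] using (Dfn.le hg hf).not

theorem Dfn.abs_lt {f g : E → ℝ} (hf : DefMap L f) (hg : DefMap L g) :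
    Dfn L {x | |f x| < g x} := by
  simpa only [_root_.abs_lt] using (Dfn.lt hg.neg hf).and (Dfn.lt hf hg)

end Calculus

end FortTheory

/-! ### Cells: topology, dimension, and generic behaviour of definable sets on them. -/

namespace FortTheory

section Cells

variable {ℓ : ℕ}

/-- The graph of `f` over `B`. -/
def graphCell (B : Set (Fin ℓ → ℝ)) (f : (Fin ℓ → ℝ) → ℝ) : Set (Fin (ℓ + 1) → ℝ) :=
  {x | proj x ∈ B ∧ x (Fin.last ℓ) = f (proj x)}

/-- The band between `f` and `g` over `B`. -/
def bandCell (B : Set (Fin ℓ → ℝ)) (f g : (Fin ℓ → ℝ) → ℝ) : Set (Fin (ℓ + 1) → ℝ) :=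
  {x | proj x ∈ B ∧ f (proj x) < x (Fin.last ℓ) ∧ x (Fin.last ℓ) < g (proj x)}

@[simp] theorem join_mem_graphCell {B : Set (Fin ℓ → ℝ)} {f x t} :
    join x t ∈ graphCell B f ↔ x ∈ B ∧ t = f x := by
  simp [graphCell]

@[simp] theorem join_mem_bandCell {B : Set (Fin ℓ → ℝ)} {f g x t} :
    join x t ∈ bandCell B f g ↔ x ∈ B ∧ f x < t ∧ t < g x := by
  simp [bandCell]

theorem proj_image_graphCell (B : Set (Fin ℓ → ℝ)) (f) : proj '' graphCell B f = B := by
  ext x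
  constructor
  · rintro ⟨y, hy, rfl⟩; exact hy.1
  · intro hx; exact ⟨join x (f x), by simpa using hx, by simp⟩

theorem proj_image_bandCell {B : Set (Fin ℓ → ℝ)} {f g : (Fin ℓ → ℝ) → ℝ}
    (h : ∀ x ∈ B, f x < g x) : proj '' bandCell B f g = B := by
  ext x
  constructor
  · rintro ⟨y, hy, rfl⟩; exact hy.1
  · intro hx
    obtain ⟨t, h1, h2⟩ := exists_between (h x hx)
    exact ⟨join x t, by simp [hx, h1, h2], by simp⟩

theorem graphCell_eq_image (B : Set (Fin ℓ → ℝ)) (f) :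
    graphCell B f = (fun x => join x (f x)) '' B := by
  ext y
  constructor
  · rintro ⟨h, h'⟩; exact ⟨proj y, h, by simp [← h']⟩
  · rintro ⟨x, hx, rfl⟩; simpa using hx

/-- The parametrization is affine in each fibre; it carries connectedness from `B × (0,1)` to the
band. -/
theorem bandCell_eq_image {B : Set (Fin ℓ → ℝ)} {f g : (Fin ℓ → ℝ) → ℝ}
    (h : ∀ x ∈ B, f x < g x) :
    bandCell B f g =
      (fun p : (Fin ℓ → ℝ) × ℝ => join p.1 (f p.1 + p.2 * (g p.1 - f p.1))) ''
        (B ×ˢ Set.Ioo 0 1) := by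
  ext y
  constructor
  · rintro ⟨h0, h1, h2⟩
    have h3 := sub_pos.2 (h _ h0)
    refine ⟨(proj y, (y (Fin.last ℓ) - f (proj y)) / (g (proj y) - f (proj y))),
      ⟨h0, div_pos (by linarith) h3, (div_lt_one h3).2 (by linarith)⟩, ?_⟩
    simp only [join_eq_iff, true_and]
    field_simp
    ring
  · rintro ⟨⟨x, t⟩, ⟨hx, h1, h2⟩, rfl⟩
    have h3 := sub_pos.2 (h _ hx)
    simp only [join_mem_bandCell]
    exact ⟨hx, by nlinarith, by nlinarith⟩

theorem isPreconnected_graphCell {B : Set (Fin ℓ → ℝ)} {f} (hB : IsPreconnected B)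
    (hf : ContinuousOn f B) : IsPreconnected (graphCell B f) := by
  rw [graphCell_eq_image]
  exact hB.image _ (continuousOn_join continuousOn_id hf)

theorem isPreconnected_bandCell {B : Set (Fin ℓ → ℝ)} {f g} (hB : IsPreconnected B)
    (hf : ContinuousOn f B) (hg : ContinuousOn g B) (h : ∀ x ∈ B, f x < g x) :
    IsPreconnected (bandCell B f g) := by
  rw [bandCell_eq_image h]
  refine (hB.prod isPreconnected_Ioo).image _ ?_
  have hm : Set.MapsTo Prod.fst (B ×ˢ Set.Ioo (0 : ℝ) 1) B := fun p hp => hp.1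
  have h1 := hf.comp continuous_fst.continuousOn hm
  have h2 := hg.comp continuous_fst.continuousOn hm
  exact continuousOn_join continuous_fst.continuousOn
    (h1.add (continuous_snd.continuousOn.mul (h2.sub h1)))

theorem exists_open_bandCell {B : Set (Fin ℓ → ℝ)} {f g} (hf : ContinuousOn f B)
    (hg : ContinuousOn g B) :
    ∃ U : Set (Fin (ℓ + 1) → ℝ), IsOpen U ∧ bandCell B f g = U ∩ proj ⁻¹' B := by
  have hm : Set.MapsTo proj (proj ⁻¹' B : Set (Fin (ℓ + 1) → ℝ)) B := fun p hp => hp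
  have h1 := hf.comp continuous_proj.continuousOn hm
  have h2 := hg.comp continuous_proj.continuousOn hm
  have h0 : ContinuousOn (fun x : Fin (ℓ + 1) → ℝ => x (Fin.last ℓ)) (proj ⁻¹' B) :=
    (continuous_apply _).continuousOn
  obtain ⟨U, hU, hU'⟩ := continuousOn_iff'.1 (h0.sub h1) (Set.Ioi 0) isOpen_Ioi
  obtain ⟨V, hV, hV'⟩ := continuousOn_iff'.1 (h2.sub h0) (Set.Ioi 0) isOpen_Ioi
  refine ⟨U ∩ V, hU.inter hV, ?_⟩
  rw [Set.inter_inter_distrib_right, ← hU', ← hV']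
  ext x
  simp [bandCell]
  tauto

theorem exists_closed_graphCell {B : Set (Fin ℓ → ℝ)} {f} (hf : ContinuousOn f B) :
    ∃ K : Set (Fin (ℓ + 1) → ℝ), IsClosed K ∧ graphCell B f = K ∩ proj ⁻¹' B := by
  have hm : Set.MapsTo proj (proj ⁻¹' B : Set (Fin (ℓ + 1) → ℝ)) B := fun p hp => hp
  have h1 := hf.comp continuous_proj.continuousOn hm
  have h0 : ContinuousOn (fun x : Fin (ℓ + 1) → ℝ => x (Fin.last ℓ)) (proj ⁻¹' B) :=
    (continuous_apply _).continuousOn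
  obtain ⟨K, hK, hK'⟩ := continuousOn_iff_isClosed.1 (h0.sub h1) {0} isClosed_singleton
  refine ⟨K, hK, ?_⟩
  rw [← hK']
  ext x
  simp [graphCell, sub_eq_zero]
  tauto

theorem isLocallyClosed_graphCell {B : Set (Fin ℓ → ℝ)} {f} (hB : IsLocallyClosed B)
    (hf : ContinuousOn f B) : IsLocallyClosed (graphCell B f) := by
  obtain ⟨K, hK, h⟩ := exists_closed_graphCell hf
  rw [h]
  exact hK.isLocallyClosed.inter (hB.preimage continuous_proj)

theorem isLocallyClosed_bandCell {B : Set (Fin ℓ → ℝ)} {f g} (hB : IsLocallyClosed B)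
    (hf : ContinuousOn f B) (hg : ContinuousOn g B) : IsLocallyClosed (bandCell B f g) := by
  obtain ⟨K, hK, h⟩ := exists_open_bandCell hf hg
  rw [h]
  exact hK.isLocallyClosed.inter (hB.preimage continuous_proj)

variable {L : FirstOrder.Language.{u, v}} [L.Structure ℝ]

theorem mem_graphOn_one {B : Set (Fin ℓ → ℝ)} {f : (Fin ℓ → ℝ) → ℝ} {z : Fin (ℓ + 1) → ℝ} :
    z ∈ graphOn (n := 1) (fun x _ => f x) B ↔ z ∈ graphCell B f := by
  have h : ∀ x, Fin.append x (fun _ : Fin 1 => f x) = join x (f x) := fun x =>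
    Fin.append_right_eq_snoc _ _
  simp only [graphOn, Set.mem_ofPred_eq, h, graphCell_eq_image, Set.mem_image, eq_comm]

theorem isContDef_iff {B : Set (Fin ℓ → ℝ)} {f : (Fin ℓ → ℝ) → ℝ} :
    IsContDef L B f ↔ ContinuousOn f B ∧ Dfn L (graphCell B f) := by
  rw [IsContDef, ← dfn_iff_def, show graphOn (n := 1) (fun x _ => f x) B = graphCell B f from
    Set.ext fun _ => mem_graphOn_one]

variable [hL : Fact (IsOMinimalExpansion L)]

theorem IsContDef.of_defMap {B : Set (Fin ℓ → ℝ)} {f} (hB : Dfn L B) (hf : DefMap L f)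
    (hc : ContinuousOn f B) : IsContDef L B f := by
  refine isContDef_iff.2 ⟨hc, Dfn.and (Dfn.preimage (by fun_prop) hB)
    (Dfn.eq (by fun_prop) (by fun_prop))⟩

theorem IsContDef.dfn_bandCell {B : Set (Fin ℓ → ℝ)} {f g} (hf : IsContDef L B f)
    (hg : IsContDef L B g) : Dfn L (bandCell B f g) := by
  have h1 := (isContDef_iff.1 hf).2
  have h2 := (isContDef_iff.1 hg).2
  -- Only the graphs of `f` and `g` over `B` are known to be definable, so their values enter as
  -- quantified points of these graphs.
  have : Dfn L {x : Fin (ℓ + 1) → ℝ | ∃ u v : ℝ, (join (proj x) u ∈ graphCell B f ∧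
      join (proj x) v ∈ graphCell B g) ∧ u < x (Fin.last ℓ) ∧ x (Fin.last ℓ) < v} := by
    refine Dfn.exists (Dfn.exists (Dfn.and (Dfn.and ?_ ?_) (Dfn.and ?_ ?_)))
    · exact Dfn.preimage (by fun_prop) h1
    · exact Dfn.preimage (by fun_prop) h2
    · exact Dfn.lt (by fun_prop) (by fun_prop)
    · exact Dfn.lt (by fun_prop) (by fun_prop)
  convert! this using 1
  ext x
  simp [bandCell]

/-! ### Dimension of cells -/

variable (L) in
/-- Cells of length `ℓ` and dimension `d`. -/
def IsCellDim : (ℓ : ℕ) → (d : ℕ) → Set (Fin ℓ → ℝ) → Prop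
  | 0, d, C => d = 0 ∧ C = Set.univ
  | ℓ + 1, d, C => ∃ B : Set (Fin ℓ → ℝ),
      (IsCellDim ℓ d B ∧ ∃ f, IsContDef L B f ∧ C = graphCell B f) ∨
      ∃ e, d = e + 1 ∧ IsCellDim ℓ e B ∧
        ∃ f g, IsContDef L B f ∧ IsContDef L B g ∧ (∀ x ∈ B, f x < g x) ∧ C = bandCell B f g

theorem isCell_succ {C : Set (Fin (ℓ + 1) → ℝ)} : IsCell L (ℓ + 1) C ↔
    ∃ B : Set (Fin ℓ → ℝ), IsCell L ℓ B ∧ ((∃ f, IsContDef L B f ∧ C = graphCell B f) ∨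
      ∃ f g, IsContDef L B f ∧ IsContDef L B g ∧ (∀ x ∈ B, f x < g x) ∧ C = bandCell B f g) :=
  Iff.rfl

theorem isCell_iff : ∀ {ℓ : ℕ} {C : Set (Fin ℓ → ℝ)}, IsCell L ℓ C ↔ ∃ d, IsCellDim L ℓ d C
  | 0, C => by simp [IsCell, IsCellDim]
  | ℓ + 1, C => by
    constructor
    · rintro ⟨B, hB, ⟨f, hf, rfl⟩ | ⟨f, g, hf, hg, h, rfl⟩⟩
      · obtain ⟨d, hd⟩ := isCell_iff.1 hB
        exact ⟨d, B, Or.inl ⟨hd, f, hf, rfl⟩⟩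
      · obtain ⟨d, hd⟩ := isCell_iff.1 hB
        exact ⟨d + 1, B, Or.inr ⟨d, rfl, hd, f, g, hf, hg, h, rfl⟩⟩
    · rintro ⟨d, B, ⟨hB, f, hf, rfl⟩ | ⟨e, rfl, hB, f, g, hf, hg, h, rfl⟩⟩
      · exact ⟨B, isCell_iff.2 ⟨d, hB⟩, Or.inl ⟨f, hf, rfl⟩⟩
      · exact ⟨B, isCell_iff.2 ⟨e, hB⟩, Or.inr ⟨f, g, hf, hg, h, rfl⟩⟩

theorem IsCell.nonempty : ∀ {ℓ : ℕ} {C : Set (Fin ℓ → ℝ)}, IsCell L ℓ C → C.Nonempty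
  | 0, C, h => by rw [show C = Set.univ from h]; exact Set.univ_nonempty
  | ℓ + 1, C, h => by
    obtain ⟨B, hB, ⟨f, hf, rfl⟩ | ⟨f, g, hf, hg, h, rfl⟩⟩ := h
    · exact Set.image_nonempty.1 ((proj_image_graphCell B f).symm ▸ hB.nonempty)
    · exact Set.image_nonempty.1 ((proj_image_bandCell h).symm ▸ hB.nonempty)

theorem IsCell.isPreconnected :
    ∀ {ℓ : ℕ} {C : Set (Fin ℓ → ℝ)}, IsCell L ℓ C → IsPreconnected C
  | 0, C, h => Set.subsingleton_of_subsingleton.isPreconnected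
  | ℓ + 1, C, h => by
    obtain ⟨B, hB, ⟨f, hf, rfl⟩ | ⟨f, g, hf, hg, h, rfl⟩⟩ := h
    · exact isPreconnected_graphCell hB.isPreconnected hf.1
    · exact isPreconnected_bandCell hB.isPreconnected hf.1 hg.1 h

/-- Local closedness makes a cell a locally compact Hausdorff space, so that Baire's theorem holds
in it. -/
theorem IsCell.isLocallyClosed :
    ∀ {ℓ : ℕ} {C : Set (Fin ℓ → ℝ)}, IsCell L ℓ C → IsLocallyClosed C
  | 0, C, h => by rw [show C = Set.univ from h]; exact isOpen_univ.isLocallyClosed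
  | ℓ + 1, C, h => by
    obtain ⟨B, hB, ⟨f, hf, rfl⟩ | ⟨f, g, hf, hg, h, rfl⟩⟩ := h
    · exact isLocallyClosed_graphCell hB.isLocallyClosed hf.1
    · exact isLocallyClosed_bandCell hB.isLocallyClosed hf.1 hg.1

theorem IsCell.dfn : ∀ {ℓ : ℕ} {C : Set (Fin ℓ → ℝ)}, IsCell L ℓ C → Dfn L C
  | 0, C, h => by rw [show C = Set.univ from h]; exact Dfn.const True
  | ℓ + 1, C, h => by
    obtain ⟨B, hB, ⟨f, hf, rfl⟩ | ⟨f, g, hf, hg, h, rfl⟩⟩ := h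
    · exact (isContDef_iff.1 hf).2
    · exact hf.dfn_bandCell hg

theorem IsCellDim.le_length : ∀ {ℓ d : ℕ} {C : Set (Fin ℓ → ℝ)}, IsCellDim L ℓ d C → d ≤ ℓ
  | 0, d, C, h => h.1.le
  | ℓ + 1, d, C, h => by
    obtain ⟨B, ⟨hB, -⟩ | ⟨e, rfl, hB, -⟩⟩ := h
    · exact hB.le_length.trans ℓ.le_succ
    · exact Nat.succ_le_succ hB.le_length

/-- A cell contained in a cell has at most the same dimension, and is relatively open in case of
equality. -/
theorem IsCellDim.subset : ∀ {ℓ d d' : ℕ} {C C' : Set (Fin ℓ → ℝ)}, IsCellDim L ℓ d C →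
    IsCellDim L ℓ d' C' → C' ⊆ C → d' ≤ d ∧ (d' = d → ∃ U, IsOpen U ∧ C' = U ∩ C)
  | 0, d, d', C, C', h, h', _ => by
    obtain ⟨rfl, rfl⟩ := h
    obtain ⟨rfl, rfl⟩ := h'
    exact ⟨le_rfl, fun _ => ⟨Set.univ, isOpen_univ, by simp⟩⟩
  | ℓ + 1, d, d', C, C', h, h', hs => by
    obtain ⟨B, h⟩ := h
    obtain ⟨B', h'⟩ := h'
    have hpB : proj '' C = B := by
      obtain ⟨-, f, -, rfl⟩ | ⟨e, -, -, f, g, -, -, h, rfl⟩ := h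
      exacts [proj_image_graphCell B f, proj_image_bandCell h]
    have hpB' : proj '' C' = B' := by
      obtain ⟨-, f, -, rfl⟩ | ⟨e, -, -, f, g, -, -, h, rfl⟩ := h'
      exacts [proj_image_graphCell B' f, proj_image_bandCell h]
    have hBB : B' ⊆ B := by rw [← hpB, ← hpB']; exact Set.image_mono hs
    obtain ⟨hB, f, hf, rfl⟩ | ⟨e, rfl, hB, f, g, hf, hg, hfg, rfl⟩ := h
    · obtain ⟨hB', f', hf', rfl⟩ | ⟨e', rfl, hB', f', g', hf', hg', hfg', rfl⟩ := h'
      · obtain ⟨h1, h2⟩ := hB.subset hB' hBB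
        refine ⟨h1, fun h => ?_⟩
        obtain ⟨U, hU, hU'⟩ := h2 h
        refine ⟨proj ⁻¹' U, hU.preimage continuous_proj, Set.Subset.antisymm (fun x hx =>
          ⟨(hU' ▸ hx.1 : proj x ∈ U ∩ B).1, hs hx⟩) ?_⟩
        rintro x ⟨hx, hx'⟩
        have hxB : proj x ∈ B' := hU' ▸ ⟨hx, hx'.1⟩
        have := hs (show join (proj x) (f' (proj x)) ∈ graphCell B' f' by simpa using hxB)
        simp only [join_mem_graphCell] at this
        exact ⟨hxB, hx'.2.trans this.2.symm⟩
      -- A band has two points in one fibre and a graph has only one.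
      · exfalso
        obtain ⟨x, hx⟩ := (isCell_iff.2 ⟨_, hB'⟩).nonempty
        obtain ⟨t, h1, h2⟩ := exists_between (hfg' x hx)
        obtain ⟨t', h1', h2'⟩ := exists_between h2
        have k1 := hs (show join x t ∈ bandCell B' f' g' by simp [*])
        have k2 := hs (show join x t' ∈ bandCell B' f' g' by simp [*]; linarith)
        simp only [join_mem_graphCell] at k1 k2
        linarith [k1.2, k2.2]
    · obtain ⟨hB', f', hf', rfl⟩ | ⟨e', rfl, hB', f', g', hf', hg', hfg', rfl⟩ := h'
      · obtain ⟨h1, -⟩ := hB.subset hB' hBB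
        exact ⟨h1.trans e.le_succ, fun h => by omega⟩
      · obtain ⟨h1, h2⟩ := hB.subset hB' hBB
        refine ⟨Nat.succ_le_succ h1, fun h => ?_⟩
        obtain ⟨U, hU, hU'⟩ := h2 (Nat.succ_injective h)
        obtain ⟨V, hV, hV'⟩ := exists_open_bandCell hf'.1 hg'.1
        refine ⟨V ∩ proj ⁻¹' U, hV.inter (hU.preimage continuous_proj),
          Set.Subset.antisymm (fun x hx => ⟨⟨(hV' ▸ hx : x ∈ V ∩ proj ⁻¹' B').1,
            (hU' ▸ hx.1 : proj x ∈ U ∩ B).1⟩, hs hx⟩) ?_⟩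
        rintro x ⟨⟨hx, hx''⟩, hx'⟩
        have hxB : proj x ∈ B' := hU' ▸ ⟨hx'', hx'.1⟩
        exact hV' ▸ ⟨hx, hxB⟩

/-! ### Definable sets of reals -/

/-- By o-minimality the set either contains an interval inside `(a, b)` or has only finitely many
points there, which can be avoided. Rational end points keep the possible intervals countable, as
Baire's theorem requires. -/
theorem Dfn.exists_rat_Ioo {S : Set ℝ} (hS : Dfn L S) {a b : ℝ} (hab : a < b) :
    ∃ q r : ℚ, a < q ∧ (q : ℝ) < r ∧ (r : ℝ) < b ∧
      ((∀ t, (q : ℝ) < t → t < r → t ∈ S) ∨ ∀ t, (q : ℝ) < t → t < r → t ∉ S) := by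
  obtain ⟨T, hT, hT', rfl⟩ := hL.out.finite_union S
    (Dfn.preimage (f := fun x : Fin 1 → ℝ => x 0) (by fun_prop) hS)
  by_cases h : ∃ A ∈ T, (A ∩ Set.Ioo a b).Nontrivial
  · obtain ⟨A, hA, u, hu, v, hv, huv⟩ := h
    wlog huv' : u < v generalizing u v
    · exact this v hv u hu huv.symm (lt_of_le_of_ne (not_lt.1 huv') huv.symm)
    obtain ⟨q, h1, h2⟩ := exists_rat_btwn huv'
    obtain ⟨r, h3, h4⟩ := exists_rat_btwn h2
    refine ⟨q, r, hu.2.1.trans h1, h3, h4.trans hv.2.2, Or.inl fun t ht ht' => ?_⟩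
    exact ⟨A, hA, (hT' A hA).out hu.1 hv.1 ⟨(h1.trans ht).le, (ht'.trans h4).le⟩⟩
  · push Not at h
    have hfin : (⋃₀ T ∩ Set.Ioo a b).Finite := by
      rw [Set.sUnion_eq_biUnion, Set.iUnion₂_inter]
      exact hT.biUnion fun A hA => (h A hA).finite
    have hopen : IsOpen (Set.Ioo a b \ (⋃₀ T ∩ Set.Ioo a b)) :=
      isOpen_Ioo.sdiff hfin.isClosed
    obtain ⟨c, hc⟩ : (Set.Ioo a b \ (⋃₀ T ∩ Set.Ioo a b)).Nonempty :=
      ((Set.Ioo_infinite hab).sdiff hfin).nonempty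
    obtain ⟨l, m, hlm, hsub⟩ := mem_nhds_iff_exists_Ioo_subset.1 (hopen.mem_nhds hc)
    obtain ⟨q, h1, h2⟩ := exists_rat_btwn (hlm.1.trans hlm.2)
    obtain ⟨r, h3, h4⟩ := exists_rat_btwn h2
    obtain ⟨q', k1, k2⟩ := exists_rat_btwn h3
    refine ⟨q', r, ?_, k2, ?_, Or.inr fun t ht ht' hmem => ?_⟩
    · exact (hsub ⟨h1.trans k1, k2.trans h4⟩).1.1
    · exact (hsub ⟨h1.trans h3, h4⟩).1.2
    · have := hsub ⟨h1.trans (k1.trans ht), ht'.trans h4⟩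
      exact this.2 ⟨hmem, this.1⟩

/-- Each of the finitely many order-connected pieces has at most one point. -/
theorem Dfn.finite_of_no_Ioo {S : Set ℝ} (hS : Dfn L S)
    (h : ∀ a b, a < b → ¬ Set.Ioo a b ⊆ S) : S.Finite := by
  obtain ⟨T, hT, hT', rfl⟩ := hL.out.finite_union S
    (Dfn.preimage (f := fun x : Fin 1 → ℝ => x 0) (by fun_prop) hS)
  refine hT.sUnion fun A hA => Set.Subsingleton.finite fun u hu v hv => ?_
  by_contra huv
  wlog huv' : u < v generalizing u v
  · exact this v hv u hu (Ne.symm huv) (lt_of_le_of_ne (not_lt.1 huv') (Ne.symm huv))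
  exact h u v huv' fun t ht => ⟨A, hA, (hT' A hA).out hu hv ⟨ht.1.le, ht.2.le⟩⟩

/-! ### Genericity -/

/-- At points of a Baire dense set countably many generically determined sets are locally
determined. -/
theorem exists_locally_determined {X κ : Type*} [TopologicalSpace X] [R1Space X]
    [LocallyCompactSpace X] [T2Space X] [Countable κ]
    {B : Set X} (hB : IsLocallyClosed B) {A : κ → Set X}
    (hA : ∀ k, ∀ U, IsOpen U → (U ∩ B).Nonempty → ∃ V, IsOpen V ∧ V ⊆ U ∧ (V ∩ B).Nonempty ∧
      (V ∩ B ⊆ A k ∨ V ∩ B ∩ A k = ∅))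
    {U : Set X} (hU : IsOpen U) (hUB : (U ∩ B).Nonempty) :
    ∃ x ∈ U ∩ B, ∀ k, ∃ W, IsOpen W ∧ x ∈ W ∧ (W ∩ B ⊆ A k ∨ W ∩ B ∩ A k = ∅) := by
  have : LocallyCompactSpace B := hB.locallyCompactSpace
  -- Each `O k` is open by its form and dense by `hA`, so Baire's theorem in `B` provides a point
  -- common to all of them.
  let O : κ → Set B := fun k =>
    {x | ∃ W, IsOpen W ∧ (x : X) ∈ W ∧ (W ∩ B ⊆ A k ∨ W ∩ B ∩ A k = ∅)}
  have hO : ∀ k, IsOpen (O k) := by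
    intro k
    rw [isOpen_iff_forall_mem_open]
    rintro x ⟨W, hW, hx, h⟩
    exact ⟨Subtype.val ⁻¹' W, fun y hy => ⟨W, hW, hy, h⟩, hW.preimage continuous_subtype_val, hx⟩
  have hd : ∀ k, Dense (O k) := by
    intro k
    rw [dense_iff_inter_open]
    rintro _ ⟨U, hU, rfl⟩ ⟨x, hx⟩
    obtain ⟨V, hV, hVU, ⟨y, hy⟩, h⟩ := hA k U hU ⟨x, hx, x.2⟩
    exact ⟨⟨y, hy.2⟩, hVU hy.1, V, hV, hy.1, h⟩
  obtain ⟨y, hy⟩ := hUB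
  obtain ⟨x, hx, hx'⟩ := (dense_iInter_of_isOpen hO hd).inter_open_nonempty _
    (hU.preimage continuous_subtype_val) ⟨⟨y, hy.2⟩, hy.1⟩
  exact ⟨x, ⟨hx, x.2⟩, fun k => Set.mem_iInter.1 hx' k⟩

/-- On a cell, a definable set is generically either full or empty. -/
theorem IsCell.generic : ∀ {ℓ : ℕ} {C : Set (Fin ℓ → ℝ)}, IsCell L ℓ C →
    ∀ {A : Set (Fin ℓ → ℝ)}, Dfn L A → ∀ U, IsOpen U → (U ∩ C).Nonempty →
    ∃ V, IsOpen V ∧ V ⊆ U ∧ (V ∩ C).Nonempty ∧ (V ∩ C ⊆ A ∨ V ∩ C ∩ A = ∅)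
  | 0, C, hC, A, hA, U, hU, hUC => by
    refine ⟨U, hU, subset_rfl, hUC, ?_⟩
    obtain ⟨x, hx⟩ := hUC
    by_cases hxA : x ∈ A
    · exact Or.inl fun y _ => Subsingleton.elim x y ▸ hxA
    · refine Or.inr (Set.eq_empty_of_forall_notMem fun y hy => hxA ?_)
      exact Subsingleton.elim y x ▸ hy.2
  | ℓ + 1, C, hC, A, hA, U, hU, hUC => by
    obtain ⟨B, hB, h⟩ := isCell_succ.1 hC
    obtain ⟨f, hf, rfl⟩ | ⟨f, g, hf, hg, h, rfl⟩ := h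
    -- A graph is homeomorphic to its base, so the claim is reduced to the set of base points whose
    -- lift lies in `A`.
    · have hA' : Dfn L {x | ∃ t : ℝ, join x t ∈ graphCell B f ∧ join x t ∈ A} :=
        Dfn.exists (Dfn.and (Dfn.preimage (by fun_prop) (isContDef_iff.1 hf).2)
          (Dfn.preimage (by fun_prop) hA))
      obtain ⟨W, hW, hW'⟩ := continuousOn_iff'.1 (continuousOn_join continuousOn_id hf.1) U hU
      obtain ⟨z, hz⟩ := hUC
      have hzW : proj z ∈ W ∩ B := by
        rw [← hW']; simpa [← hz.2.2, hz.2.1] using hz.1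
      obtain ⟨V, hV, hVW, ⟨x, hx⟩, hVA⟩ := IsCell.generic hB hA' W hW ⟨_, hzW⟩
      have key : ∀ y, proj y ∈ V → y ∈ graphCell B f → y ∈ U := by
        intro y hy hy'
        have : proj y ∈ W ∩ B := ⟨hVW hy, hy'.1⟩
        rw [← hW'] at this
        simpa [← hy'.2] using this.1
      refine ⟨proj ⁻¹' V ∩ U, (hV.preimage continuous_proj).inter hU, Set.inter_subset_right,
        ⟨join x (f x), ⟨?_, key _ ?_ ?_⟩, ?_⟩, ?_⟩
      · simpa using hx.1
      · simpa using hx.1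
      · simpa using hx.2
      · simpa using hx.2
      · refine hVA.imp (fun h y hy => ?_) (fun h => Set.eq_empty_of_forall_notMem fun y hy => ?_)
        · obtain ⟨t, ht, ht'⟩ := h ⟨hy.1.1, hy.2.1⟩
          rw [join_mem_graphCell] at ht
          rw [ht.2, ← hy.2.2, join_proj] at ht'
          exact ht'
        · exact h.subset ⟨⟨hy.1.1.1, hy.1.2.1⟩, y (Fin.last ℓ), by simpa using hy.1.2, by simpa using hy.2⟩
    · obtain ⟨U₀, hU₀, hU₀'⟩ := exists_open_bandCell hf.1 hg.1
      obtain ⟨z, hz⟩ := hUC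
      have hzU : join (proj z) (z (Fin.last ℓ)) ∈ U ∩ U₀ := by
        rw [join_proj]; exact ⟨hz.1, (hU₀' ▸ hz.2 : z ∈ U₀ ∩ _).1⟩
      have hcont : Continuous fun p : (Fin ℓ → ℝ) × ℝ => join p.1 p.2 := by fun_prop
      obtain ⟨U', I, hU', hI, hzU', hzI, hprod⟩ := isOpen_prod_iff.1
        ((hU.inter hU₀).preimage hcont) (proj z) (z (Fin.last ℓ)) hzU
      obtain ⟨a, b, hab, hsub⟩ := mem_nhds_iff_exists_Ioo_subset.1 (hI.mem_nhds hzI)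
      -- `S (q, r, s)` collects the base points over which the interval `(q, r)` lies in `A` (`s =
      -- true`) or misses `A` (`s = false`). The family is countable, so some base point `x` is
      -- generic for all of it at once. The interval that o-minimality provides in the fibre over
      -- `x` then works over a whole neighbourhood of `x`.
      let S : ℚ × ℚ × Bool → Set (Fin ℓ → ℝ) := fun k => {x | ∀ t : ℝ, (k.1 : ℝ) < t →
        t < (k.2.1 : ℝ) → (k.2.2 = true ∧ join x t ∈ A ∨ k.2.2 = false ∧ join x t ∉ A)}
      have hAj : Dfn L {p : (Fin ℓ → ℝ) × ℝ | join p.1 p.2 ∈ A} := Dfn.preimage (by fun_prop) hA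
      have hS : ∀ k, Dfn L (S k) := fun k => Dfn.forall <| Dfn.imp
        (Dfn.lt (by fun_prop) (by fun_prop)) <| Dfn.imp (Dfn.lt (by fun_prop) (by fun_prop)) <|
        Dfn.or ((Dfn.const _).and hAj) ((Dfn.const _).and hAj.not)
      obtain ⟨x, hx, hx'⟩ := exists_locally_determined hB.isLocallyClosed (A := S)
        (fun k U hU hUB => IsCell.generic hB (hS k) U hU hUB) hU' ⟨_, hzU', hz.2.1⟩
      have hAx : Dfn L {t : ℝ | join x t ∈ A} := Dfn.preimage (by fun_prop) hA
      obtain ⟨q, r, h1, h2, h3, h4⟩ := hAx.exists_rat_Ioo (hab.1.trans hab.2)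
      obtain ⟨s, hs⟩ : ∃ s, x ∈ S (q, r, s) := by
        rcases h4 with h4 | h4
        · exact ⟨true, fun t ht ht' => Or.inl ⟨rfl, h4 t ht ht'⟩⟩
        · exact ⟨false, fun t ht ht' => Or.inr ⟨rfl, h4 t ht ht'⟩⟩
      obtain ⟨W, hW, hxW, hWS⟩ := hx' (q, r, s)
      have hWS : W ∩ B ⊆ S (q, r, s) := hWS.resolve_right fun he => he.subset ⟨⟨hxW, hx.2⟩, hs⟩
      have hlast : Continuous fun y : Fin (ℓ + 1) → ℝ => y (Fin.last ℓ) := continuous_apply _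
      have hmemU : ∀ y, proj y ∈ U' → (q : ℝ) < y (Fin.last ℓ) → y (Fin.last ℓ) < r →
          y ∈ U ∩ U₀ := by
        intro y hy hy1 hy2
        have : (proj y, y (Fin.last ℓ)) ∈ U' ×ˢ I :=
          ⟨hy, hsub ⟨h1.trans hy1, hy2.trans h3⟩⟩
        simpa using hprod this
      refine ⟨proj ⁻¹' (W ∩ U') ∩ (fun y => y (Fin.last ℓ)) ⁻¹' Set.Ioo (q : ℝ) r,
        ((hW.inter hU').preimage continuous_proj).inter (isOpen_Ioo.preimage hlast),
        fun y hy => (hmemU y hy.1.2 hy.2.1 hy.2.2).1, ?_, ?_⟩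
      · obtain ⟨t, ht1, ht2⟩ := exists_between h2
        refine ⟨join x t, ⟨by simpa using ⟨hxW, hx.1⟩, by simp [ht1, ht2]⟩, ?_⟩
        rw [hU₀']
        exact ⟨(hmemU (join x t) (by simpa using hx.1) (by simpa) (by simpa)).2, by simpa using hx.2⟩
      · have key : ∀ y ∈ proj ⁻¹' (W ∩ U') ∩ (fun y => y (Fin.last ℓ)) ⁻¹' Set.Ioo (q : ℝ) r ∩
            bandCell B f g, s = true ∧ y ∈ A ∨ s = false ∧ y ∉ A := by
          rintro y ⟨⟨⟨hyW, -⟩, hy1, hy2⟩, hyB⟩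
          simpa using hWS ⟨hyW, hyB.1⟩ (y (Fin.last ℓ)) hy1 hy2
        cases s
        · refine Or.inr (Set.eq_empty_of_forall_notMem fun y hy => ?_)
          simpa [hy.2] using key y hy.1
        · exact Or.inl fun y hy => by simpa using key y hy

end Cells

end FortTheory

/-! ### Families of finite subsets of the unit interval and their continuous sections. -/

namespace FortTheory

open Filter Topology

theorem exists_box {m : ℕ} {W : Set (Fin m → ℝ)} (hW : IsOpen W) {x} (hx : x ∈ W) :
    ∃ δ : ℝ, 0 < δ ∧ ∀ x' : Fin m → ℝ, (∀ i, |x' i - x i| < δ) → x' ∈ W := by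
  obtain ⟨δ, hδ, h⟩ := Metric.isOpen_iff.1 hW x hx
  exact ⟨δ, hδ, fun x' hx' => h ((dist_pi_lt_iff hδ).2 hx')⟩

theorem eventually_box {m : ℕ} (x : Fin m → ℝ) {δ : ℝ} (hδ : 0 < δ) :
    ∀ᶠ x' in 𝓝 x, ∀ i, |x' i - x i| < δ := by
  filter_upwards [Metric.ball_mem_nhds x hδ] with x' hx' i
  exact (dist_pi_lt_iff hδ).1 hx' i

theorem exists_gap {S : Set ℝ} (hS : S.Finite) :
    ∃ η : ℝ, 0 < η ∧ ∀ y ∈ S, ∀ z ∈ S, |y - z| < η → y = z := by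
  have h : ∀ᶠ η : ℝ in 𝓝[>] 0, ∀ p ∈ S ×ˢ S, |p.1 - p.2| < η → p.1 = p.2 := by
    rw [eventually_all_finite (hS.prod hS)]
    rintro ⟨y, z⟩ -
    by_cases hyz : y = z
    · exact Eventually.of_forall fun _ _ => hyz
    · have : 0 < |y - z| := abs_pos.2 (sub_ne_zero.2 hyz)
      filter_upwards [nhdsWithin_le_nhds (Iio_mem_nhds this)] with η hη hη'
      exact absurd hη' (not_lt.2 (le_of_lt hη))
  obtain ⟨η, hη, hη'⟩ := (h.and self_mem_nhdsWithin).exists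
  exact ⟨η, hη', fun y hy z hz => hη (y, z) ⟨hy, hz⟩⟩

theorem iff_of_isPreconnected {X : Type*} [TopologicalSpace X] {B : Set X}
    (hB : IsPreconnected B) {p : X → Prop} (h : ∀ x ∈ B, ∀ᶠ x' in 𝓝[B] x, p x' ↔ p x)
    {x y : X} (hx : x ∈ B) (hy : y ∈ B) : p x ↔ p y := by
  classical
  have hc : ContinuousOn (fun x => decide (p x)) B := by
    intro x hx
    refine ContinuousWithinAt.congr_of_eventuallyEq (f := fun _ => decide (p x))
      continuousWithinAt_const ?_ rfl
    filter_upwards [h x hx] with x' hx'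
    simp [hx']
  simpa using hB.constant hc hx hy

section Sections

variable {m : ℕ} (L : FirstOrder.Language.{u, v}) [L.Structure ℝ]

/-- A definable family of finite subsets of `[0,1]` containing the end points. -/
structure IsSections (Y : (Fin m → ℝ) → Set ℝ) : Prop where
  dfn : Dfn L {p : (Fin m → ℝ) × ℝ | p.2 ∈ Y p.1}
  finite : ∀ x, (Y x).Finite
  zero_mem : ∀ x, 0 ∈ Y x
  one_mem : ∀ x, 1 ∈ Y x
  subset : ∀ x, Y x ⊆ Set.Icc 0 1

/-- The points of `B` near which the family `Y` on `B` consists of disjoint continuous sections. -/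
def regularOn (Y : (Fin m → ℝ) → Set ℝ) (B : Set (Fin m → ℝ)) : Set (Fin m → ℝ) :=
  {x | x ∈ B ∧ ∃ r : ℝ, 0 < r ∧ ∀ ε : ℝ, 0 < ε → ε < r → ∃ δ : ℝ, 0 < δ ∧
    ∀ x' : Fin m → ℝ, x' ∈ B → (∀ i, |x' i - x i| < δ) →
      (∀ y : ℝ, y ∈ Y x → ∃ y' : ℝ, (y' ∈ Y x' ∧ |y' - y| < ε) ∧
        ∀ z : ℝ, z ∈ Y x' → |z - y| < ε → z = y') ∧
      (∀ y' : ℝ, y' ∈ Y x' → ∃ y : ℝ, y ∈ Y x ∧ |y' - y| < ε)}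

theorem regularOn_mono {Y : (Fin m → ℝ) → Set ℝ} {B B' : Set (Fin m → ℝ)} (h : B' ⊆ B) :
    B' ∩ regularOn Y B ⊆ regularOn Y B' := by
  rintro x ⟨hx, -, r, hr, H⟩
  refine ⟨hx, r, hr, fun ε hε hεr => ?_⟩
  obtain ⟨δ, hδ, H⟩ := H ε hε hεr
  exact ⟨δ, hδ, fun x' hx' => H x' (h hx')⟩

/-- Regularity is a local condition. The lemma will be applied to a subcell of full dimension, which
is relatively open. -/
theorem regularOn_inter_open {Y : (Fin m → ℝ) → Set ℝ} {B U : Set (Fin m → ℝ)} (hU : IsOpen U) :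
    regularOn Y (U ∩ B) ⊆ regularOn Y B := by
  rintro x ⟨hx, r, hr, H⟩
  refine ⟨hx.2, r, hr, fun ε hε hεr => ?_⟩
  obtain ⟨δ, hδ, H⟩ := H ε hε hεr
  obtain ⟨δ', hδ', H'⟩ := exists_box hU hx.1
  refine ⟨min δ δ', lt_min hδ hδ', fun x' hx' hd => H x' ⟨?_, hx'⟩ ?_⟩
  · exact H' x' fun i => (hd i).trans_le (min_le_right _ _)
  · exact fun i => (hd i).trans_le (min_le_left _ _)

theorem regularOn.eventually {Y : (Fin m → ℝ) → Set ℝ} {B : Set (Fin m → ℝ)} {x}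
    (h : x ∈ regularOn Y B) : ∃ r : ℝ, 0 < r ∧ ∀ ε : ℝ, 0 < ε → ε < r → ∀ᶠ x' in 𝓝[B] x,
      (∀ y : ℝ, y ∈ Y x → ∃ y' : ℝ, (y' ∈ Y x' ∧ |y' - y| < ε) ∧
        ∀ z : ℝ, z ∈ Y x' → |z - y| < ε → z = y') ∧
      (∀ y' : ℝ, y' ∈ Y x' → ∃ y : ℝ, y ∈ Y x ∧ |y' - y| < ε) := by
  obtain ⟨hx, r, hr, H⟩ := h
  refine ⟨r, hr, fun ε hε hεr => ?_⟩
  obtain ⟨δ, hδ, H⟩ := H ε hε hεr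
  filter_upwards [self_mem_nhdsWithin, nhdsWithin_le_nhds (eventually_box x hδ)] with x' h1 h2
  exact H x' h1 h2

open Classical in
/-- The `i`-th smallest element of `Y x`, starting with `0` and ending in `1`. -/
noncomputable def sec (Y : (Fin m → ℝ) → Set ℝ) : ℕ → (Fin m → ℝ) → ℝ
  | 0, _ => 0
  | i + 1, x => if sec Y i x < 1 then sInf (Y x ∩ Set.Ioi (sec Y i x)) else 1

variable {L}
variable {Y : (Fin m → ℝ) → Set ℝ}

theorem IsSections.sec_succ (hY : IsSections L Y) {i : ℕ} {x} (h : sec Y i x < 1) :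
    sec Y (i + 1) x ∈ Y x ∧ sec Y i x < sec Y (i + 1) x ∧
      ∀ z ∈ Y x, sec Y i x < z → sec Y (i + 1) x ≤ z := by
  have hf : (Y x ∩ Set.Ioi (sec Y i x)).Finite := (hY.finite x).inter_of_left _
  have hmem : sInf (Y x ∩ Set.Ioi (sec Y i x)) ∈ Y x ∩ Set.Ioi (sec Y i x) :=
    Set.Nonempty.csInf_mem ⟨1, hY.one_mem x, h⟩ hf
  rw [sec, if_pos h]
  exact ⟨hmem.1, hmem.2, fun z hz hz' => csInf_le hf.bddBelow ⟨hz, hz'⟩⟩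

theorem sec_succ_of_eq_one {i : ℕ} {x} (h : ¬ sec Y i x < 1) : sec Y (i + 1) x = 1 := by
  rw [sec, if_neg h]

theorem IsSections.sec_mem (hY : IsSections L Y) (i : ℕ) (x) : sec Y i x ∈ Y x := by
  cases i with
  | zero => exact hY.zero_mem x
  | succ i =>
    by_cases h : sec Y i x < 1
    · exact (hY.sec_succ h).1
    · rw [sec_succ_of_eq_one h]; exact hY.one_mem x

theorem IsSections.sec_le_one (hY : IsSections L Y) (i : ℕ) (x) : sec Y i x ≤ 1 := (hY.subset x (hY.sec_mem i x)).2

theorem sec_eq_one {i j : ℕ} {x} (hij : i ≤ j) (h : sec Y i x = 1) :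
    sec Y j x = 1 := by
  induction hij with
  | refl => exact h
  | step _ ih => exact sec_succ_of_eq_one (by simp [ih])

theorem IsSections.sec_strictMono (hY : IsSections L Y) {k : ℕ} {x} (h : sec Y k x < 1) {i j : ℕ} (hij : i < j)
    (hj : j ≤ k + 1) : sec Y i x < sec Y j x := by
  have hlt : ∀ i ≤ k, sec Y i x < 1 := fun i hi =>
    lt_of_le_of_ne (hY.sec_le_one i x) fun h' => h.ne (sec_eq_one hi h')
  induction hij with
  | refl => exact (hY.sec_succ (hlt _ (by omega))).2.1
  | step _ ih => exact (ih (by omega)).trans (hY.sec_succ (hlt _ (by omega))).2.1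

theorem IsSections.exists_sec_eq_one (hY : IsSections L Y) (x) : ∃ i, sec Y i x = 1 := by
  by_contra! h
  have hlt : ∀ i, sec Y i x < 1 := fun i => lt_of_le_of_ne (hY.sec_le_one i x) (h i)
  have hm : StrictMono fun i => sec Y i x := strictMono_nat_of_lt_succ fun i =>
    (hY.sec_succ (hlt i)).2.1
  exact Set.infinite_of_injective_forall_mem hm.injective (fun i => hY.sec_mem i x) (hY.finite x)

/-- Near a regular point `x` the next element of `Y x'` after `sec Y i x'` is caught from both
sides: the point of `Y x'` close to `sec Y (i + 1) x` bounds it from above, and the uniqueness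
clause keeps it from staying close to `sec Y i x`. -/
theorem IsSections.continuousOn_sec (hY : IsSections L Y) {B : Set (Fin m → ℝ)} (hB : B ⊆ regularOn Y B) (i : ℕ) :
    ContinuousOn (sec Y i) B ∧ ∀ x ∈ B, ∀ᶠ x' in 𝓝[B] x, sec Y i x' = 1 ↔ sec Y i x = 1 := by
  -- The point `1` lies in every fibre, so by the uniqueness clause a section close to `1` is equal
  -- to `1`.
  have hone : ∀ i, ContinuousOn (sec Y i) B →
      ∀ x ∈ B, ∀ᶠ x' in 𝓝[B] x, sec Y i x' = 1 ↔ sec Y i x = 1 := by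
    intro i hc x hx
    by_cases h : sec Y i x = 1
    · obtain ⟨r, hr, H⟩ := regularOn.eventually (hB hx)
      filter_upwards [H (r / 2) (by linarith) (by linarith),
        Metric.tendsto_nhds.1 (hc x hx) (r / 2) (by linarith)] with x' h1 h2
      obtain ⟨y', -, h3⟩ := h1.1 1 (hY.one_mem x)
      rw [Real.dist_eq, h] at h2
      have h4 := h3 _ (hY.sec_mem i x') h2
      have h5 := h3 1 (hY.one_mem x') (by simpa using by linarith)
      simp [h, h4, ← h5]
    · filter_upwards [(hc x hx).eventually_ne h] with x' h1
      simp [h, h1]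
  suffices ContinuousOn (sec Y i) B from ⟨this, hone i this⟩
  induction i with
  | zero => exact continuousOn_const
  | succ i ih =>
    intro x hx
    by_cases h1 : sec Y i x < 1
    · obtain ⟨hm, hlt, hmin⟩ := hY.sec_succ h1
      obtain ⟨r, hr, H⟩ := regularOn.eventually (hB hx)
      obtain ⟨η, hη, hgap⟩ := exists_gap (hY.finite x)
      have hgap' : ∀ y ∈ Y x, ∀ z ∈ Y x, y < z → y + η ≤ z := by
        intro y hy z hz hyz
        by_contra! hcon
        exact hyz.ne (hgap y hy z hz (abs_lt.2 ⟨by linarith, by linarith⟩))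
      refine Metric.tendsto_nhds.2 fun ε₀ hε₀ => ?_
      obtain ⟨ε, hε, hεs⟩ : ∃ ε : ℝ, 0 < ε ∧ ε < min (min r ε₀) (η / 2) :=
        exists_between (lt_min (lt_min hr hε₀) (by linarith))
      simp only [lt_min_iff] at hεs
      filter_upwards [H ε hε hεs.1.1, Metric.tendsto_nhds.1 (ih x hx) ε hε] with x' H' hd
      rw [Real.dist_eq] at hd ⊢
      obtain ⟨y', ⟨hy', hy'd⟩, huniq⟩ := H'.1 _ hm
      have hg := hgap' _ (hY.sec_mem i x) _ hm hlt
      have hlt' : sec Y i x' < y' := by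
        rw [abs_lt] at hd hy'd; linarith
      have h1' : sec Y i x' < 1 := hlt'.trans_le (hY.subset x' hy').2
      obtain ⟨km, klt, kmin⟩ := hY.sec_succ h1'
      have kle := kmin y' hy' hlt'
      obtain ⟨w, hw, hwd⟩ := H'.2 _ km
      -- Here `w` is the point of `Y x` close to `sec Y (i + 1) x'`. The gap `η` excludes `w < sec Y
      -- i x`. If `w = sec Y i x`, two different points of `Y x'` would be close to `w`, against
      -- uniqueness.
      have hw1 : sec Y i x < w := by
        by_contra! hcon
        rcases hcon.lt_or_eq with hcon | rfl
        · have := hgap' _ hw _ (hY.sec_mem i x) hcon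
          rw [abs_lt] at hwd hd; linarith
        · obtain ⟨z, -, hz⟩ := H'.1 _ hw
          have e1 := hz _ km hwd
          have e2 := hz _ (hY.sec_mem i x') hd
          linarith
      have hw2 := hmin w hw hw1
      have hw3 : w = sec Y (i + 1) x := by
        by_contra hne
        have := hgap' _ hm _ hw (lt_of_le_of_ne hw2 (Ne.symm hne))
        rw [abs_lt] at hwd hy'd; linarith
      rw [hw3] at hwd
      exact hwd.trans hεs.1.2
    · have h2 : sec Y i x = 1 := le_antisymm (hY.sec_le_one i x) (not_lt.1 h1)
      refine ContinuousWithinAt.congr_of_eventuallyEq (f := fun _ => (1 : ℝ))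
        continuousWithinAt_const ?_ (sec_succ_of_eq_one h1)
      filter_upwards [hone i ih x hx] with x' hx'
      exact sec_succ_of_eq_one (by simp [hx'.2 h2])

/-- On a connected set of regular points the number of sections is constant. -/
theorem IsSections.exists_card (hY : IsSections L Y) {B : Set (Fin m → ℝ)} (hB : B ⊆ regularOn Y B)
    (hc : IsPreconnected B) (hne : B.Nonempty) :
    ∃ k, ∀ x ∈ B, sec Y k x < 1 ∧ sec Y (k + 1) x = 1 := by
  classical
  obtain ⟨x₀, hx₀⟩ := hne
  have h := hY.exists_sec_eq_one x₀
  obtain ⟨k, hk⟩ : ∃ k, Nat.find h = k + 1 := by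
    refine Nat.exists_eq_succ_of_ne_zero fun h0 => ?_
    have := Nat.find_spec h
    rw [h0] at this
    simp [sec] at this
  refine ⟨k, fun x hx => ?_⟩
  have key : ∀ i, sec Y i x = 1 ↔ sec Y i x₀ = 1 := fun i =>
    iff_of_isPreconnected hc (p := fun x => sec Y i x = 1) (hY.continuousOn_sec hB i).2 hx hx₀
  refine ⟨lt_of_le_of_ne (hY.sec_le_one k x) ?_, ?_⟩
  · rw [Ne, key]
    exact Nat.find_min h (by omega)
  · rw [key, ← hk]
    exact Nat.find_spec h

variable [hL : Fact (IsOMinimalExpansion L)]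

theorem IsSections.defMap_sec (hY : IsSections L Y) (i : ℕ) : DefMap L (sec Y i) := by
  induction i with
  | zero => exact DefMap.const 0
  | succ i ih =>
    have h : Dfn L {p : (Fin m → ℝ) × ℝ | (sec Y i p.1 < 1 ∧ (p.2 ∈ Y p.1 ∧ sec Y i p.1 < p.2 ∧
        ∀ z : ℝ, z ∈ Y p.1 → sec Y i p.1 < z → p.2 ≤ z)) ∨ (¬ sec Y i p.1 < 1 ∧ p.2 = 1)} := by
      have h1 : Dfn L {p : (Fin m → ℝ) × ℝ | sec Y i p.1 < 1} := Dfn.lt (by fun_prop) (by fun_prop)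
      refine (h1.and (hY.dfn.and ((Dfn.lt (by fun_prop) (by fun_prop)).and
        (Dfn.forall (Dfn.imp ?_ (Dfn.imp ?_ ?_)))))).or (h1.not.and (Dfn.eq ?_ ?_))
      · exact Dfn.preimage (f := fun p : ((Fin m → ℝ) × ℝ) × ℝ => (p.1.1, p.2)) (by fun_prop) hY.dfn
      · exact Dfn.lt (by fun_prop) (by fun_prop)
      · exact Dfn.le (by fun_prop) (by fun_prop)
      · fun_prop
      · fun_prop
    unfold DefMap
    convert! h using 1
    ext ⟨x, t⟩
    simp only [Set.mem_ofPred_eq]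
    by_cases hx : sec Y i x < 1
    · obtain ⟨h1, h2, h3⟩ := hY.sec_succ hx
      simp only [hx, true_and, not_true, false_and, or_false]
      constructor
      · rintro rfl; exact ⟨h1, h2, h3⟩
      · rintro ⟨k1, k2, k3⟩
        exact le_antisymm (k3 _ h1 h2) (h3 _ k1 k2)
    · simp [hx, sec_succ_of_eq_one]

/-- Regularity is phrased with real numbers `r`, `ε`, `δ` and coordinate boxes, hence by a
first-order formula; the proof follows the shape of this formula. -/
theorem IsSections.dfn_regularOn (hY : IsSections L Y) {B : Set (Fin m → ℝ)} (hB : Dfn L B) :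
    Dfn L (regularOn Y B) := by
  have h1 : ∀ {E : Type} [Coord E] {f : E → Fin m → ℝ} {g : E → ℝ}, DefMap L f → DefMap L g →
      Dfn L {x | g x ∈ Y (f x)} := fun {E _ f g} hf hg =>
    Dfn.preimage (f := fun x => (f x, g x)) (by fun_prop) hY.dfn
  unfold regularOn
  repeat' first
    | with_reducible first
      | refine Dfn.and ?_ ?_ | refine Dfn.imp ?_ ?_ | refine Dfn.exists ?_ | refine Dfn.forall ?_
      | refine Dfn.abs_lt ?_ ?_ | refine Dfn.lt ?_ ?_ | refine Dfn.eq ?_ ?_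
      | refine Dfn.forall_finite fun _ => ?_ | refine h1 ?_ ?_ | refine Dfn.preimage ?_ hB
    | fun_prop

/-- Baire's theorem takes the place of a uniform bound on the size of the fibres. A finite fibre is
isolated by some finite set `τ` of rational intervals. There are countably many such `τ`, so at a
generic point `x` the isolation of `Y x` by `τ` persists for all nearby fibres. -/
theorem IsSections.regularOn_nonempty (hY : IsSections L Y) {C : Set (Fin m → ℝ)} (hC : IsCell L m C) :
    (regularOn Y C).Nonempty := by
  -- The points whose fibre meets every interval of `τ` exactly once and is covered by these
  -- intervals.
  let T : Finset (ℚ × ℚ) → Set (Fin m → ℝ) := fun τ =>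
    {x | (∀ p : τ, ∃ y : ℝ, (y ∈ Y x ∧ (p.1.1 : ℝ) < y ∧ y < (p.1.2 : ℝ)) ∧
        ∀ z : ℝ, z ∈ Y x → (p.1.1 : ℝ) < z → z < (p.1.2 : ℝ) → z = y) ∧
      ∀ y : ℝ, y ∈ Y x → ∃ p : τ, (p.1.1 : ℝ) < y ∧ y < (p.1.2 : ℝ)}
  have hT : ∀ τ, Dfn L (T τ) := by
    intro τ
    have h1 : ∀ {E : Type} [Coord E] {f : E → Fin m → ℝ} {g : E → ℝ}, DefMap L f → DefMap L g →
        Dfn L {x | g x ∈ Y (f x)} := fun {E _ f g} hf hg =>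
      Dfn.preimage (f := fun x => (f x, g x)) (by fun_prop) hY.dfn
    repeat' first
      | with_reducible first
        | refine Dfn.and ?_ ?_ | refine Dfn.imp ?_ ?_ | refine Dfn.forall_finite fun _ => ?_
        | refine Dfn.exists_finite fun _ => ?_ | refine Dfn.exists ?_ | refine Dfn.forall ?_
        | refine Dfn.lt ?_ ?_ | refine Dfn.eq ?_ ?_ | refine h1 ?_ ?_
      | fun_prop
  obtain ⟨x, ⟨-, hx⟩, H⟩ := exists_locally_determined hC.isLocallyClosed
    (fun τ U hU hUC => hC.generic (hT τ) U hU hUC) isOpen_univ (by simpa using hC.nonempty)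
  obtain ⟨η, hη, hgap⟩ := exists_gap (hY.finite x)
  refine ⟨x, hx, η / 2, by linarith, fun ε hε hε' => ?_⟩
  have hl : ∀ y : ℝ, ∃ q : ℚ, y - ε / 2 < q ∧ (q : ℝ) < y := fun y =>
    exists_rat_btwn (by linarith)
  have hu : ∀ y : ℝ, ∃ q : ℚ, y < q ∧ (q : ℝ) < y + ε / 2 := fun y =>
    exists_rat_btwn (by linarith)
  choose a ha1 ha2 using hl
  choose b hb1 hb2 using hu
  -- Each point of `Y x` gets a rational interval around it of radius below `ε / 2`; since `ε < η /
  -- 2`, the interval contains no other point of `Y x`.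
  let τ : Finset (ℚ × ℚ) := (hY.finite x).toFinset.image fun y => (a y, b y)
  have hmem : ∀ p : τ, ∃ y ∈ Y x, p.1 = (a y, b y) := by
    rintro ⟨p, hp⟩
    obtain ⟨y, hy, rfl⟩ := Finset.mem_image.1 hp
    exact ⟨y, by simpa using hy, rfl⟩
  have hmem' : ∀ y ∈ Y x, (a y, b y) ∈ τ := fun y hy =>
    Finset.mem_image.2 ⟨y, by simpa using hy, rfl⟩
  have hxT : x ∈ T τ := by
    refine ⟨fun p => ?_, fun y hy => ⟨⟨_, hmem' y hy⟩, ha2 y, hb1 y⟩⟩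
    obtain ⟨y, hy, hp⟩ := hmem p
    rw [hp]
    refine ⟨y, ⟨hy, ha2 y, hb1 y⟩, fun z hz h1 h2 => hgap z hz y hy ?_⟩
    have := ha1 y
    have := hb2 y
    exact abs_lt.2 ⟨by linarith, by linarith⟩
  obtain ⟨W, hW, hxW, hWT⟩ := H τ
  have hWT : W ∩ C ⊆ T τ := hWT.resolve_right fun he => he.subset ⟨⟨hxW, hx⟩, hxT⟩
  obtain ⟨δ, hδ, hδW⟩ := exists_box hW hxW
  refine ⟨δ, hδ, fun x' hx' hd => ?_⟩
  obtain ⟨k1, k2⟩ := hWT ⟨hδW x' hd, hx'⟩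
  have k2' : ∀ y' ∈ Y x', ∃ y ∈ Y x, |y' - y| < ε ∧ |y' - y| < ε / 2 ∧ (a y : ℝ) < y' ∧ y' < b y := by
    intro y' hy'
    obtain ⟨p, hp1, hp2⟩ := k2 y' hy'
    obtain ⟨y, hy, hp⟩ := hmem p
    rw [hp] at hp1 hp2
    have := ha1 y
    have := hb2 y
    have : |y' - y| < ε / 2 := abs_lt.2 ⟨by simp at *; linarith, by simp at *; linarith⟩
    exact ⟨y, hy, by linarith, this, hp1, hp2⟩
  refine ⟨fun y hy => ?_, fun y' hy' => ?_⟩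
  · obtain ⟨y', ⟨h1, h2, h3⟩, h4⟩ := k1 ⟨_, hmem' y hy⟩
    have := ha1 y
    have := hb2 y
    simp only at h2 h3
    refine ⟨y', ⟨h1, abs_lt.2 ⟨by linarith, by linarith⟩⟩, fun z hz hzy => ?_⟩
    obtain ⟨w, hw, -, hzw, h5, h6⟩ := k2' z hz
    -- Both are within `ε` of `z` and the gap `η` exceeds `2 * ε`.
    have : w = y := by
      refine hgap w hw y hy ?_
      rw [abs_lt] at *
      constructor <;> linarith
    subst this
    exact h4 z hz h5 h6
  · obtain ⟨y, hy, h, -⟩ := k2' y' hy'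
    exact ⟨y, hy, h⟩

end Sections

end FortTheory

/-! ### The cylindrical decomposition theorem for o-minimal structures. -/

namespace FortTheory

open Filter Topology

/-- No monotonicity of `g` is needed: the least `j` with `t < g j` serves as `i + 1`. -/
theorem exists_mem_stack {g : ℕ → ℝ} {k : ℕ} {t : ℝ} (h0 : g 0 < t) (h1 : t < g (k + 1)) :
    ∃ i ≤ k, (1 ≤ i ∧ t = g i) ∨ (g i < t ∧ t < g (i + 1)) := by
  classical
  have h : ∃ j, t < g j := ⟨_, h1⟩
  obtain ⟨i, hi⟩ : ∃ i, Nat.find h = i + 1 := by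
    refine Nat.exists_eq_succ_of_ne_zero fun h' => ?_
    have := Nat.find_spec h
    rw [h'] at this
    exact lt_asymm this h0
  have hik : i ≤ k := by
    have := Nat.find_min' h h1
    omega
  have hlt : t < g (i + 1) := hi ▸ Nat.find_spec h
  have hle : g i ≤ t := not_lt.1 (Nat.find_min h (m := i) (by omega))
  refine ⟨i, hik, ?_⟩
  rcases hle.eq_or_lt with h2 | h2
  · refine Or.inl ⟨?_, h2.symm⟩
    rcases i with _ | i
    · exact absurd h2 h0.ne
    · omega
  · exact Or.inr ⟨h2, hlt⟩

section CD

variable {L : FirstOrder.Language.{u, v}} [L.Structure ℝ]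

theorem IsCylDecomp.isCellDecomp : ∀ {ℓ : ℕ} {Φ : Set (Set (Fin ℓ → ℝ))} {X : Set (Fin ℓ → ℝ)},
    IsCylDecomp L ℓ Φ X → IsCellDecomp L Φ X
  | 0, _, _, h => h
  | _ + 1, _, _, h => h.1

theorem Compatible.subset_of_mem {ℓ : ℕ} {A X : Set (Fin ℓ → ℝ)} (h : Compatible A X) {x}
    (hA : x ∈ A) (hX : x ∈ X) : A ⊆ X :=
  h.resolve_right fun he => he.subset ⟨hA, hX⟩

theorem IsCellDecomp.eq_of_mem {ℓ : ℕ} {Φ : Set (Set (Fin ℓ → ℝ))} {X : Set (Fin ℓ → ℝ)}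
    (h : IsCellDecomp L Φ X) {C C' : Set (Fin ℓ → ℝ)} (hC : C ∈ Φ) (hC' : C' ∈ Φ) {x}
    (hx : x ∈ C) (hx' : x ∈ C') : C = C' := by
  by_contra hne
  exact Set.disjoint_left.1 (h.2.2.1 hC hC' hne) hx hx'

theorem IsCellDecomp.exists_mem {ℓ : ℕ} {Φ : Set (Set (Fin ℓ → ℝ))} {X : Set (Fin ℓ → ℝ)}
    (h : IsCellDecomp L Φ X) {x} (hx : x ∈ X) : ∃ C ∈ Φ, x ∈ C := by
  rw [← h.2.2.2] at hx
  exact hx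

theorem IsCellDecomp.cell_subset {ℓ : ℕ} {Φ : Set (Set (Fin ℓ → ℝ))} {X : Set (Fin ℓ → ℝ)}
    (h : IsCellDecomp L Φ X) {C} (hC : C ∈ Φ) : C ⊆ X := by
  rw [← h.2.2.2]
  exact Set.subset_sUnion_of_mem hC

variable (L) in
/-- Cylindrical decompositions of the unit cube adapted to finitely many definable sets exist. -/
def HasCD (m : ℕ) : Prop :=
  ∀ (κ : Type) [Finite κ] (A : κ → Set (Fin m → ℝ)), (∀ k, Dfn L (A k)) →
    ∃ Φ : Set (Set (Fin m → ℝ)), IsCylDecomp L m Φ (openCube m) ∧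
      ∀ C ∈ Φ, ∀ k, Compatible C (A k)

variable [hL : Fact (IsOMinimalExpansion L)]

/-- The old cells are added to the sets to be respected. A new cell is nonempty, so it meets some
old cell and is then contained in it. -/
theorem HasCD.exists_refinement {m : ℕ} (hcd : HasCD L m) {κ : Type} [Finite κ]
    {A : κ → Set (Fin m → ℝ)} (hA : ∀ k, Dfn L (A k)) {Φ : Set (Set (Fin m → ℝ))}
    (hΦ : IsCylDecomp L m Φ (openCube m)) :
    ∃ Φ' : Set (Set (Fin m → ℝ)), IsCylDecomp L m Φ' (openCube m) ∧
      (∀ C ∈ Φ', ∀ k, Compatible C (A k)) ∧ ∀ C' ∈ Φ', ∃ C ∈ Φ, C' ⊆ C := by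
  have hΦd := hΦ.isCellDecomp
  have : Finite Φ := hΦd.1
  obtain ⟨Φ', h1, h2⟩ := hcd (Φ ⊕ κ) (Sum.elim (fun C => C.1) A) (by
    rintro (C | k)
    · exact (hΦd.2.1 _ C.2).dfn
    · exact hA k)
  refine ⟨Φ', h1, fun C hC k => h2 C hC (Sum.inr k), fun C' hC' => ?_⟩
  obtain ⟨x, hx⟩ := (h1.isCellDecomp.2.1 C' hC').nonempty
  obtain ⟨C, hC, hxC⟩ := hΦd.exists_mem (h1.isCellDecomp.cell_subset hC' hx)
  exact ⟨C, hC, (h2 C' hC' (Sum.inl ⟨C, hC⟩)).subset_of_mem hx hxC⟩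

/-- Refine repeatedly by the regular loci of the current cells. A subcell outside the regular locus
of its cell has smaller dimension, so after `m + 1` rounds no bad cell is left. -/
theorem HasCD.exists_regular {m : ℕ} (hcd : HasCD L m) {Y : (Fin m → ℝ) → Set ℝ}
    (hY : IsSections L Y) :
    ∃ Φ : Set (Set (Fin m → ℝ)), IsCylDecomp L m Φ (openCube m) ∧ ∀ C ∈ Φ, C ⊆ regularOn Y C := by
  have key : ∀ n : ℕ, ∃ Φ : Set (Set (Fin m → ℝ)), IsCylDecomp L m Φ (openCube m) ∧
      ∀ C ∈ Φ, C ⊆ regularOn Y C ∨ ∃ d, IsCellDim L m d C ∧ d + n ≤ m := by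
    intro n
    induction n with
    | zero =>
      obtain ⟨Φ, h, -⟩ := hcd Empty (fun k => k.elim) (fun k => k.elim)
      refine ⟨Φ, h, fun C hC => Or.inr ?_⟩
      obtain ⟨d, hd⟩ := isCell_iff.1 (h.isCellDecomp.2.1 C hC)
      exact ⟨d, hd, hd.le_length⟩
    | succ n ih =>
      obtain ⟨Φ, hΦ, hΦ'⟩ := ih
      have hΦd := hΦ.isCellDecomp
      have : Finite Φ := hΦd.1
      obtain ⟨Ψ, hΨ, hcomp, hsub⟩ := hcd.exists_refinement (κ := Φ)
        (A := fun C => regularOn Y C.1) (fun C => hY.dfn_regularOn (hΦd.2.1 _ C.2).dfn) hΦ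
      refine ⟨Ψ, hΨ, fun C' hC' => ?_⟩
      obtain ⟨C, hC, hCC⟩ := hsub C' hC'
      rcases hcomp C' hC' ⟨C, hC⟩ with h | h
      · exact Or.inl fun x hx => regularOn_mono hCC ⟨hx, h hx⟩
      have hcell := hΨ.isCellDecomp.2.1 C' hC'
      obtain ⟨x, hx⟩ := hcell.nonempty
      rcases hΦ' C hC with h' | ⟨d, hd, hdn⟩
      · exact (h.subset ⟨hx, h' (hCC hx)⟩).elim
      · obtain ⟨d', hd'⟩ := isCell_iff.1 hcell
        obtain ⟨hle, heq⟩ := hd.subset hd' hCC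
        refine Or.inr ⟨d', hd', ?_⟩
        -- A subcell of the same dimension is relatively open in `C`. It has a point that is regular
        -- for it, and by locality this point is regular for `C`, although `C'` avoids the regular
        -- locus of `C`.
        have : d' ≠ d := by
          intro hdd
          obtain ⟨U, hU, hUC⟩ := heq hdd
          obtain ⟨y, hy⟩ := hY.regularOn_nonempty hcell
          refine h.subset (show y ∈ _ from ⟨hy.1, ?_⟩)
          rw [hUC] at hy
          exact regularOn_inter_open hU hy
        omega
  obtain ⟨Φ, hΦ, h⟩ := key (m + 1)
  refine ⟨Φ, hΦ, fun C hC => (h C hC).resolve_right ?_⟩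
  rintro ⟨d, -, hd⟩
  omega

/-- The boundary points in the fibres of a family of subsets of `ℝ^(m+1)`. -/
def fibreBoundary {m : ℕ} {κ : Type} (A : κ → Set (Fin (m + 1) → ℝ)) (x : Fin m → ℝ) : Set ℝ :=
  {t | t = 0 ∨ t = 1 ∨ (0 < t ∧ t < 1) ∧ ∃ k, ∀ ε : ℝ, 0 < ε →
    (∃ u : ℝ, |u - t| < ε ∧ join x u ∈ A k) ∧ ∃ u : ℝ, |u - t| < ε ∧ ¬ join x u ∈ A k}

/-- Finiteness of the fibres: an interval of boundary points of `A k` would contain a subinterval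
inside or outside `A k`, and the midpoint of that subinterval is not a boundary point. -/
theorem isSections_fibreBoundary {m : ℕ} {κ : Type} [Finite κ]
    {A : κ → Set (Fin (m + 1) → ℝ)} (hA : ∀ k, Dfn L (A k)) : IsSections L (fibreBoundary A) where
  dfn := by
    unfold fibreBoundary
    simp only [Set.mem_ofPred_eq]
    repeat' first
      | with_reducible first
        | refine Dfn.or ?_ ?_ | refine Dfn.and ?_ ?_ | refine Dfn.not ?_ | refine Dfn.imp ?_ ?_
        | refine Dfn.exists_finite fun _ => ?_ | refine Dfn.exists ?_ | refine Dfn.forall ?_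
        | refine Dfn.abs_lt ?_ ?_ | refine Dfn.lt ?_ ?_ | refine Dfn.eq ?_ ?_
        | refine Dfn.preimage ?_ (hA _)
      | fun_prop
  finite x := by
    have : fibreBoundary A x ⊆ {0, 1} ∪ ⋃ k, {t : ℝ | ∀ ε : ℝ, 0 < ε →
        (∃ u : ℝ, |u - t| < ε ∧ join x u ∈ A k) ∧ ∃ u : ℝ, |u - t| < ε ∧ ¬ join x u ∈ A k} := by
      rintro t (h | h | ⟨-, k, h⟩)
      · simp [h]
      · simp [h]
      · exact Or.inr (Set.mem_iUnion.2 ⟨k, h⟩)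
    refine (((Set.finite_singleton _).insert _).union (Set.finite_iUnion fun k => ?_)).subset this
    have hAx : Dfn L {t : ℝ | join x t ∈ A k} := Dfn.preimage (by fun_prop) (hA k)
    refine Dfn.finite_of_no_Ioo (L := L) ?_ fun a b hab hsub => ?_
    · repeat' first
        | with_reducible first
          | refine Dfn.and ?_ ?_ | refine Dfn.not ?_ | refine Dfn.imp ?_ ?_
          | refine Dfn.exists ?_ | refine Dfn.forall ?_
          | refine Dfn.abs_lt ?_ ?_ | refine Dfn.lt ?_ ?_ | refine Dfn.preimage ?_ (hA _)
        | fun_prop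
    · obtain ⟨q, r, h1, h2, h3, h4⟩ := hAx.exists_rat_Ioo hab
      obtain ⟨⟨u, hu, hu'⟩, v, hv, hv'⟩ := hsub (show ((q : ℝ) + r) / 2 ∈ Set.Ioo a b from
        ⟨by linarith, by linarith⟩) ((r - q) / 2) (by linarith)
      rw [abs_lt] at hu hv
      rcases h4 with h4 | h4
      · exact hv' (h4 v (by linarith) (by linarith))
      · exact h4 u (by linarith) (by linarith) hu'
  zero_mem x := Or.inl rfl
  one_mem x := Or.inr (Or.inl rfl)
  subset x := by
    rintro t (rfl | rfl | ⟨h, -⟩)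
    · simp
    · simp
    · exact ⟨h.1.le, h.2.le⟩

/-- Away from the boundary points membership is locally constant along the fibre, and an interval is
connected. -/
theorem join_mem_iff_of_no_fibreBoundary {m : ℕ} {κ : Type} {A : κ → Set (Fin (m + 1) → ℝ)}
    {x : Fin m → ℝ} {a b : ℝ} (ha : 0 ≤ a) (hb : b ≤ 1)
    (h : ∀ t, a < t → t < b → t ∉ fibreBoundary A x) (k : κ) {t t' : ℝ} (ht : t ∈ Set.Ioo a b)
    (ht' : t' ∈ Set.Ioo a b) : join x t ∈ A k ↔ join x t' ∈ A k := by
  refine iff_of_isPreconnected isPreconnected_Ioo (p := fun t => join x t ∈ A k) (fun s hs => ?_)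
    ht ht'
  have h1 := h s hs.1 hs.2
  have hε : ∃ ε : ℝ, 0 < ε ∧
      ((∀ u, |u - s| < ε → join x u ∉ A k) ∨ ∀ u, |u - s| < ε → join x u ∈ A k) := by
    by_contra! hcon
    refine h1 (Or.inr (Or.inr ⟨⟨ha.trans_lt hs.1, hs.2.trans_le hb⟩, k, fun ε hε => ?_⟩))
    obtain ⟨⟨u, hu⟩, w, hw⟩ := hcon ε hε
    exact ⟨⟨u, hu⟩, w, hw⟩
  obtain ⟨ε, hε, h2⟩ := hε
  filter_upwards [nhdsWithin_le_nhds (Metric.ball_mem_nhds s hε)] with u hu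
  have hu : |u - s| < ε := hu
  have hs' : |s - s| < ε := by simpa using hε
  rcases h2 with h2 | h2
  · exact iff_of_false (h2 u hu) (h2 s hs')
  · exact iff_of_true (h2 u hu) (h2 s hs')

/-- Graphs are taken only for `1 ≤ i ≤ n C`, because the sections with index `0` and `n C + 1` are
the constants `0` and `1` over `C` and lie outside the open cube. -/
theorem IsSections.isCylDecomp_stack {m : ℕ} {Y : (Fin m → ℝ) → Set ℝ} (hY : IsSections L Y)
    {Φ : Set (Set (Fin m → ℝ))} (hΦ : IsCylDecomp L m Φ (openCube m))
    (hreg : ∀ C ∈ Φ, C ⊆ regularOn Y C) {n : Set (Fin m → ℝ) → ℕ}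
    (hn : ∀ C ∈ Φ, ∀ x ∈ C, sec Y (n C) x < 1 ∧ sec Y (n C + 1) x = 1) :
    IsCylDecomp L (m + 1) {D | ∃ C ∈ Φ, ∃ i ≤ n C, (1 ≤ i ∧ D = graphCell C (sec Y i)) ∨
      D = bandCell C (sec Y i) (sec Y (i + 1))} (openCube (m + 1)) := by
  have hΦd := hΦ.isCellDecomp
  have hmono : ∀ C ∈ Φ, ∀ x ∈ C, ∀ i j, i < j → j ≤ n C + 1 → sec Y i x < sec Y j x :=
    fun C hC x hx i j hij hj => hY.sec_strictMono (hn C hC x hx).1 hij hj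
  have hcd : ∀ C ∈ Φ, ∀ i, IsContDef L C (sec Y i) := fun C hC i =>
    IsContDef.of_defMap (hΦd.2.1 C hC).dfn (hY.defMap_sec i) (hY.continuousOn_sec (hreg C hC) i).1
  have hproj : ∀ D, (∃ C ∈ Φ, ∃ i ≤ n C, (1 ≤ i ∧ D = graphCell C (sec Y i)) ∨
      D = bandCell C (sec Y i) (sec Y (i + 1))) → proj '' D ∈ Φ := by
    rintro D ⟨C, hC, i, hi, ⟨-, rfl⟩ | rfl⟩
    · rwa [proj_image_graphCell]
    · rwa [proj_image_bandCell fun x hx => hmono C hC x hx i (i + 1) (by omega) (by omega)]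
  refine ⟨⟨?_, ?_, ?_, ?_⟩, ?_⟩
  · have : {D | ∃ C ∈ Φ, ∃ i ≤ n C, (1 ≤ i ∧ D = graphCell C (sec Y i)) ∨
        D = bandCell C (sec Y i) (sec Y (i + 1))} ⊆
        ⋃ C ∈ Φ, ⋃ i ∈ Set.Iic (n C),
          {graphCell C (sec Y i), bandCell C (sec Y i) (sec Y (i + 1))} := by
      rintro D ⟨C, hC, i, hi, h⟩
      simp only [Set.mem_iUnion]
      exact ⟨C, hC, i, hi, h.imp (fun h => h.2) id⟩
    exact (hΦd.1.biUnion fun C _ => (Set.finite_Iic _).biUnion fun i _ =>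
      (Set.finite_singleton _).insert _).subset this
  · rintro D ⟨C, hC, i, hi, ⟨-, rfl⟩ | rfl⟩
    · exact isCell_succ.2 ⟨C, hΦd.2.1 C hC, Or.inl ⟨_, hcd C hC i, rfl⟩⟩
    · exact isCell_succ.2 ⟨C, hΦd.2.1 C hC, Or.inr ⟨_, _, hcd C hC i, hcd C hC (i + 1),
        fun x hx => hmono C hC x hx i (i + 1) (by omega) (by omega), rfl⟩⟩
  · rintro D hD D' hD' hne
    refine Set.disjoint_left.2 fun z hz hz' => hne ?_
    have hzC := Set.mem_image_of_mem proj hz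
    have hzC' := Set.mem_image_of_mem proj hz'
    have heq := hΦd.eq_of_mem (hproj D hD) (hproj D' hD') hzC hzC'
    obtain ⟨C, hC, i, hi, h⟩ := hD
    obtain ⟨C', hC', i', hi', h'⟩ := hD'
    have hm := hmono C hC
    have key : ∀ D, (∃ i ≤ n C, (1 ≤ i ∧ D = graphCell C (sec Y i)) ∨
      D = bandCell C (sec Y i) (sec Y (i + 1))) → proj '' D = C := by
      rintro D ⟨i, hi, ⟨-, rfl⟩ | rfl⟩
      · rw [proj_image_graphCell]
      · rw [proj_image_bandCell fun x hx => hmono C hC x hx i (i + 1) (by omega) (by omega)]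
    have hCC : C' = C := by
      rw [key D ⟨i, hi, h⟩] at heq
      rw [heq]
      rcases h' with ⟨-, rfl⟩ | rfl
      · rw [proj_image_graphCell]
      · rw [proj_image_bandCell fun x hx => hmono C' hC' x hx i' (i' + 1) (by omega) (by omega)]
    subst hCC
    rcases h with ⟨-, rfl⟩ | rfl <;> rcases h' with ⟨-, rfl⟩ | rfl
    · rcases lt_trichotomy i i' with h | h | h
      · linarith [hm _ hz.1 i i' h (by omega), hz.2, hz'.2]
      · rw [h]
      · linarith [hm _ hz.1 i' i h (by omega), hz.2, hz'.2]
    · exfalso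
      rcases lt_or_ge i (i' + 1) with h | h
      · rcases Nat.lt_succ_iff_lt_or_eq.1 h with h | rfl
        · linarith [hm _ hz.1 i i' h (by omega), hz.2, hz'.2.1]
        · linarith [hz.2, hz'.2.1]
      · rcases h.eq_or_lt with rfl | h
        · linarith [hz.2, hz'.2.2]
        · linarith [hm _ hz.1 (i' + 1) i h (by omega), hz.2, hz'.2.2]
    · exfalso
      rcases lt_or_ge i' (i + 1) with h | h
      · rcases Nat.lt_succ_iff_lt_or_eq.1 h with h | rfl
        · linarith [hm _ hz.1 i' i h (by omega), hz'.2, hz.2.1]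
        · linarith [hz'.2, hz.2.1]
      · rcases h.eq_or_lt with rfl | h
        · linarith [hz'.2, hz.2.2]
        · linarith [hm _ hz.1 (i + 1) i' h (by omega), hz'.2, hz.2.2]
    · rcases lt_trichotomy i i' with h | h | h
      · rcases (Nat.succ_le_iff.2 h).eq_or_lt with h | h
        · rw [← h] at hz'
          linarith [hz.2.2, hz'.2.1]
        · linarith [hm _ hz.1 (i + 1) i' h (by omega), hz.2.2, hz'.2.1]
      · rw [h]
      · rcases (Nat.succ_le_iff.2 h).eq_or_lt with h | h
        · rw [← h] at hz
          linarith [hz.2.1, hz'.2.2]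
        · linarith [hm _ hz.1 (i' + 1) i h (by omega), hz.2.1, hz'.2.2]
  · ext z
    constructor
    · rintro ⟨D, ⟨C, hC, i, hi, h⟩, hz⟩
      have hzC : proj z ∈ C := by
        rcases h with ⟨-, rfl⟩ | rfl <;> exact hz.1
      have h01 : 0 < z (Fin.last m) ∧ z (Fin.last m) < 1 := by
        have h1 := (hn C hC _ hzC).2
        rcases h with ⟨h1i, rfl⟩ | rfl
        · rw [hz.2, ← h1]
          exact ⟨hmono C hC _ hzC 0 i (by omega) (by omega), hmono C hC _ hzC _ _ (by omega) le_rfl⟩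
        · exact ⟨(hY.subset _ (hY.sec_mem i _)).1.trans_lt hz.2.1,
            hz.2.2.trans_le (hY.sec_le_one _ _)⟩
      intro i
      refine Fin.lastCases h01 (fun j => ?_) i
      exact hΦd.cell_subset hC hzC j
    · intro hz
      obtain ⟨C, hC, hzC⟩ := hΦd.exists_mem (x := proj z) fun j => hz j.castSucc
      obtain ⟨i, hi, h⟩ := exists_mem_stack (g := fun i => sec Y i (proj z)) (k := n C)
        (t := z (Fin.last m)) (hz (Fin.last m)).1
        (by rw [(hn C hC _ hzC).2]; exact (hz (Fin.last m)).2)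
      rcases h with ⟨h1, h2⟩ | h
      · exact ⟨_, ⟨C, hC, i, hi, Or.inl ⟨h1, rfl⟩⟩, hzC, h2⟩
      · exact ⟨_, ⟨C, hC, i, hi, Or.inr rfl⟩, hzC, h⟩
  · have h1 : (fun C => proj '' C) '' {D | ∃ C ∈ Φ, ∃ i ≤ n C, (1 ≤ i ∧ D = graphCell C (sec Y i)) ∨
        D = bandCell C (sec Y i) (sec Y (i + 1))} = Φ := by
      ext C
      constructor
      · rintro ⟨D, hD, rfl⟩
        exact hproj D hD
      · intro hC
        exact ⟨_, ⟨C, hC, 0, Nat.zero_le _, Or.inr rfl⟩,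
          proj_image_bandCell fun x hx => hmono C hC x hx 0 1 (by omega) (by omega)⟩
    have h2 : proj '' openCube (m + 1) = openCube m := by
      ext x
      constructor
      · rintro ⟨z, hz, rfl⟩ j
        exact hz j.castSucc
      · intro hx
        refine ⟨join x (1 / 2), fun i => ?_, by simp⟩
        refine Fin.lastCases ?_ (fun j => ?_) i
        · norm_num
        · simpa using hx j
    rw [h1, h2]
    exact hΦ

/-- The cylindrical decomposition theorem for o-minimal structures. -/
theorem hasCD : ∀ m : ℕ, HasCD L m
  | 0 => by
    intro κ _ A hA
    refine ⟨{Set.univ}, ⟨Set.finite_singleton _, ?_, Set.pairwiseDisjoint_singleton _ _, ?_⟩, ?_⟩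
    · rintro C rfl
      rfl
    · rw [Set.sUnion_singleton]
      exact (Set.eq_univ_of_forall fun x i => i.elim0).symm
    · rintro C rfl k
      rcases (A k).eq_empty_or_nonempty with h | ⟨x, hx⟩
      · exact Or.inr (by rw [h, Set.inter_empty])
      · exact Or.inl fun y _ => Subsingleton.elim x y ▸ hx
  | m + 1 => by
    intro κ _ A hA
    have hcd := hasCD m
    have hY := isSections_fibreBoundary hA
    set Y := fibreBoundary A
    obtain ⟨Φ, hΦ, hreg⟩ := hcd.exists_regular hY
    have hcard : ∀ {Φ : Set (Set (Fin m → ℝ))}, IsCylDecomp L m Φ (openCube m) →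
        (∀ C ∈ Φ, C ⊆ regularOn Y C) →
        ∃ n : Set (Fin m → ℝ) → ℕ, ∀ C ∈ Φ, ∀ x ∈ C,
          sec Y (n C) x < 1 ∧ sec Y (n C + 1) x = 1 := by
      intro Φ hΦ hreg
      have : ∀ C, ∃ n, C ∈ Φ → ∀ x ∈ C, sec Y n x < 1 ∧ sec Y (n + 1) x = 1 := by
        intro C
        by_cases hC : C ∈ Φ
        · have hcell := hΦ.isCellDecomp.2.1 C hC
          obtain ⟨k, hk⟩ := hY.exists_card (hreg C hC) hcell.isPreconnected hcell.nonempty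
          exact ⟨k, fun _ => hk⟩
        · exact ⟨0, fun h => (hC h).elim⟩
      choose n hn using this
      exact ⟨n, hn⟩
    obtain ⟨n, hn⟩ := hcard hΦ hreg
    -- A common bound for the number of sections makes the next family of sets finite.
    obtain ⟨K, hK⟩ := (hΦ.isCellDecomp.1.image n).bddAbove
    have hK' : ∀ C ∈ Φ, n C ≤ K := fun C hC => hK ⟨C, hC, rfl⟩
    -- The Boolean separates bands (`true`) from graphs (`false`): the base is refined so that over
    -- each new cell the `i`-th band lies in `A k` over every point or over none, and likewise for
    -- the `i`-th graph.
    obtain ⟨Ψ, hΨ, hcomp, hsub⟩ := hcd.exists_refinement (κ := Bool × Fin (K + 1) × κ)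
      (A := fun p => {x | (p.1 = true → ∀ t : ℝ, sec Y p.2.1 x < t → t < sec Y (p.2.1 + 1) x →
        join x t ∈ A p.2.2) ∧ (p.1 = false → join x (sec Y p.2.1 x) ∈ A p.2.2)}) (by
      rintro ⟨b, i, k⟩
      have h1 := hY.defMap_sec (i : ℕ)
      have h2 := hY.defMap_sec ((i : ℕ) + 1)
      repeat' first
        | with_reducible exact Dfn.const _
        | with_reducible first
          | refine Dfn.and ?_ ?_ | refine Dfn.imp ?_ ?_ | refine Dfn.forall ?_
          | refine Dfn.lt ?_ ?_ | refine Dfn.preimage ?_ (hA _)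
        | fun_prop) hΦ
    have hregΨ : ∀ C ∈ Ψ, C ⊆ regularOn Y C := by
      intro C' hC' x hx
      obtain ⟨C, hC, hCC⟩ := hsub C' hC'
      exact regularOn_mono hCC ⟨hx, hreg C hC (hCC hx)⟩
    obtain ⟨n', hn'⟩ := hcard hΨ hregΨ
    -- Over a subcell the sections reach `1` at the same index as over the old cell, so the bound
    -- `K` survives the refinement.
    have hn'K : ∀ C ∈ Ψ, n' C ≤ K := by
      intro C' hC'
      obtain ⟨C, hC, hCC⟩ := hsub C' hC'
      obtain ⟨x, hx⟩ := (hΨ.isCellDecomp.2.1 C' hC').nonempty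
      by_contra! hcon
      exact (hn' C' hC' x hx).1.ne (sec_eq_one
        (show n C + 1 ≤ n' C' by have := hK' C hC; omega) (hn C hC x (hCC hx)).2)
    refine ⟨_, hY.isCylDecomp_stack hΨ hregΨ hn', ?_⟩
    rintro D ⟨C, hC, i, hi, h⟩ k
    have hiK : i < K + 1 := by have := hn'K C hC; omega
    rcases h with ⟨-, rfl⟩ | rfl
    · refine (hcomp C hC (false, ⟨i, hiK⟩, k)).imp (fun h z hz => ?_)
        (fun h => Set.eq_empty_of_forall_notMem fun z hz => ?_)
      · have := (h hz.1).2 rfl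
        simpa [← hz.2] using this
      · refine h.subset (show proj z ∈ _ from ⟨hz.1.1, by simp, fun _ => ?_⟩)
        simpa [← hz.1.2] using hz.2
    · have hb : ∀ x ∈ C, ∀ t, sec Y i x < t → t < sec Y (i + 1) x → t ∉ Y x := by
        intro x hx t h1 h2 ht
        have hlt : sec Y i x < 1 := h1.trans_le (hY.subset x ht).2
        exact absurd ((hY.sec_succ hlt).2.2 t ht h1) (not_le.2 h2)
      refine (hcomp C hC (true, ⟨i, hiK⟩, k)).imp (fun h z hz => ?_)
        (fun h => Set.eq_empty_of_forall_notMem fun z hz => ?_)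
      · have := (h hz.1).1 rfl _ hz.2.1 hz.2.2
        simpa using this
      -- Consecutive sections have no boundary point between them, so one point of the band in `A k`
      -- puts its whole fibre in `A k`.
      · refine h.subset (show proj z ∈ _ from ⟨hz.1.1, fun _ t h1 h2 => ?_, by simp⟩)
        refine (join_mem_iff_of_no_fibreBoundary (hY.subset _ (hY.sec_mem i _)).1
          (hY.sec_le_one (i + 1) _) (hb _ hz.1.1) k ⟨h1, h2⟩ hz.1.2).2 ?_
        simpa using hz.2

end CD

end FortTheory

/-! ### Calculus of formats and degrees. -/

namespace FortTheory

/-- The closure properties of the families of sets of given format and degree. -/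
structure IsFDCalculus (Ω : FDFamily) : Prop where
  mono_format : ∀ {𝓕 D ℓ : ℕ}, Ω 𝓕 D ℓ ⊆ Ω (𝓕 + 1) D ℓ
  mono_degree : ∀ {𝓕 D ℓ : ℕ}, Ω 𝓕 D ℓ ⊆ Ω 𝓕 (D + 1) ℓ
  prod_left : ∀ {𝓕 D ℓ : ℕ} {X : Set (Fin ℓ → ℝ)}, X ∈ Ω 𝓕 D ℓ →
    {x : Fin (ℓ + 1) → ℝ | (fun i : Fin ℓ => x i.succ) ∈ X} ∈ Ω (𝓕 + 1) D (ℓ + 1)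
  image_proj : ∀ {𝓕 D ℓ : ℕ} {X : Set (Fin (ℓ + 1) → ℝ)}, X ∈ Ω 𝓕 D (ℓ + 1) →
    proj '' X ∈ Ω (𝓕 + 1) D ℓ
  le_format : ∀ {𝓕 D ℓ : ℕ} {X : Set (Fin ℓ → ℝ)}, X ∈ Ω 𝓕 D ℓ → ℓ ≤ 𝓕
  iInter : ∀ {k ℓ : ℕ} (𝓕 D : Fin (k + 1) → ℕ) (X : Fin (k + 1) → Set (Fin ℓ → ℝ)),
    (∀ i, X i ∈ Ω (𝓕 i) (D i) ℓ) → (⋂ i, X i) ∈ Ω (Finset.univ.sup 𝓕 + 1) (∑ i, D i) ℓ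
  zeroSet : ∀ {ℓ : ℕ} (P : MvPolynomial (Fin ℓ) ℝ),
    {x : Fin ℓ → ℝ | MvPolynomial.eval x P = 0} ∈ Ω ℓ P.totalDegree ℓ

theorem IsSharplyOMinimal.isFDCalculus {L : FirstOrder.Language.{u, v}} [L.Structure ℝ]
    {Ω : FDFamily} (h : IsSharplyOMinimal L Ω) : IsFDCalculus Ω where
  mono_format := fun h' => h.mono_format h'
  mono_degree := fun h' => h.mono_degree h'
  prod_left := h.prod_left
  image_proj := h.image_proj
  le_format := h.le_format
  iInter := h.iInter
  zeroSet := h.zeroSet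

section DefinableSets

variable (L : FirstOrder.Language.{u, v}) [L.Structure ℝ]

/-- The filtration in which every definable subset of `ℝ^ℓ` has format `ℓ` and degree `0`. -/
def trivialFD : FDFamily := fun 𝓕 _ ℓ => {X | ℓ ≤ 𝓕 ∧ Dfn L X}

variable {L} [hL : Fact (IsOMinimalExpansion L)]

theorem defMap_mvPolynomial {ℓ : ℕ} (P : MvPolynomial (Fin ℓ) ℝ) :
    DefMap L (fun x : Fin ℓ → ℝ => MvPolynomial.eval x P) := by
  induction P using MvPolynomial.induction_on with
  | C a => simpa using DefMap.const a
  | add p q hp hq => simpa using hp.add hq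
  | mul_X p i hp => simpa using hp.mul (DefMap.apply i)

/-- For this filtration the estimates are void, and the construction with formats and degrees also
yields the o-minimal statement. -/
theorem isFDCalculus_trivialFD : IsFDCalculus (trivialFD L) where
  mono_format := fun h => ⟨h.1.trans (Nat.le_succ _), h.2⟩
  mono_degree := fun h => h
  prod_left := fun h => ⟨Nat.succ_le_succ h.1,
    Dfn.preimage (f := fun x : Fin _ → ℝ => fun i => x (Fin.succ i)) (by fun_prop) h.2⟩
  image_proj := fun {𝓕 D ℓ X} h => by
    refine ⟨by have := h.1; omega, ?_⟩
    have : Dfn L {x : Fin ℓ → ℝ | ∃ t : ℝ, join x t ∈ X} :=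
      Dfn.exists (Dfn.preimage (by fun_prop) h.2)
    convert! this using 1
    ext x
    constructor
    · rintro ⟨z, hz, rfl⟩; exact ⟨z (Fin.last ℓ), by simpa using hz⟩
    · rintro ⟨t, ht⟩; exact ⟨_, ht, by simp⟩
  le_format := fun h => h.1
  iInter := fun 𝓕 D X h => by
    refine ⟨(h 0).1.trans ((Finset.le_sup (f := 𝓕) (Finset.mem_univ 0)).trans (Nat.le_succ _)), ?_⟩
    have := Dfn.forall_finite (P := fun i x => x ∈ X i) fun i => (h i).2
    convert! this using 1
    ext x; simp
  zeroSet := fun P => ⟨le_rfl, Dfn.eq (defMap_mvPolynomial P) (DefMap.const 0)⟩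

end DefinableSets

namespace IsFDCalculus

variable {Ω : FDFamily}

theorem mono (hΩ : IsFDCalculus Ω) {𝓕 𝓕' D D' ℓ : ℕ} {X : Set (Fin ℓ → ℝ)} (h : X ∈ Ω 𝓕 D ℓ) (h1 : 𝓕 ≤ 𝓕')
    (h2 : D ≤ D') : X ∈ Ω 𝓕' D' ℓ := by
  induction h1 with
  | refl =>
    induction h2 with
    | refl => exact h
    | step _ ih => exact hΩ.mono_degree ih
  | step _ ih => exact hΩ.mono_format ih

theorem iInter' (hΩ : IsFDCalculus Ω) {k ℓ 𝓕 D : ℕ} {X : Fin (k + 1) → Set (Fin ℓ → ℝ)} (h : ∀ i, X i ∈ Ω 𝓕 D ℓ) :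
    (⋂ i, X i) ∈ Ω (𝓕 + 1) ((k + 1) * D) ℓ := by
  refine hΩ.mono (hΩ.iInter (fun _ => 𝓕) (fun _ => D) X h) ?_ ?_
  · exact Nat.succ_le_succ (Finset.sup_le fun _ _ => le_rfl)
  · simp

theorem inter (hΩ : IsFDCalculus Ω) {ℓ 𝓕 D : ℕ} {X Y : Set (Fin ℓ → ℝ)} (hX : X ∈ Ω 𝓕 D ℓ) (hY : Y ∈ Ω 𝓕 D ℓ) :
    X ∩ Y ∈ Ω (𝓕 + 1) (2 * D) ℓ := by
  have := hΩ.iInter' (k := 1) (X := ![X, Y]) (𝓕 := 𝓕) (D := D) (by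
    intro i; fin_cases i <;> assumption)
  convert this using 1
  ext x
  simp [Fin.forall_fin_two]

/-- Coordinates are added on the left one at a time. The length `N` is a variable tied to `n + m` by
an equation, which avoids casts in the recursion. -/
theorem lift (hΩ : IsFDCalculus Ω) {m 𝓕 D : ℕ} {X : Set (Fin m → ℝ)} (hX : X ∈ Ω 𝓕 D m) : ∀ (n N : ℕ) (h : n + m = N),
    {z : Fin N → ℝ | (fun i : Fin m => z ⟨n + i, by omega⟩) ∈ X} ∈ Ω (𝓕 + n) D N
  | 0, N, h => by
    obtain rfl : m = N := by omega
    have h : {z : Fin m → ℝ | (fun i : Fin m => z ⟨0 + i, by omega⟩) ∈ X} = X := by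
      ext z; simp
    rwa [h]
  | n + 1, N, h => by
    obtain ⟨N', rfl⟩ : ∃ N', N = N' + 1 := ⟨n + m, by omega⟩
    have := hΩ.prod_left (hΩ.lift hX n N' (by omega))
    have e : ∀ (z : Fin (N' + 1) → ℝ) (i : Fin m),
        z ⟨n + 1 + i, by omega⟩ = z (Fin.succ ⟨n + i, by omega⟩) := fun z i =>
      congrArg z (Fin.ext (by simp; omega))
    simpa only [e] using! this

theorem exists_append (hΩ : IsFDCalculus Ω) {n 𝓕 D : ℕ} : ∀ {k : ℕ} {S : Set (Fin (n + k) → ℝ)}, S ∈ Ω 𝓕 D (n + k) →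
    {x : Fin n → ℝ | ∃ u : Fin k → ℝ, Fin.append x u ∈ S} ∈ Ω (𝓕 + k) D n
  | 0, S, hS => by
    have h : ∀ (x : Fin n → ℝ) (u : Fin 0 → ℝ), Fin.append x u = x := fun x u => by
      rw [Subsingleton.elim u Fin.elim0, Fin.append_elim0]; rfl
    have h' : {x : Fin n → ℝ | ∃ u : Fin 0 → ℝ, Fin.append x u ∈ S} = S := by
      ext x; simp [h]
    rwa [h']
  | k + 1, S, hS => by
    have := hΩ.mono (hΩ.exists_append (k := k) (hΩ.image_proj (ℓ := n + k) hS))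
      (show 𝓕 + 1 + k ≤ 𝓕 + (k + 1) by omega) le_rfl
    convert this using 1
    ext x
    constructor
    · rintro ⟨u, hu⟩
      refine ⟨proj u, _, hu, ?_⟩
      ext i
      refine Fin.addCases (fun i => ?_) (fun i => ?_) i
      · rw [Fin.append_left, proj, show (Fin.castAdd k i).castSucc = Fin.castAdd (k + 1) i from rfl,
          Fin.append_left]
      · rw [Fin.append_right, proj,
          show (Fin.natAdd n i).castSucc = Fin.natAdd n i.castSucc from rfl, Fin.append_right]
        rfl
    · rintro ⟨u, z, hz, hzu⟩
      refine ⟨join u (z (Fin.last _)), ?_⟩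
      have e : Fin.append x (join u (z (Fin.last _))) = z := ?_
      · rwa [e]
      ext i
      refine Fin.addCases (fun i => ?_) (fun i => ?_) i
      · rw [Fin.append_left]
        have := congrFun hzu (Fin.castAdd k i)
        rw [Fin.append_left] at this
        exact this.symm
      · rw [Fin.append_right]
        refine Fin.lastCases ?_ (fun j => ?_) i
        · rw [join_last]; rfl
        · rw [join_castSucc]
          have := congrFun hzu (Fin.natAdd n j)
          rw [Fin.append_right] at this
          exact this.symm

/-- Preimages under polynomial maps. -/
theorem preimage (hΩ : IsFDCalculus Ω) {m n 𝓕 D d : ℕ} {X : Set (Fin m → ℝ)} (hX : X ∈ Ω 𝓕 D m)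
    (p : Fin m → MvPolynomial (Fin n) ℝ) (hp : ∀ j, (p j).totalDegree ≤ d) (hd : 1 ≤ d) :
    {x : Fin n → ℝ | (fun j => MvPolynomial.eval x (p j)) ∈ X} ∈
      Ω (2 * 𝓕 + n + 1) (D + 𝓕 * d) n := by
  have hm := hΩ.le_format hX
  -- The equations `y j = p j (x)` of the graph. The preimage is the projection to the `x` of this
  -- graph intersected with the cylinder over `X`: lifting adds `n` to the format, intersecting adds
  -- `1`, and projecting adds `m ≤ 𝓕`.
  let Q : Fin m → MvPolynomial (Fin (n + m)) ℝ := fun j =>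
    MvPolynomial.X (Fin.natAdd n j) - MvPolynomial.rename (Fin.castAdd m) (p j)
  have hQ : ∀ j, (Q j).totalDegree ≤ d := fun j =>
    (MvPolynomial.totalDegree_sub _ _).trans (max_le (by simpa using hd)
      ((MvPolynomial.totalDegree_rename_le _ _).trans (hp j)))
  have h1 := hΩ.iInter (k := m) (Fin.cons (𝓕 + n) fun _ => n + m) (Fin.cons D fun _ => d)
    (Fin.cons {z : Fin (n + m) → ℝ | (fun i : Fin m => z (Fin.natAdd n i)) ∈ X}
      fun j => {z | MvPolynomial.eval z (Q j) = 0}) (by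
    refine Fin.cases ?_ fun j => ?_
    · exact hΩ.lift hX n (n + m) rfl
    · exact hΩ.mono (hΩ.zeroSet (Q j)) le_rfl (hQ j))
  have h2 := hΩ.exists_append h1
  refine hΩ.mono (D := D + m * d) ?_ (le_refl _)
    (Nat.add_le_add_left (Nat.mul_le_mul_right _ hm) _)
  convert hΩ.mono h2 (𝓕' := 2 * 𝓕 + n + 1) (D' := D + m * d) ?_ ?_ using 1
  · ext x
    simp only [Set.mem_ofPred_eq, Set.mem_iInter, Fin.forall_fin_succ, Fin.cons_zero,
      Fin.cons_succ, Q, map_sub, MvPolynomial.eval_X, Fin.append_right,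
      MvPolynomial.eval_rename, sub_eq_zero]
    have h : ∀ u : Fin m → ℝ, (Fin.append x u ∘ Fin.castAdd m) = x := fun u => by
      ext i; simp
    simp only [h]
    constructor
    · intro hx
      exact ⟨_, hx, fun _ => rfl⟩
    · rintro ⟨u, hu, h⟩
      rwa [← funext h]
  · have : Finset.univ.sup (Fin.cons (𝓕 + n) fun _ => n + m : Fin (m + 1) → ℕ) ≤ 𝓕 + n := by
      refine Finset.sup_le fun i _ => ?_
      refine Fin.cases ?_ (fun j => ?_) i
      · simp
      · simp; omega
    omega
  · simp [Fin.sum_univ_succ]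

theorem preimage_comp (hΩ : IsFDCalculus Ω) {m n 𝓕 D : ℕ} {X : Set (Fin m → ℝ)} (hX : X ∈ Ω 𝓕 D m)
    (σ : Fin m → Fin n) :
    {x : Fin n → ℝ | (fun j => x (σ j)) ∈ X} ∈ Ω (2 * 𝓕 + n + 1) (D + 𝓕) n := by
  simpa using hΩ.preimage hX (fun j => MvPolynomial.X (σ j)) (d := 1) (by simp) le_rfl

theorem preimage_smul (hΩ : IsFDCalculus Ω) {m 𝓕 D : ℕ} {X : Set (Fin m → ℝ)} (hX : X ∈ Ω 𝓕 D m) (c : Fin m → ℝ) :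
    {x : Fin m → ℝ | (fun j => c j * x j) ∈ X} ∈ Ω (2 * 𝓕 + m + 1) (D + 𝓕) m := by
  simpa using hΩ.preimage hX (fun j => MvPolynomial.C (c j) * MvPolynomial.X j) (d := 1)
    (fun j => (MvPolynomial.totalDegree_mul _ _).trans (by simp)) le_rfl

/-- The interval `(k, k + 1)` is the projection of the curve `y² (x - k) (k + 1 - x) = 1` of degree
`4`, so the bounds do not depend on `k`. -/
theorem intCell₁ (hΩ : IsFDCalculus Ω) {c : Set ℝ} (hc : IsIntCell₁ c) : {x : Fin 1 → ℝ | x 0 ∈ c} ∈ Ω 3 4 1 := by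
  obtain ⟨k, rfl | rfl⟩ := hc
  · have := hΩ.zeroSet (MvPolynomial.X 0 - MvPolynomial.C (k : ℝ) : MvPolynomial (Fin 1) ℝ)
    simp only [map_sub, MvPolynomial.eval_X, MvPolynomial.eval_C, sub_eq_zero] at this
    refine hΩ.mono this (by norm_num) ?_
    exact (MvPolynomial.totalDegree_sub _ _).trans
      (max_le (by simp) (by rw [MvPolynomial.totalDegree_C]; simp))
  · let Q : MvPolynomial (Fin 2) ℝ := MvPolynomial.X 1 ^ 2 *
      ((MvPolynomial.X 0 - MvPolynomial.C (k : ℝ)) *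
        (MvPolynomial.C ((k : ℝ) + 1) - MvPolynomial.X 0)) - MvPolynomial.C 1
    have hQ : Q.totalDegree ≤ 4 := by
      refine (MvPolynomial.totalDegree_sub _ _).trans (max_le ?_ (by simp))
      refine (MvPolynomial.totalDegree_mul _ _).trans ?_
      refine (Nat.add_le_add (b := 2) (d := 2) ?_ ?_).trans le_rfl
      · exact (MvPolynomial.totalDegree_pow _ _).trans (by simp)
      · refine (MvPolynomial.totalDegree_mul _ _).trans
          (Nat.add_le_add (b := 1) (d := 1) ?_ ?_)
        · exact (MvPolynomial.totalDegree_sub _ _).trans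
            (max_le (by simp) (by rw [MvPolynomial.totalDegree_C]; simp))
        · exact (MvPolynomial.totalDegree_sub _ _).trans
            (max_le (by rw [MvPolynomial.totalDegree_C]; simp) (by simp))
    refine hΩ.mono (hΩ.image_proj (hΩ.zeroSet Q)) le_rfl hQ |> fun h => ?_
    convert h using 1
    ext x
    simp only [Set.mem_ofPred_eq, Set.mem_image, Q, map_sub, map_mul, map_pow,
      MvPolynomial.eval_X, MvPolynomial.eval_C, Set.mem_Ioo]
    constructor
    · rintro ⟨h1, h2⟩
      have h3 : 0 < (x 0 - k) * (k + 1 - x 0) := mul_pos (by linarith) (by linarith)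
      refine ⟨join x (√((x 0 - k) * (k + 1 - x 0)))⁻¹, ?_, by simp⟩
      rw [show (1 : Fin 2) = Fin.last 1 from rfl, join_last, show (0 : Fin 2) = Fin.castSucc 0 from
        rfl, join_castSucc, inv_pow, Real.sq_sqrt h3.le, inv_mul_cancel₀ h3.ne', sub_self]
    · rintro ⟨z, hz, rfl⟩
      have e : proj z 0 = z 0 := rfl
      rw [e]
      have h3 : 0 < (z 0 - k) * (k + 1 - z 0) := by
        by_contra! hcon
        nlinarith [sq_nonneg (z 1)]
      constructor
      · by_contra! hcon
        nlinarith
      · by_contra! hcon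
        nlinarith

theorem coord_mem_intCell₁ (hΩ : IsFDCalculus Ω) {c : Set ℝ} (hc : IsIntCell₁ c) {n : ℕ} (i : Fin n) :
    {x : Fin n → ℝ | x i ∈ c} ∈ Ω (n + 7) 7 n :=
  hΩ.mono (hΩ.preimage_comp (hΩ.intCell₁ hc) fun _ => i) (by omega) le_rfl

theorem intCell (hΩ : IsFDCalculus Ω) {ℓ : ℕ} (hℓ : 1 ≤ ℓ) {C : Set (Fin ℓ → ℝ)} (hC : IsIntCell C) :
    C ∈ Ω (ℓ + 8) (ℓ * 7) ℓ := by
  obtain ⟨c, hc, rfl⟩ := hC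
  obtain ⟨n, rfl⟩ : ∃ n, ℓ = n + 1 := ⟨ℓ - 1, by omega⟩
  convert hΩ.iInter' (fun i => hΩ.coord_mem_intCell₁ (hc i) i) using 1
  ext x; simp

end IsFDCalculus

end FortTheory

/-! ### Building a chart one coordinate at a time. -/

namespace FortTheory

open Filter Topology

/-! ### Piecewise linear interpolation -/

/-- The piecewise linear interpolation of a sequence. -/
noncomputable def interp (g : ℕ → ℝ) (s : ℝ) : ℝ :=
  g ⌊s⌋₊ + (s - ⌊s⌋₊) * (g (⌊s⌋₊ + 1) - g ⌊s⌋₊)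

theorem interp_natCast (g : ℕ → ℝ) (i : ℕ) : interp g i = g i := by
  simp [interp]

theorem interp_of_mem_Ioo (g : ℕ → ℝ) {i : ℕ} {s : ℝ} (h1 : (i : ℝ) < s) (h2 : s < i + 1) :
    interp g s = g i + (s - i) * (g (i + 1) - g i) := by
  have : ⌊s⌋₊ = i := (Nat.floor_eq_iff ((Nat.cast_nonneg i).trans h1.le)).2 ⟨h1.le, h2⟩
  rw [interp, this]

theorem interp_lt {g : ℕ → ℝ} {n : ℕ} (hg : ∀ i j, i < j → j ≤ n → g i < g j) {s t : ℝ}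
    (hs : 0 ≤ s) (hst : s < t) (ht : t ≤ n) : interp g s < interp g t := by
  have h1 := Nat.floor_le hs
  have h2 := Nat.lt_floor_add_one s
  have h3 := Nat.floor_le (hs.trans hst.le)
  have hsn : ⌊s⌋₊ < n := by
    have : (⌊s⌋₊ : ℝ) < n := by linarith
    exact_mod_cast this
  have h4 := hg ⌊s⌋₊ (⌊s⌋₊ + 1) (by omega) (by omega)
  rcases (Nat.floor_mono hst.le).eq_or_lt with h | h
  · unfold interp
    rw [← h]
    nlinarith
  · have h5 : interp g s < g (⌊s⌋₊ + 1) := by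
      unfold interp
      nlinarith
    have h6 : g (⌊s⌋₊ + 1) ≤ g ⌊t⌋₊ := by
      have hle : ⌊t⌋₊ ≤ n := by
        have := (Nat.floor_mono ht)
        simpa using this
      rcases (Nat.succ_le_iff.2 h).eq_or_lt with h' | h'
      · rw [← h']
      · exact (hg _ _ h' hle).le
    have h7 : g ⌊t⌋₊ ≤ interp g t := by
      unfold interp
      have hle : (⌊t⌋₊ : ℝ) ≤ n := h3.trans ht
      -- If `⌊t⌋₊ = n`, the uncontrolled value `g (n + 1)` appears in the formula, but with factor
      -- zero.
      rcases hle.eq_or_lt with h' | h'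
      · have : t - ⌊t⌋₊ = 0 := by linarith
        rw [this]; simp
      · have h' : ⌊t⌋₊ < n := by exact_mod_cast h'
        have := hg ⌊t⌋₊ (⌊t⌋₊ + 1) (by omega) (by omega)
        have := mul_nonneg (sub_nonneg.2 h3) (sub_pos.2 this).le
        linarith
    linarith

/-! ### The cells above a cell -/

section Stack

variable {ℓ : ℕ}

theorem lt_of_isPreconnected {B : Set (Fin ℓ → ℝ)} (hB : IsPreconnected B) {f g : (Fin ℓ → ℝ) → ℝ}
    (hf : ContinuousOn f B) (hg : ContinuousOn g B) (hne : ∀ x ∈ B, f x ≠ g x) {x₀ x}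
    (hx₀ : x₀ ∈ B) (hx : x ∈ B) (h : f x₀ < g x₀) : f x < g x := by
  refine (iff_of_isPreconnected hB (p := fun x => f x < g x) (fun y hy => ?_) hx₀ hx).1 h
  rcases (hne y hy).lt_or_gt with h | h
  · filter_upwards [(hf y hy).eventually_lt (hg y hy) h] with z hz
    exact iff_of_true hz h
  · filter_upwards [(hg y hy).eventually_lt (hf y hy) h] with z hz
    exact iff_of_false hz.not_gt h.not_gt

theorem bandCell_congr {B : Set (Fin ℓ → ℝ)} {f g f' g' : (Fin ℓ → ℝ) → ℝ}
    (h : ∀ x ∈ B, f x = f' x) (h' : ∀ x ∈ B, g x = g' x) :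
    bandCell B f g = bandCell B f' g' := by
  ext z
  exact and_congr_right fun hz => by rw [h _ hz, h' _ hz]

/-- A finite partition of `B × (0,H)` into cells over `B` is given by an increasing sequence of
continuous functions. -/
theorem exists_stack {B : Set (Fin ℓ → ℝ)} (hB : IsPreconnected B) (hne : B.Nonempty)
    {S : Set (Set (Fin (ℓ + 1) → ℝ))} (hfin : S.Finite) (hdisj : S.PairwiseDisjoint id)
    {H : ℝ} (hH : 0 < H)
    (hcell : ∀ C ∈ S, (∃ f, ContinuousOn f B ∧ C = graphCell B f) ∨
      ∃ f g, ContinuousOn f B ∧ ContinuousOn g B ∧ (∀ x ∈ B, f x < g x) ∧ C = bandCell B f g)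
    (hS : ⋃₀ S = bandCell B (fun _ => 0) fun _ => H) :
    ∃ (k : ℕ) (f : ℕ → (Fin ℓ → ℝ) → ℝ), (f 0 = fun _ => 0) ∧ (f (k + 1) = fun _ => H) ∧
      (∀ i j, i < j → j ≤ k + 1 → ∀ x ∈ B, f i x < f j x) ∧
      (∀ i ≤ k + 1, ContinuousOn (f i) B) ∧
      (∀ i, 1 ≤ i → i ≤ k → graphCell B (f i) ∈ S) ∧
      ∀ i ≤ k, bandCell B (f i) (f (i + 1)) ∈ S := by
  classical
  obtain ⟨x₀, hx₀⟩ := hne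
  have hsub : ∀ C ∈ S, C ⊆ bandCell B (fun _ => 0) fun _ => H := fun C hC =>
    hS ▸ Set.subset_sUnion_of_mem hC
  have heq : ∀ C ∈ S, ∀ C' ∈ S, ∀ z, z ∈ C → z ∈ C' → C = C' := by
    intro C hC C' hC' z hz hz'
    by_contra h
    exact Set.disjoint_left.1 (hdisj hC hC' h) hz hz'
  let G : Set ((Fin ℓ → ℝ) → ℝ) := {f | ContinuousOn f B ∧ graphCell B f ∈ S}
  have hGval : ∀ f ∈ G, ∀ x ∈ B, 0 < f x ∧ f x < H := by
    intro f hf x hx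
    have := hsub _ hf.2 (show join x (f x) ∈ _ by simpa using hx)
    simpa [hx] using this
  have hGeq : ∀ f ∈ G, ∀ g ∈ G, ∀ x ∈ B, f x = g x → ∀ y ∈ B, f y = g y := by
    intro f hf g hg x hx hxe y hy
    have := heq _ hf.2 _ hg.2 (join x (f x)) (by simpa using hx) (by simpa using ⟨hx, hxe⟩)
    have hmem : join y (f y) ∈ graphCell B f := by simpa using hy
    rw [this] at hmem
    simpa [hy] using hmem
  have hTfin : ((fun f : (Fin ℓ → ℝ) → ℝ => f x₀) '' G).Finite := by
    -- The value at `x₀` is recovered from the graph as the supremum of a one-point fibre, so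
    -- finitely many cells give finitely many values.
    refine (hfin.image fun C => sSup {t | join x₀ t ∈ C}).subset ?_
    rintro _ ⟨f, hf, rfl⟩
    refine ⟨_, hf.2, ?_⟩
    have : {t | join x₀ t ∈ graphCell B f} = {f x₀} := by
      ext t; simp [hx₀]
    simp only [this, csSup_singleton]
  -- The graphs in `S` are sorted by their values at `x₀`. Disjoint graphs over a connected base
  -- never cross, so this order holds over all of `B`.
  let T : Finset ℝ := hTfin.toFinset
  let e := T.orderEmbOfFin rfl
  have he : ∀ i, ∃ f ∈ G, f x₀ = e i := by
    intro i
    exact hTfin.mem_toFinset.1 (T.orderEmbOfFin_mem rfl i)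
  choose q hq hqe using he
  -- Index `0` is the bottom, the indices `1` to `T.card` are the sorted graphs, and every later
  -- index is the top `H`.
  let f : ℕ → (Fin ℓ → ℝ) → ℝ := fun i =>
    if i = 0 then fun _ => 0 else if h : i - 1 < T.card then q ⟨i - 1, h⟩ else fun _ => H
  have hf0 : f 0 = fun _ => 0 := by simp [f]
  have hfi : ∀ i (h : i < T.card), f (i + 1) = q ⟨i, h⟩ := fun i h => by simp [f, h]
  have hfH : f (T.card + 1) = fun _ => H := by simp [f]
  have hfG : ∀ i, 1 ≤ i → i ≤ T.card → f i ∈ G := by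
    intro i h1 h2
    obtain ⟨j, rfl⟩ : ∃ j, i = j + 1 := ⟨i - 1, by omega⟩
    rw [hfi j (by omega)]
    exact hq _
  have hmono : ∀ i j, i < j → j ≤ T.card + 1 → ∀ x ∈ B, f i x < f j x := by
    intro i j hij hj x hx
    rcases hj.eq_or_lt with rfl | hj
    · rw [hfH]
      rcases i with _ | i
      · rw [hf0]; exact hH
      · exact (hGval _ (hfG _ (by omega) (by omega)) x hx).2
    · rcases i with _ | i
      · rw [hf0]; exact (hGval _ (hfG _ (by omega) (by omega)) x hx).1
      · obtain ⟨j, rfl⟩ : ∃ j', j = j' + 1 := ⟨j - 1, by omega⟩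
        have h0 : f (i + 1) x₀ < f (j + 1) x₀ := by
          rw [hfi i (by omega), hfi j (by omega), hqe, hqe]
          exact e.strictMono (by simpa using hij)
        have hi := hfG (i + 1) (by omega) (by omega)
        have hj' := hfG (j + 1) (by omega) (by omega)
        refine lt_of_isPreconnected hB hi.1 hj'.1 (fun y hy h => ?_) hx₀ hx h0
        exact h0.ne (hGeq _ hi _ hj' y hy h x₀ hx₀)
  have honly : ∀ g ∈ G, ∃ i, 1 ≤ i ∧ i ≤ T.card ∧ ∀ x ∈ B, g x = f i x := by
    intro g hg
    have : g x₀ ∈ Set.range e := by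
      rw [Finset.range_orderEmbOfFin]
      simpa [T] using ⟨g, hg, rfl⟩
    obtain ⟨i, hi⟩ := this
    refine ⟨i + 1, by omega, by omega, ?_⟩
    rw [hfi i i.2]
    exact hGeq g hg _ (hq i) x₀ hx₀ ((hqe i).trans hi).symm
  have hcont : ∀ i ≤ T.card + 1, ContinuousOn (f i) B := by
    intro i hi
    rcases i with _ | i
    · rw [hf0]; exact continuousOn_const
    · rcases hi.eq_or_lt with h | h
      · rw [h, hfH]; exact continuousOn_const
      · exact (hfG (i + 1) (by omega) (by omega)).1
  -- no graph passes strictly between consecutive functions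
  have hbetween : ∀ i ≤ T.card, ∀ x ∈ B, ∀ t, f i x < t → t < f (i + 1) x → ∀ g ∈ G, g x ≠ t := by
    rintro i hi x hx t h1 h2 g hg rfl
    obtain ⟨j, hj1, hj2, hj⟩ := honly g hg
    rw [hj x hx] at h1 h2
    rcases lt_or_ge i j with h | h
    · rcases (Nat.succ_le_iff.2 h).eq_or_lt with h | h
      · rw [← h] at h2
        exact lt_irrefl _ h2
      · exact lt_asymm h2 (hmono (i + 1) j h (by omega) x hx)
    · rcases h.eq_or_lt with rfl | h
      · exact lt_irrefl _ h1
      · exact lt_asymm h1 (hmono j i h (by omega) x hx)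
  have hex : ∀ i ≤ T.card, ∀ x ∈ B, ∀ t, f i x < t → t < f (i + 1) x → ∃ a b, ContinuousOn a B ∧
      ContinuousOn b B ∧ (∀ x ∈ B, a x < b x) ∧ bandCell B a b ∈ S ∧ a x < t ∧ t < b x := by
    intro i hi x hx t h1 h2
    have h0 : 0 ≤ f i x := by
      rcases i with _ | i
      · rw [hf0]
      · exact (hGval _ (hfG (i + 1) (by omega) hi) x hx).1.le
    have h3 : f (i + 1) x ≤ H := by
      rcases hi.eq_or_lt with rfl | hi
      · rw [hfH]
      · exact (hGval _ (hfG (i + 1) (by omega) (by omega)) x hx).2.le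
    have : join x t ∈ ⋃₀ S := by
      rw [hS]
      simp only [join_mem_bandCell]
      exact ⟨hx, by linarith, by linarith⟩
    obtain ⟨C, hC, hxC⟩ := this
    rcases hcell C hC with ⟨g, hg, rfl⟩ | ⟨a, b, ha, hb, hab, rfl⟩
    · rw [join_mem_graphCell] at hxC
      exact absurd hxC.2.symm (hbetween i hi x hx t h1 h2 g ⟨hg, hC⟩)
    · rw [join_mem_bandCell] at hxC
      exact ⟨a, b, ha, hb, hab, hC, hxC.2⟩
  -- A band of `S` cannot contain a point of one of the graphs: the two cells would coincide, while
  -- the band has further points in the same fibre.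
  have hnotin : ∀ i ≤ T.card + 1, ∀ x ∈ B, ∀ a b, bandCell B a b ∈ S →
      ¬ (a x < f i x ∧ f i x < b x) := by
    intro i hi x hx a b hab h
    have hmem : join x (f i x) ∈ bandCell B a b := by simpa [hx] using h
    have h2 := hsub _ hab hmem
    simp only [join_mem_bandCell] at h2
    rcases i with _ | i
    · rw [hf0] at h2; exact lt_irrefl _ h2.2.1
    rcases hi.eq_or_lt with h' | h'
    · rw [h', hfH] at h2; exact lt_irrefl _ h2.2.2
    have hg := hfG (i + 1) (by omega) (by omega)
    have he := heq _ hg.2 _ hab (join x (f (i + 1) x)) (by simpa using hx) hmem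
    obtain ⟨t, ht1, ht2⟩ := exists_between h.1
    have hmem' : join x t ∈ bandCell B a b := by
      simp only [join_mem_bandCell]; exact ⟨hx, ht1, ht2.trans h.2⟩
    rw [← he, join_mem_graphCell] at hmem'
    exact ht2.ne hmem'.2
  -- If an end of the band lay strictly between two consecutive functions, another band of `S` would
  -- contain that end point and overlap the first band, hence equal it; but a band does not contain
  -- its own ends.
  have hends : ∀ i ≤ T.card, ∀ x ∈ B, ∀ t, f i x < t → t < f (i + 1) x → ∀ a b,
      bandCell B a b ∈ S → a x < t → t < b x → a x = f i x ∧ b x = f (i + 1) x := by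
    intro i hi x hx t h1 h2 a b hab hat hbt
    have ha1 : f i x ≤ a x := by
      by_contra! hcon
      exact hnotin i (by omega) x hx a b hab ⟨hcon, h1.trans hbt⟩
    have hb1 : b x ≤ f (i + 1) x := by
      by_contra! hcon
      exact hnotin (i + 1) (by omega) x hx a b hab ⟨hat.trans h2, hcon⟩
    refine ⟨le_antisymm ?_ ha1, le_antisymm hb1 ?_⟩
    · by_contra! hcon
      obtain ⟨a', b', -, -, -, hab', h3, h4⟩ := hex i hi x hx (a x) hcon (hat.trans h2)
      obtain ⟨s, hs1, hs2⟩ := exists_between (lt_min (hat.trans hbt) h4)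
      rw [lt_min_iff] at hs2
      have he := heq _ hab _ hab' (join x s) (by simp [hx, hs1, hs2]) (by
        simp only [join_mem_bandCell]; exact ⟨hx, h3.trans hs1, hs2.2⟩)
      have : join x (a x) ∈ bandCell B a' b' := by simp [hx, h3, h4]
      rw [← he] at this
      simp at this
    · by_contra! hcon
      obtain ⟨a', b', -, -, -, hab', h3, h4⟩ := hex i hi x hx (b x) (h1.trans hbt) hcon
      obtain ⟨s, hs1, hs2⟩ := exists_between (max_lt (hat.trans hbt) h3)
      rw [max_lt_iff] at hs1
      have he := heq _ hab _ hab' (join x s) (by simp [hx, hs1, hs2]) (by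
        simp only [join_mem_bandCell]; exact ⟨hx, hs1.2, hs2.trans h4⟩)
      have : join x (b x) ∈ bandCell B a' b' := by simp [hx, h3, h4]
      rw [← he] at this
      simp at this
  refine ⟨T.card, f, hf0, hfH, hmono, hcont, fun i h1 h2 => (hfG i h1 h2).2, fun i hi => ?_⟩
  obtain ⟨t, ht1, ht2⟩ := exists_between (hmono i (i + 1) (by omega) (by omega) x₀ hx₀)
  obtain ⟨a, b, ha, hb, hab, habS, hat, hbt⟩ := hex i hi x₀ hx₀ t ht1 ht2
  obtain ⟨e1, e2⟩ := hends i hi x₀ hx₀ t ht1 ht2 a b habS hat hbt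
  -- The midline of the band found over `x₀`. It never meets any `f j`, so it stays between `f i`
  -- and `f (i + 1)` over all of `B`, and `hends` then identifies the band over every point.
  let c : (Fin ℓ → ℝ) → ℝ := fun x => (a x + b x) / 2
  have hc : ContinuousOn c B := (ha.add hb).div_const 2
  have hac : ∀ x ∈ B, a x < c x ∧ c x < b x := fun x hx => by
    have := hab x hx
    constructor <;> simp only [c] <;> linarith
  have hcne : ∀ j ≤ T.card + 1, ∀ x ∈ B, c x ≠ f j x := by
    intro j hj x hx h
    have := hac x hx
    rw [h] at this
    exact hnotin j hj x hx a b habS this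
  have hpos : ∀ x ∈ B, f i x < c x ∧ c x < f (i + 1) x := by
    intro x hx
    constructor
    · exact lt_of_isPreconnected hB (hcont i (by omega)) hc
        (fun y hy => (hcne i (by omega) y hy).symm) hx₀ hx (by rw [← e1]; exact (hac x₀ hx₀).1)
    · exact lt_of_isPreconnected hB hc (hcont (i + 1) (by omega))
        (fun y hy => hcne (i + 1) (by omega) y hy) hx₀ hx (by rw [← e2]; exact (hac x₀ hx₀).2)
  have hall : ∀ x ∈ B, a x = f i x ∧ b x = f (i + 1) x := fun x hx =>
    hends i hi x hx (c x) (hpos x hx).1 (hpos x hx).2 a b habS (hac x hx).1 (hac x hx).2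
  rw [← bandCell_congr (fun x hx => (hall x hx).1) fun x hx => (hall x hx).2]
  exact habS

end Stack

/-! ### Formats of graphs -/

theorem append_mem_graphOn {m n : ℕ} {f : (Fin m → ℝ) → Fin n → ℝ} {B : Set (Fin m → ℝ)} {x y} :
    Fin.append x y ∈ graphOn f B ↔ x ∈ B ∧ y = f x := by
  constructor
  · rintro ⟨x', hx', h⟩
    have h1 : x = x' := by
      ext i; simpa using congrFun h (Fin.castAdd n i)
    subst h1
    refine ⟨hx', ?_⟩
    ext i; simpa using congrFun h (Fin.natAdd m i)
  · rintro ⟨hx, rfl⟩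
    exact ⟨x, hx, rfl⟩

theorem IsFDCalculus.inter₅ {Ω : FDFamily} (hΩ : IsFDCalculus Ω) {ℓ 𝓕 D : ℕ}
    {X₁ X₂ X₃ X₄ X₅ : Set (Fin ℓ → ℝ)} (h₁ : X₁ ∈ Ω 𝓕 D ℓ) (h₂ : X₂ ∈ Ω 𝓕 D ℓ) (h₃ : X₃ ∈ Ω 𝓕 D ℓ)
    (h₄ : X₄ ∈ Ω 𝓕 D ℓ) (h₅ : X₅ ∈ Ω 𝓕 D ℓ) :
    {x | x ∈ X₁ ∧ x ∈ X₂ ∧ x ∈ X₃ ∧ x ∈ X₄ ∧ x ∈ X₅} ∈ Ω (𝓕 + 1) (5 * D) ℓ := by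
  have := hΩ.iInter' (k := 4) (X := ![X₁, X₂, X₃, X₄, X₅]) (𝓕 := 𝓕) (D := D) (by
    intro i; fin_cases i <;> assumption)
  convert this using 1
  ext x
  simp [Fin.forall_fin_succ]
  tauto

/-- Two auxiliary variables `u`, `v` stand for the values of `f` and `g` at `ψ (proj z)`. The graph
is then the projection along `u`, `v` of five conditions: the graphs of `ψ`, `f` and `g`, the
condition on the last coordinate of `z`, and one quadratic equation `Q = 0`. Renaming variables
gives format at most `2 * a + 2 * ℓ + 5`, the intersection adds `1`, and the two projections add
`2`. -/
theorem IsFDCalculus.graphOn_join {Ω : FDFamily} (hΩ : IsFDCalculus Ω) {ℓ a b : ℕ} (ha : 3 ≤ a)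
    (hb : 4 ≤ b) {ψ : (Fin ℓ → ℝ) → Fin ℓ → ℝ} {C B : Set (Fin ℓ → ℝ)} {f g : (Fin ℓ → ℝ) → ℝ}
    (hψ : graphOn ψ C ∈ Ω a b (ℓ + ℓ)) (hf : graphCell B f ∈ Ω a b (ℓ + 1))
    (hg : graphCell B g ∈ Ω a b (ℓ + 1)) (hCB : ∀ x ∈ C, ψ x ∈ B) {c : Set ℝ}
    (hc : IsIntCell₁ c) (r : ℝ) {φ : (Fin (ℓ + 1) → ℝ) → Fin (ℓ + 1) → ℝ}
    (hφ : ∀ z, proj z ∈ C → z (Fin.last ℓ) ∈ c → φ z = join (ψ (proj z))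
      (f (ψ (proj z)) + (z (Fin.last ℓ) - r) * (g (ψ (proj z)) - f (ψ (proj z))))) :
    graphOn φ {z | proj z ∈ C ∧ z (Fin.last ℓ) ∈ c} ∈
      Ω (2 * a + 2 * ℓ + 8) (5 * (a + b)) ((ℓ + 1) + (ℓ + 1)) := by
  let N := (ℓ + 1) + (ℓ + 1)
  let ix : Fin ℓ → Fin (N + 2) := fun j => Fin.castAdd 2 (Fin.castAdd (ℓ + 1) j.castSucc)
  let is : Fin (N + 2) := Fin.castAdd 2 (Fin.castAdd (ℓ + 1) (Fin.last ℓ))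
  let iy : Fin ℓ → Fin (N + 2) := fun j => Fin.castAdd 2 (Fin.natAdd (ℓ + 1) j.castSucc)
  let it : Fin (N + 2) := Fin.castAdd 2 (Fin.natAdd (ℓ + 1) (Fin.last ℓ))
  let iu : Fin (N + 2) := Fin.natAdd N 0
  let iv : Fin (N + 2) := Fin.natAdd N 1
  let σ₁ : Fin (ℓ + ℓ) → Fin (N + 2) := fun j => Fin.addCases ix iy j
  let σ : Fin (N + 2) → Fin (ℓ + 1) → Fin (N + 2) := fun k j => Fin.lastCases k iy j
  have hσ : ∀ k, σ k (Fin.last ℓ) = k := fun k => Fin.lastCases_last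
  have hσ' : ∀ k j, σ k (Fin.castSucc j) = iy j := fun k j => Fin.lastCases_castSucc _
  have hσ₁ : ∀ j, σ₁ (Fin.castAdd ℓ j) = ix j := fun j => Fin.addCases_left _
  have hσ₁' : ∀ j, σ₁ (Fin.natAdd ℓ j) = iy j := fun j => Fin.addCases_right _
  let Q : MvPolynomial (Fin (N + 2)) ℝ := MvPolynomial.X it - (MvPolynomial.X iu +
    (MvPolynomial.X is - MvPolynomial.C r) * (MvPolynomial.X iv - MvPolynomial.X iu))
  have hQ : Q.totalDegree ≤ 2 := by
    refine (MvPolynomial.totalDegree_sub _ _).trans (max_le (by simp) ?_)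
    refine (MvPolynomial.totalDegree_add _ _).trans (max_le (by simp) ?_)
    refine (MvPolynomial.totalDegree_mul _ _).trans (Nat.add_le_add (b := 1) (d := 1) ?_ ?_)
    · exact (MvPolynomial.totalDegree_sub _ _).trans (max_le (by simp) (by simp))
    · exact (MvPolynomial.totalDegree_sub _ _).trans (max_le (by simp) (by simp))
  have hN : N + 2 = 2 * ℓ + 4 := by simp only [N]; omega
  have k1 := hΩ.mono (hΩ.preimage_comp hψ σ₁)
    (show _ ≤ 2 * a + 2 * ℓ + 5 by omega) (show _ ≤ a + b by omega)
  have k2 := hΩ.mono (hΩ.preimage_comp hf (σ iu))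
    (show _ ≤ 2 * a + 2 * ℓ + 5 by omega) (show _ ≤ a + b by omega)
  have k3 := hΩ.mono (hΩ.preimage_comp hg (σ iv))
    (show _ ≤ 2 * a + 2 * ℓ + 5 by omega) (show _ ≤ a + b by omega)
  have k4 := hΩ.mono (hΩ.coord_mem_intCell₁ hc is)
    (show _ ≤ 2 * a + 2 * ℓ + 5 by omega) (show _ ≤ a + b by omega)
  have k5 := hΩ.mono (hΩ.zeroSet Q) (show _ ≤ 2 * a + 2 * ℓ + 5 by omega)
    (show _ ≤ a + b by omega)
  have k := hΩ.inter₅ k1 k2 k3 k4 k5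
  have k' := hΩ.mono (hΩ.exists_append (n := N) (k := 2) k)
    (show _ ≤ 2 * a + 2 * ℓ + 8 by omega) le_rfl
  convert k' using 1
  ext w
  obtain ⟨z, z', rfl⟩ : ∃ z z', Fin.append z z' = w := ⟨_, _, Fin.append_castAdd_natAdd⟩
  have hx : ∀ u j, Fin.append (Fin.append z z') u (ix j) = proj z j := fun u j => by
    simp [ix, N, proj]
  have hs : ∀ u, Fin.append (Fin.append z z') u is = z (Fin.last ℓ) := fun u => by
    simp [is, N]
  have hy : ∀ u j, Fin.append (Fin.append z z') u (iy j) = proj z' j := fun u j => by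
    change Fin.append (Fin.append z z') u (Fin.castAdd 2 (Fin.natAdd (ℓ + 1) j.castSucc)) = _
    rw [Fin.append_left, Fin.append_right]
    rfl
  have ht : ∀ u, Fin.append (Fin.append z z') u it = z' (Fin.last ℓ) := fun u => by
    change Fin.append (Fin.append z z') u (Fin.castAdd 2 (Fin.natAdd (ℓ + 1) (Fin.last ℓ))) = _
    rw [Fin.append_left, Fin.append_right]
  have hu : ∀ u : Fin 2 → ℝ, Fin.append (Fin.append z z') u iu = u 0 := fun u => by
    simp [iu, N]
  have hv : ∀ u : Fin 2 → ℝ, Fin.append (Fin.append z z') u iv = u 1 := fun u => by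
    simp [iv, N]
  have e1 : ∀ u : Fin 2 → ℝ, (fun j => Fin.append (Fin.append z z') u
      (σ₁ j)) = Fin.append (proj z) (proj z') := by
    intro u
    ext j
    refine Fin.addCases (fun j => ?_) (fun j => ?_) j
    · rw [hσ₁, hx, Fin.append_left]
    · rw [hσ₁', hy, Fin.append_right]
  have e2 : ∀ u : Fin 2 → ℝ, (fun j => Fin.append (Fin.append z z') u
      ((σ iu) j)) = join (proj z') (u 0) := by
    intro u
    ext j
    refine Fin.lastCases ?_ (fun j => ?_) j
    · rw [hσ, hu, join_last]
    · rw [hσ', hy, join_castSucc]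
  have e3 : ∀ u : Fin 2 → ℝ, (fun j => Fin.append (Fin.append z z') u
      ((σ iv) j)) = join (proj z') (u 1) := by
    intro u
    ext j
    refine Fin.lastCases ?_ (fun j => ?_) j
    · rw [hσ, hv, join_last]
    · rw [hσ', hy, join_castSucc]
  have key : ∀ u : Fin 2 → ℝ, (((fun j => Fin.append (Fin.append z z') u (σ₁ j)) ∈ graphOn ψ C ∧
      (fun j => Fin.append (Fin.append z z') u (σ iu j)) ∈ graphCell B f ∧
      (fun j => Fin.append (Fin.append z z') u (σ iv j)) ∈ graphCell B g ∧
      Fin.append (Fin.append z z') u is ∈ c ∧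
      MvPolynomial.eval (Fin.append (Fin.append z z') u) Q = 0) ↔
      (proj z ∈ C ∧ proj z' = ψ (proj z)) ∧ (proj z' ∈ B ∧ u 0 = f (proj z')) ∧
      (proj z' ∈ B ∧ u 1 = g (proj z')) ∧ z (Fin.last ℓ) ∈ c ∧
      z' (Fin.last ℓ) - (u 0 + (z (Fin.last ℓ) - r) * (u 1 - u 0)) = 0) := by
    intro u
    rw [e1, e2, e3, hs, append_mem_graphOn, join_mem_graphCell, join_mem_graphCell]
    simp only [Q, map_sub, map_add, map_mul, MvPolynomial.eval_X, MvPolynomial.eval_C, ht, hu, hv,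
      hs]
  rw [append_mem_graphOn]
  refine Iff.trans ?_ (exists_congr key).symm
  constructor
  · rintro ⟨⟨h1, h2⟩, rfl⟩
    rw [hφ z h1 h2]
    refine ⟨![f (ψ (proj z)), g (ψ (proj z))], ?_⟩
    simp [h1, h2, hCB]
  · rintro ⟨u, ⟨h1, h2⟩, ⟨-, h3⟩, ⟨-, h4⟩, h5, h6⟩
    refine ⟨⟨h1, h5⟩, ?_⟩
    rw [hφ z h1 h5, ← h2, ← h3, ← h4, eq_comm, join_eq_iff]
    exact ⟨rfl, (sub_eq_zero.1 h6).symm⟩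

end FortTheory

namespace FortTheory

/-! ### Integer cells -/

theorem IsIntCell₁.eq_intCell₁ {c : Set ℝ} (hc : IsIntCell₁ c) {t : ℝ} (ht : t ∈ c) :
    c = intCell₁ t := by
  obtain ⟨k, rfl | rfl⟩ := hc
  · obtain rfl : t = k := ht
    simp [intCell₁]
  · have hf : ⌊t⌋ = k := Int.floor_eq_iff.2 ⟨ht.1.le, ht.2⟩
    rw [intCell₁, hf, if_neg ht.1.ne']

theorem IsIntCell.eq_intCell {ℓ : ℕ} {C : Set (Fin ℓ → ℝ)} (hC : IsIntCell C) {x : Fin ℓ → ℝ}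
    (hx : x ∈ C) : C = intCell x := by
  obtain ⟨c, hc, rfl⟩ := hC
  ext y
  exact forall_congr' fun i => by rw [(hc i).eq_intCell₁ (hx i)]

theorem IsIntCell.nonempty {ℓ : ℕ} {C : Set (Fin ℓ → ℝ)} (hC : IsIntCell C) : C.Nonempty := by
  obtain ⟨c, hc, rfl⟩ := hC
  choose p hp using fun i => (hc i).nonempty
  exact ⟨p, hp⟩

theorem IsIntCell.exists_eq_prod {ℓ : ℕ} {C : Set (Fin (ℓ + 1) → ℝ)} (hC : IsIntCell C) :
    ∃ (C₁ : Set (Fin ℓ → ℝ)) (c : Set ℝ), IsIntCell C₁ ∧ IsIntCell₁ c ∧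
      C = {z | proj z ∈ C₁ ∧ z (Fin.last ℓ) ∈ c} := by
  obtain ⟨c, hc, rfl⟩ := hC
  refine ⟨_, _, ⟨fun i => c i.castSucc, fun i => hc _, rfl⟩, hc (Fin.last ℓ), ?_⟩
  ext z
  exact Fin.forall_fin_succ'

theorem IsIntCell₁.exists_nat {c : Set ℝ} (hc : IsIntCell₁ c) {K : ℕ}
    (h : c ⊆ Set.Ioo 0 ((K : ℝ) + 1)) :
    ∃ i : ℕ, i ≤ K ∧ ((1 ≤ i ∧ c = {(i : ℝ)}) ∨ c = Set.Ioo (i : ℝ) (i + 1)) := by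
  obtain ⟨k, rfl | rfl⟩ := hc
  · have h1 := h rfl
    have h2 : 0 < k := by exact_mod_cast h1.1
    have h3 : k < K + 1 := by exact_mod_cast h1.2
    lift k to ℕ using h2.le
    exact ⟨k, by omega, Or.inl ⟨by omega, by simp⟩⟩
  · have h1 := h (show (k : ℝ) + 1 / 2 ∈ _ by constructor <;> linarith)
    have h2 : (-1 : ℝ) < k := by linarith [h1.1]
    have h3 : (k : ℝ) < K + 1 := by linarith [h1.2]
    have h2' : -1 < k := by exact_mod_cast h2
    have h3' : k < K + 1 := by exact_mod_cast h3
    lift k to ℕ using (by omega)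
    exact ⟨k, by omega, Or.inr (by simp)⟩

theorem IsFort.intCell_mem_cells {ℓ : ℕ} {F : Set (Fin ℓ → ℝ)} (hF : IsFort ℓ F) {x} (hx : x ∈ F) :
    intCell x ∈ cells F :=
  ⟨isIntCell_intCell x, hF.aux.1 x hx⟩

theorem IsFort.nonempty : ∀ {ℓ : ℕ} {F : Set (Fin ℓ → ℝ)}, IsFort ℓ F → F.Nonempty
  | 0, F, hF => (show F = Set.univ from hF) ▸ Set.univ_nonempty
  | ℓ + 1, F, hF => by
    obtain ⟨B, h, hB, hpos, -, rfl⟩ := hF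
    obtain ⟨x, hx⟩ := hB.nonempty
    refine ⟨join x (1 / 2), ?_⟩
    have h1 : (1 : ℝ) ≤ h x := by exact_mod_cast hpos x hx
    simp only [Set.mem_ofPred_eq, proj_join, join_last]
    exact ⟨hx, by norm_num, by linarith⟩

/-! ### Charts of cylindrical decompositions by forts -/

/-- The fort `F'` parametrizes the set `Y` by `ψ`, mapping its integer cells to members of `Ψ`. -/
structure FortChart (Ω : FDFamily) (a b : ℕ) {ℓ : ℕ} (Ψ : Set (Set (Fin ℓ → ℝ)))
    (Y F' : Set (Fin ℓ → ℝ)) (ψ : (Fin ℓ → ℝ) → Fin ℓ → ℝ) : Prop where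
  isFort : IsFort ℓ F'
  image_eq : ψ '' F' = Y
  precellular : PrecellularOn ψ F'
  map_cell : ∀ C' ∈ cells F', ψ '' C' ∈ Ψ
  continuousOn : ∀ C' ∈ cells F', ContinuousOn ψ C'
  natural : ∀ C' ∈ cells F', NaturalOn ψ C'
  format : ∀ C' ∈ cells F', graphOn ψ C' ∈ Ω a b (ℓ + ℓ)

theorem proj_eq_proj {ℓ : ℕ} {x y : Fin (ℓ + 1) → ℝ} (h : ∀ j < Fin.last ℓ, x j = y j) :
    proj x = proj y :=
  funext fun j => h _ (Fin.castSucc_lt_last j)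

theorem PrecellularOn.join {ℓ : ℕ} {ψ : (Fin ℓ → ℝ) → Fin ℓ → ℝ} {F : Set (Fin ℓ → ℝ)}
    (h : PrecellularOn ψ F) {F' : Set (Fin (ℓ + 1) → ℝ)} (hF : ∀ z ∈ F', proj z ∈ F)
    {g : (Fin ℓ → ℝ) → ℝ → ℝ}
    (hg : ∀ y ∈ F', ∀ z ∈ F', proj y = proj z → y (Fin.last ℓ) < z (Fin.last ℓ) →
      g (proj y) (y (Fin.last ℓ)) < g (proj y) (z (Fin.last ℓ))) :
    PrecellularOn (fun z => FortTheory.join (ψ (proj z)) (g (proj z) (z (Fin.last ℓ)))) F' := by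
  refine ⟨fun i => ?_, fun i => ?_⟩
  · refine Fin.lastCases (fun y hy z hz hyz => ?_) (fun i y hy z hz hyz => ?_) i
    · simp only [join_last]
      rw [proj_eq_proj fun j hj => hyz j hj.le, hyz _ le_rfl]
    · simp only [join_castSucc]
      exact h.1 i _ (hF y hy) _ (hF z hz) fun j hj => hyz _ (by simpa using hj)
  · refine Fin.lastCases (fun y hy z hz hyz hlt => ?_) (fun i y hy z hz hyz hlt => ?_) i
    · simp only [join_last]
      have := proj_eq_proj hyz
      rw [← this]
      exact hg y hy z hz this hlt
    · simp only [join_castSucc]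
      exact h.2 i _ (hF y hy) _ (hF z hz) (fun j hj => hyz _ (by simpa using hj)) hlt

theorem NaturalOn.join {ℓ : ℕ} {ψ : (Fin ℓ → ℝ) → Fin ℓ → ℝ} {C : Set (Fin ℓ → ℝ)}
    (h : NaturalOn ψ C) {C' : Set (Fin (ℓ + 1) → ℝ)} (hC : ∀ z ∈ C', proj z ∈ C)
    {φ : (Fin (ℓ + 1) → ℝ) → Fin (ℓ + 1) → ℝ} {u v : (Fin ℓ → ℝ) → ℝ}
    (hφ : ∀ z ∈ C', φ z = FortTheory.join (ψ (proj z)) (u (proj z) * z (Fin.last ℓ) + v (proj z))) :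
    NaturalOn φ C' := by
  intro i
  refine Fin.lastCases (fun x hx => ?_) (fun i x hx => ?_) i
  · refine ⟨u (proj x), v (proj x), fun y hy hyx => ?_⟩
    rw [hφ y hy, proj_eq_proj hyx, join_last]
  · obtain ⟨a, b, hab⟩ := h i _ (hC x hx)
    refine ⟨a, b, fun y hy hyx => ?_⟩
    rw [hφ y hy, join_castSucc]
    exact hab _ (hC y hy) fun j hj => hyx _ (by simpa using hj)

/-- Over an integer cell with image `B` the new fort has height `K B + 1`, and the fibre map
interpolates linearly between the values of `f B i` at the integers `i`. The level `i` goes to the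
graph of `f B i` and `(i, i + 1)` goes to the band above it. -/
theorem FortChart.succ {Ω : FDFamily} (hΩ : IsFDCalculus Ω) {ℓ a b : ℕ} (ha : 3 ≤ a) (hb : 4 ≤ b)
    {Ψ₁ : Set (Set (Fin ℓ → ℝ))} {Y₁ F₁ : Set (Fin ℓ → ℝ)} {ψ₁ : (Fin ℓ → ℝ) → Fin ℓ → ℝ}
    (h₁ : FortChart Ω a b Ψ₁ Y₁ F₁ ψ₁)
    {Ψ : Set (Set (Fin (ℓ + 1) → ℝ))} {Y : Set (Fin (ℓ + 1) → ℝ)} (hΨ : ∀ C ∈ Ψ, C ⊆ Y)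
    {K : Set (Fin ℓ → ℝ) → ℕ} {f : Set (Fin ℓ → ℝ) → ℕ → (Fin ℓ → ℝ) → ℝ}
    (hY : ∀ z ∈ Y, proj z ∈ Y₁ ∧ ∀ B ∈ Ψ₁, proj z ∈ B →
      f B 0 (proj z) < z (Fin.last ℓ) ∧ z (Fin.last ℓ) < f B (K B + 1) (proj z))
    (hmono : ∀ B ∈ Ψ₁, ∀ i j, i < j → j ≤ K B + 1 → ∀ x ∈ B, f B i x < f B j x)
    (hcont : ∀ B ∈ Ψ₁, ∀ i ≤ K B + 1, ContinuousOn (f B i) B)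
    (hgraph : ∀ B ∈ Ψ₁, ∀ i, 1 ≤ i → i ≤ K B → graphCell B (f B i) ∈ Ψ)
    (hband : ∀ B ∈ Ψ₁, ∀ i ≤ K B, bandCell B (f B i) (f B (i + 1)) ∈ Ψ)
    (hformat : ∀ B ∈ Ψ₁, ∀ i ≤ K B + 1, graphCell B (f B i) ∈ Ω a b (ℓ + 1)) :
    ∃ F' ψ, FortChart Ω (2 * a + 2 * ℓ + 8) (5 * (a + b)) Ψ Y F' ψ := by
  -- For `x` in `F₁`, `β x` is the member of `Ψ₁` to which `ψ₁` sends the integer cell of `x`. It is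
  -- constant on integer cells, and therefore so is the height `K (β x) + 1`.
  let β : (Fin ℓ → ℝ) → Set (Fin ℓ → ℝ) := fun x => ψ₁ '' intCell x
  have hβ : ∀ C₁ ∈ cells F₁, ∀ x ∈ C₁, β x = ψ₁ '' C₁ := fun C₁ hC₁ x hx => by
    simp only [β, ← hC₁.1.eq_intCell hx]
  have hβΨ : ∀ x ∈ F₁, β x ∈ Ψ₁ := fun x hx => h₁.map_cell _ (h₁.isFort.intCell_mem_cells hx)
  have hβmem : ∀ x, ψ₁ x ∈ β x := fun x => ⟨x, mem_intCell x, rfl⟩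
  let F' : Set (Fin (ℓ + 1) → ℝ) := {z | proj z ∈ F₁ ∧ 0 < z (Fin.last ℓ) ∧
    z (Fin.last ℓ) < ((K (β (proj z)) + 1 : ℕ) : ℝ)}
  let g : (Fin ℓ → ℝ) → ℝ → ℝ := fun x => interp fun i => f (β x) i (ψ₁ x)
  let ψ : (Fin (ℓ + 1) → ℝ) → Fin (ℓ + 1) → ℝ := fun z =>
    join (ψ₁ (proj z)) (g (proj z) (z (Fin.last ℓ)))
  have hF' : IsFort (ℓ + 1) F' := by
    refine ⟨F₁, fun x => K (β x) + 1, h₁.isFort, fun _ _ => Nat.succ_pos _, ?_, rfl⟩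
    intro C₁ hC₁ x hx y hy
    simp only [hβ C₁ hC₁ x hx, hβ C₁ hC₁ y hy]
  have hpre : PrecellularOn ψ F' := by
    refine h₁.precellular.join (fun z hz => hz.1) ?_
    intro y hy z hz hyz hlt
    refine interp_lt (fun i j hij hj => hmono _ (hβΨ _ hy.1) i j hij hj _ (hβmem _)) hy.2.1.le hlt ?_
    rw [hyz]
    exact hz.2.2.le
  -- on each cell the map is given by a pair of functions
  have hcells : ∀ C' ∈ cells F', ψ '' C' ∈ Ψ ∧ ∃ C₁ ∈ cells F₁, ∃ c, IsIntCell₁ c ∧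
      C' = {z | proj z ∈ C₁ ∧ z (Fin.last ℓ) ∈ c} ∧ ∃ i ≤ K (ψ₁ '' C₁) + 1,
        ∃ j ≤ K (ψ₁ '' C₁) + 1, ∀ z, proj z ∈ C₁ → z (Fin.last ℓ) ∈ c →
          ψ z = join (ψ₁ (proj z)) (f (ψ₁ '' C₁) i (ψ₁ (proj z)) + (z (Fin.last ℓ) - i) *
            (f (ψ₁ '' C₁) j (ψ₁ (proj z)) - f (ψ₁ '' C₁) i (ψ₁ (proj z)))) := by
    rintro C' ⟨hC', hCF⟩
    obtain ⟨C₁, c, hC₁, hc, rfl⟩ := hC'.exists_eq_prod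
    obtain ⟨t₀, ht₀⟩ := hc.nonempty
    obtain ⟨x₀, hx₀⟩ := hC₁.nonempty
    have hC₁F : C₁ ∈ cells F₁ := ⟨hC₁, fun x hx => by
      simpa using (hCF (show join x t₀ ∈ _ by simp [hx, ht₀])).1⟩
    have hBΨ := h₁.map_cell C₁ hC₁F
    obtain ⟨i, hi, hci⟩ := hc.exists_nat (K := K (ψ₁ '' C₁)) (fun t ht => by
      have := (hCF (show join x₀ t ∈ _ by simp [hx₀, ht])).2
      simpa [hβ C₁ hC₁F x₀ hx₀] using this)
    rcases hci with ⟨hi1, rfl⟩ | rfl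
    · have hψ : ∀ z, proj z ∈ C₁ → z (Fin.last ℓ) ∈ ({(i : ℝ)} : Set ℝ) →
          ψ z = join (ψ₁ (proj z)) (f (ψ₁ '' C₁) i (ψ₁ (proj z))) := by
        intro z hz hzi
        simp only [ψ, g, Set.mem_singleton_iff.1 hzi, interp_natCast, hβ C₁ hC₁F _ hz]
      -- With `j = i` the difference vanishes, so integer levels obey the same affine formula as
      -- bands.
      refine ⟨?_, C₁, hC₁F, _, hc, rfl, i, by omega, i, by omega, fun z hz hzi => by
        rw [hψ z hz hzi]; simp⟩
      convert hgraph _ hBΨ i hi1 hi using 1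
      ext w
      constructor
      · rintro ⟨z, ⟨hz, hzi⟩, rfl⟩
        rw [hψ z hz hzi, join_mem_graphCell]
        exact ⟨⟨_, hz, rfl⟩, rfl⟩
      · rintro ⟨⟨x, hx, hxw⟩, hw⟩
        refine ⟨join x i, ⟨by simpa using hx, by simp⟩, ?_⟩
        rw [hψ _ (by simpa using hx) (by simp), proj_join, join_eq_iff, hw, hxw]
        exact ⟨rfl, rfl⟩
    · have hψ : ∀ z, proj z ∈ C₁ → z (Fin.last ℓ) ∈ Set.Ioo (i : ℝ) (i + 1) →
          ψ z = join (ψ₁ (proj z)) (f (ψ₁ '' C₁) i (ψ₁ (proj z)) + (z (Fin.last ℓ) - i) *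
            (f (ψ₁ '' C₁) (i + 1) (ψ₁ (proj z)) - f (ψ₁ '' C₁) i (ψ₁ (proj z)))) := by
        intro z hz hzi
        simp only [ψ, g, interp_of_mem_Ioo _ hzi.1 hzi.2, hβ C₁ hC₁F _ hz]
      refine ⟨?_, C₁, hC₁F, _, hc, rfl, i, by omega, i + 1, by omega, hψ⟩
      convert hband _ hBΨ i hi using 1
      ext w
      constructor
      · rintro ⟨z, ⟨hz, hzi⟩, rfl⟩
        have hlt := hmono _ hBΨ i (i + 1) (by omega) (by omega) (ψ₁ (proj z)) ⟨_, hz, rfl⟩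
        rw [hψ z hz hzi, join_mem_bandCell]
        refine ⟨⟨_, hz, rfl⟩, ?_, ?_⟩ <;> nlinarith [hzi.1, hzi.2]
      · rintro ⟨⟨x, hx, hxw⟩, hw1, hw2⟩
        have hlt := hmono _ hBΨ i (i + 1) (by omega) (by omega) (ψ₁ x) ⟨_, hx, rfl⟩
        rw [← hxw] at hw1 hw2
        have hpos := sub_pos.2 hlt
        let s : ℝ := i + (w (Fin.last ℓ) - f (ψ₁ '' C₁) i (ψ₁ x)) /
          (f (ψ₁ '' C₁) (i + 1) (ψ₁ x) - f (ψ₁ '' C₁) i (ψ₁ x))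
        have hs : s ∈ Set.Ioo (i : ℝ) (i + 1) := by
          refine ⟨lt_add_of_pos_right _ (div_pos (sub_pos.2 hw1) hpos), ?_⟩
          refine add_lt_add_right ((div_lt_one hpos).2 ?_) _
          linarith
        refine ⟨join x s, ⟨by simpa using hx, by simpa using hs⟩, ?_⟩
        rw [hψ _ (by simpa using hx) (by simpa using hs), proj_join, join_eq_iff, join_last]
        refine ⟨hxw, ?_⟩
        simp only [s, add_sub_cancel_left]
        rw [div_mul_cancel₀ _ hpos.ne']
        ring
  refine ⟨F', ψ, hF', ?_, hpre, fun C' hC' => (hcells C' hC').1, fun C' hC' => ?_,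
    fun C' hC' => ?_, fun C' hC' => ?_⟩
  · apply Set.Subset.antisymm
    · rintro _ ⟨z, hz, rfl⟩
      exact hΨ _ (hcells _ (hF'.intCell_mem_cells hz)).1 ⟨z, mem_intCell z, rfl⟩
    · intro w hw
      obtain ⟨hw1, hw2⟩ := hY w hw
      obtain ⟨x, hx, hxw⟩ := h₁.image_eq.symm ▸ hw1
      have hB := hβΨ x hx
      have hm := hβmem x
      obtain ⟨h3, h4⟩ := hw2 _ hB (hxw ▸ hm)
      rw [← hxw] at h3 h4
      obtain ⟨i, hi, hiw⟩ := exists_mem_stack (g := fun i => f (β x) i (ψ₁ x)) h3 h4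
      have hiK : (i : ℝ) ≤ K (β x) := by exact_mod_cast hi
      rcases hiw with ⟨hi1, hiw⟩ | ⟨hiw1, hiw2⟩
      · refine ⟨join x i, ⟨by simpa using hx, ?_, ?_⟩, ?_⟩
        · rw [join_last]
          exact_mod_cast hi1
        · simp only [join_last, proj_join]
          push_cast
          linarith
        · simp only [ψ, g, proj_join, join_last, interp_natCast]
          exact join_eq_iff.2 ⟨hxw, hiw.symm⟩
      · have hpos := sub_pos.2 (hiw1.trans hiw2)
        let s : ℝ := (w (Fin.last ℓ) - f (β x) i (ψ₁ x)) / (f (β x) (i + 1) (ψ₁ x) - f (β x) i (ψ₁ x))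
        have hs0 : 0 < s := div_pos (sub_pos.2 hiw1) hpos
        have hs1 : s < 1 := (div_lt_one hpos).2 (by linarith)
        have hi0 : (0 : ℝ) ≤ i := Nat.cast_nonneg i
        refine ⟨join x (i + s), ⟨by simpa using hx, ?_, ?_⟩, ?_⟩
        · rw [join_last]
          linarith
        · simp only [join_last, proj_join]
          push_cast
          linarith
        · simp only [ψ, g, proj_join, join_last]
          rw [interp_of_mem_Ioo (i := i) _ (by linarith) (by linarith)]
          refine join_eq_iff.2 ⟨hxw, ?_⟩
          simp only [s, add_sub_cancel_left]
          rw [div_mul_cancel₀ _ hpos.ne']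
          ring
  · obtain ⟨-, C₁, hC₁, c, hc, rfl, i, hi, j, hj, hψ⟩ := hcells C' hC'
    have hm : Set.MapsTo proj {z : Fin (ℓ + 1) → ℝ | proj z ∈ C₁ ∧ z (Fin.last ℓ) ∈ c} C₁ :=
      fun z hz => hz.1
    have h2 := (h₁.continuousOn C₁ hC₁).comp continuous_proj.continuousOn hm
    have hm' : Set.MapsTo (ψ₁ ∘ proj) {z : Fin (ℓ + 1) → ℝ | proj z ∈ C₁ ∧ z (Fin.last ℓ) ∈ c}
      (ψ₁ '' C₁) := fun z hz => ⟨_, hz.1, rfl⟩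
    have h3 := (hcont _ (h₁.map_cell C₁ hC₁) i hi).comp h2 hm'
    have h4 := (hcont _ (h₁.map_cell C₁ hC₁) j hj).comp h2 hm'
    have h5 : ContinuousOn (fun z : Fin (ℓ + 1) → ℝ => z (Fin.last ℓ) - i)
        {z : Fin (ℓ + 1) → ℝ | proj z ∈ C₁ ∧ z (Fin.last ℓ) ∈ c} := by fun_prop
    exact (continuousOn_join h2 (h3.add (h5.mul (h4.sub h3)))).congr fun z hz => hψ z hz.1 hz.2
  · obtain ⟨-, C₁, hC₁, c, hc, rfl, i, hi, j, hj, hψ⟩ := hcells C' hC'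
    refine (h₁.natural C₁ hC₁).join (fun z hz => hz.1)
      (u := fun x => f (ψ₁ '' C₁) j (ψ₁ x) - f (ψ₁ '' C₁) i (ψ₁ x))
      (v := fun x => f (ψ₁ '' C₁) i (ψ₁ x) - i * (f (ψ₁ '' C₁) j (ψ₁ x) - f (ψ₁ '' C₁) i (ψ₁ x)))
      fun z hz => ?_
    rw [hψ z hz.1 hz.2]
    congr 1
    ring
  · obtain ⟨-, C₁, hC₁, c, hc, rfl, i, hi, j, hj, hψ⟩ := hcells C' hC'
    have hB := h₁.map_cell C₁ hC₁
    exact hΩ.graphOn_join ha hb (h₁.format C₁ hC₁) (hformat _ hB i hi) (hformat _ hB j hj)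
      (fun x hx => ⟨x, hx, rfl⟩) hc i hψ

end FortTheory

/-! ### Charts of cylindrical decompositions, with bounds on format and degree. -/

namespace FortTheory

/-- The format of the charts of cylindrical decompositions into cells of format `c`. -/
def fortFormat : ℕ → ℕ → ℕ
  | 0, _ => 0
  | ℓ + 1, c => 2 * (fortFormat ℓ (c + 1) + (2 * c + ℓ + 8)) + 2 * ℓ + 8

/-- The degree of the charts of cylindrical decompositions into cells of format `c`, as a polynomial
in the degree of the cells. -/
noncomputable def fortDegree : ℕ → ℕ → Polynomial ℕ
  | 0, _ => 0
  | ℓ + 1, c => 5 * (Polynomial.C (fortFormat ℓ (c + 1) + (2 * c + ℓ + 8)) +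
      (fortDegree ℓ (c + 1) + 2 * Polynomial.X + Polynomial.C (2 * c + 6)))

/-- Needed for the bottom and the top of a stack: they are constant functions whose graphs are not
cells of the decomposition, so their format has to come from that of the base. -/
theorem IsFDCalculus.graphCell_const {Ω : FDFamily} (hΩ : IsFDCalculus Ω) {ℓ c P : ℕ}
    {B : Set (Fin ℓ → ℝ)} (hB : B ∈ Ω (c + 1) P ℓ) (hℓ : ℓ ≤ c) (t : ℝ) :
    graphCell B (fun _ => t) ∈ Ω (2 * c + ℓ + 5) (2 * (P + c + 1)) (ℓ + 1) := by
  have h1 := hΩ.preimage_comp hB (Fin.castSucc : Fin ℓ → Fin (ℓ + 1))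
  have h2 := hΩ.zeroSet (MvPolynomial.X (Fin.last ℓ) - MvPolynomial.C t :
    MvPolynomial (Fin (ℓ + 1)) ℝ)
  have h3 : (MvPolynomial.X (Fin.last ℓ) - MvPolynomial.C t :
      MvPolynomial (Fin (ℓ + 1)) ℝ).totalDegree ≤ 1 :=
    (MvPolynomial.totalDegree_sub _ _).trans (max_le (by simp) (by simp))
  have h := hΩ.inter (hΩ.mono h1 (show _ ≤ 2 * c + ℓ + 4 by omega) (show _ ≤ P + c + 1 by omega))
    (hΩ.mono h2 (show _ ≤ 2 * c + ℓ + 4 by omega) (show _ ≤ P + c + 1 by omega))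
  convert h using 1
  ext z
  simp only [map_sub, MvPolynomial.eval_X, MvPolynomial.eval_C, sub_eq_zero]
  rfl

variable {L : FirstOrder.Language.{u, v}} [L.Structure ℝ] [hL : Fact (IsOMinimalExpansion L)]

theorem cells_zero : cells (Set.univ : Set (Fin 0 → ℝ)) = {Set.univ} := by
  ext C
  constructor
  · rintro ⟨hC, -⟩
    obtain ⟨x, hx⟩ := hC.nonempty
    exact Set.eq_univ_of_forall fun y => Subsingleton.elim x y ▸ hx
  · rintro rfl
    exact ⟨⟨Fin.elim0, fun i => i.elim0, by ext; simp⟩, le_rfl⟩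

/-- A cylindrical decomposition of a rescaled fort that refines its integer cells is parametrized by
another fort. -/
theorem exists_fortChart {Ω : FDFamily} (hΩ : IsFDCalculus Ω) {r : ℝ} (hr : 0 < r) :
    ∀ {ℓ : ℕ} {F : Set (Fin ℓ → ℝ)}, IsFort ℓ F → ∀ {Ψ : Set (Set (Fin ℓ → ℝ))} {c P : ℕ},
      IsCylDecomp L ℓ Ψ {x | r • x ∈ F} → (∀ C ∈ Ψ, C ∈ Ω c P ℓ) →
      (∀ C ∈ Ψ, ∃ D ∈ cells F, ∀ x ∈ C, r • x ∈ D) →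
      ∃ F' ψ, FortChart Ω (fortFormat ℓ c) ((fortDegree ℓ c).eval P) Ψ {x | r • x ∈ F} F' ψ
  | 0, F, hF, Ψ, c, P, hΨ, _, _ => by
    obtain rfl : F = Set.univ := hF
    refine ⟨Set.univ, id, rfl, by simp, ⟨fun i => i.elim0, fun i => i.elim0⟩, ?_,
      fun _ _ => continuousOn_id, fun _ _ i => i.elim0, ?_⟩
    · rw [cells_zero]
      rintro _ rfl
      obtain ⟨C, hC, -⟩ := hΨ.isCellDecomp.exists_mem
        (show (Fin.elim0 : Fin 0 → ℝ) ∈ {x : Fin 0 → ℝ | r • x ∈ (Set.univ : Set (Fin 0 → ℝ))} by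
          simp)
      rw [Set.image_id]
      have h : C = Set.univ := hΨ.isCellDecomp.2.1 C hC
      exact h ▸ hC
    · rw [cells_zero]
      rintro _ rfl
      have h := hΩ.zeroSet (0 : MvPolynomial (Fin 0) ℝ)
      have h' : graphOn (id : (Fin 0 → ℝ) → Fin 0 → ℝ) Set.univ = {x | MvPolynomial.eval x 0 = 0} := by
        ext z
        simp only [map_zero, graphOn, Set.mem_ofPred_eq, iff_true]
        exact ⟨fun i => i.elim0, trivial, funext fun i => (Nat.not_lt_zero _ i.2).elim⟩
      rw [h']
      simpa [fortFormat, fortDegree] using h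
  | ℓ + 1, F, hF, Ψ, c, P, hΨ, hΨΩ, hcells => by
    obtain ⟨B₀, h, hB₀, hpos, hconst, rfl⟩ := hF
    obtain ⟨hd, hp⟩ := hΨ
    have hproj : proj '' {x : Fin (ℓ + 1) → ℝ | r • x ∈ {x | proj x ∈ B₀ ∧ 0 < x (Fin.last ℓ) ∧
        x (Fin.last ℓ) < h (proj x)}} = {x | r • x ∈ B₀} := by
      ext x
      constructor
      · rintro ⟨z, hz, rfl⟩
        exact hz.1
      · intro hx
        have h0 : (0 : ℝ) < h (r • x) := by exact_mod_cast hpos _ hx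
        have hj : proj (r • join x (h (r • x) / 2 / r)) = r • x := by
          rw [show proj (r • join x (h (r • x) / 2 / r)) = r • proj (join x (h (r • x) / 2 / r)) from
            rfl, proj_join]
        refine ⟨join x (h (r • x) / 2 / r), ⟨by rw [hj]; exact hx, ?_, ?_⟩, proj_join _ _⟩
        · simp only [Pi.smul_apply, join_last, smul_eq_mul]
          positivity
        · rw [hj]
          simp only [Pi.smul_apply, join_last, smul_eq_mul]
          rw [mul_div_cancel₀ _ hr.ne']
          linarith
    rw [hproj] at hp
    set Ψ₁ : Set (Set (Fin ℓ → ℝ)) := (fun C => proj '' C) '' Ψ with hΨ₁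
    have hd₁ := hp.isCellDecomp
    have hΨ₁Ω : ∀ B ∈ Ψ₁, B ∈ Ω (c + 1) P ℓ := by
      rintro _ ⟨C, hC, rfl⟩
      exact hΩ.image_proj (hΨΩ C hC)
    have hcells₁ : ∀ B ∈ Ψ₁, ∃ D ∈ cells B₀, ∀ x ∈ B, r • x ∈ D := by
      rintro _ ⟨C, hC, rfl⟩
      obtain ⟨D, ⟨hD, hDF⟩, hCD⟩ := hcells C hC
      obtain ⟨D₁, e, hD₁, he, rfl⟩ := hD.exists_eq_prod
      obtain ⟨t, ht⟩ := he.nonempty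
      refine ⟨D₁, ⟨hD₁, fun x hx => ?_⟩, ?_⟩
      · simpa using (hDF (show join x t ∈ _ by simp [hx, ht])).1
      · rintro _ ⟨z, hz, rfl⟩
        exact (hCD z hz).1
    -- Projecting the cells raises their format by one, whence the `c + 1` in the recursions for
    -- `fortFormat` and `fortDegree`.
    obtain ⟨F₁, ψ₁, h₁⟩ := exists_fortChart hΩ hr hB₀ hp hΨ₁Ω hcells₁
    have hstack : ∀ B ∈ Ψ₁, ∃ (k : ℕ) (f : ℕ → (Fin ℓ → ℝ) → ℝ),
        (∀ i, 1 ≤ i → i ≤ k → graphCell B (f i) ∈ Ψ) ∧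
        (∀ i ≤ k, bandCell B (f i) (f (i + 1)) ∈ Ψ) ∧
        (∀ i j, i < j → j ≤ k + 1 → ∀ x ∈ B, f i x < f j x) ∧
        (∀ i ≤ k + 1, ContinuousOn (f i) B) ∧
        (∃ t, f 0 = fun _ => t) ∧ (∃ t, f (k + 1) = fun _ => t) ∧
        ∀ z : Fin (ℓ + 1) → ℝ, r • z ∈ {x : Fin (ℓ + 1) → ℝ | proj x ∈ B₀ ∧ 0 < x (Fin.last ℓ) ∧
          x (Fin.last ℓ) < h (proj x)} → proj z ∈ B →
          f 0 (proj z) < z (Fin.last ℓ) ∧ z (Fin.last ℓ) < f (k + 1) (proj z) := by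
      intro B hB
      have hBc := hd₁.2.1 B hB
      obtain ⟨x₀, hx₀⟩ := hBc.nonempty
      have hBB₀ : ∀ x ∈ B, r • x ∈ B₀ := fun x hx => hd₁.cell_subset hB hx
      -- The rescaled cell `B` lies in a single integer cell of the base fort, so the height above
      -- it is constant and the stack over `B` has a constant top.
      have hh : ∀ x ∈ B, h (r • x) = h (r • x₀) := by
        obtain ⟨D, hD, hBD⟩ := hcells₁ B hB
        exact fun x hx => hconst D hD _ (hBD x hx) _ (hBD x₀ hx₀)
      have hH : (0 : ℝ) < h (r • x₀) / r :=
        div_pos (by exact_mod_cast hpos _ (hBB₀ x₀ hx₀)) hr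
      have hiff : ∀ z : Fin (ℓ + 1) → ℝ, proj z ∈ B → (r • z ∈ {x : Fin (ℓ + 1) → ℝ | proj x ∈ B₀ ∧
          0 < x (Fin.last ℓ) ∧ x (Fin.last ℓ) < h (proj x)} ↔
          0 < z (Fin.last ℓ) ∧ z (Fin.last ℓ) < h (r • x₀) / r) := by
        intro z hz
        have e1 : proj (r • z) = r • proj z := rfl
        simp only [Set.mem_ofPred_eq, e1, hh _ hz, hBB₀ _ hz, true_and, Pi.smul_apply, smul_eq_mul,
          mul_pos_iff_of_pos_left hr, lt_div_iff₀' hr]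
      obtain ⟨k, f, hf0, hfk, hmono, hcont, hgraph, hband⟩ := exists_stack hBc.isPreconnected
        ⟨x₀, hx₀⟩ (S := {C ∈ Ψ | proj '' C = B}) (hd.1.subset fun C hC => hC.1)
        (hd.2.2.1.subset fun C hC => hC.1) hH (by
          rintro C ⟨hC, hCB⟩
          obtain ⟨B', hB', ⟨f, hf, rfl⟩ | ⟨f, g, hf, hg, hfg, rfl⟩⟩ := isCell_succ.1 (hd.2.1 C hC)
          · rw [proj_image_graphCell] at hCB
            subst hCB
            exact Or.inl ⟨f, hf.1, rfl⟩
          · rw [proj_image_bandCell hfg] at hCB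
            subst hCB
            exact Or.inr ⟨f, g, hf.1, hg.1, hfg, rfl⟩) (by
          ext z
          constructor
          · rintro ⟨C, ⟨hC, hCB⟩, hz⟩
            have hzB : proj z ∈ B := hCB ▸ ⟨z, hz, rfl⟩
            exact ⟨hzB, (hiff z hzB).1 (hd.cell_subset hC hz)⟩
          · rintro ⟨hzB, hz⟩
            obtain ⟨C, hC, hzC⟩ := hd.exists_mem ((hiff z hzB).2 hz)
            exact ⟨C, ⟨hC, hd₁.eq_of_mem ⟨C, hC, rfl⟩ hB ⟨z, hzC, rfl⟩ hzB⟩, hzC⟩)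
      refine ⟨k, f, fun i h1 h2 => (hgraph i h1 h2).1, fun i hi => (hband i hi).1, hmono, hcont,
        ⟨_, hf0⟩, ⟨_, hfk⟩, fun z hz hzB => ?_⟩
      rw [hf0, hfk]
      exact (hiff z hzB).1 hz
    choose! K f hgraph hband hmono hcont hf0 hfK hY using hstack
    -- Some cell is needed to deduce `ℓ + 1 ≤ c` from `le_format`.
    rcases Set.eq_empty_or_nonempty Ψ₁ with hemp | ⟨B', hB'⟩
    · exfalso
      obtain ⟨x, hx⟩ := hB₀.nonempty
      have hx' : r⁻¹ • x ∈ {x | r • x ∈ B₀} := by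
        simpa [smul_smul, mul_inv_cancel₀ hr.ne'] using hx
      obtain ⟨B, hB, -⟩ := hd₁.exists_mem hx'
      exact (hemp ▸ hB : B ∈ (∅ : Set _))
    obtain ⟨C', hC', -⟩ := hB'
    have hℓc := hΩ.le_format (hΨΩ C' hC')
    -- Sums are used as upper bounds for maxima: `a` and `b` dominate the data of the base chart, of
    -- the constant graphs and of the cells, and satisfy `3 ≤ a` and `4 ≤ b`.
    let a := fortFormat ℓ (c + 1) + (2 * c + ℓ + 8)
    let b := (fortDegree ℓ (c + 1)).eval P + 2 * P + (2 * c + 6)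
    have h₁' : FortChart Ω a b Ψ₁ {x | r • x ∈ B₀} F₁ ψ₁ := { h₁ with
      format := fun C' hC' => hΩ.mono (h₁.format C' hC') (by simp only [a]; omega)
        (by simp only [b]; omega) }
    have key := h₁'.succ hΩ (by simp only [a]; omega) (by simp only [b]; omega)
      (Ψ := Ψ) (K := K) (f := f)
      (fun C hC => hd.cell_subset hC) (fun z hz => ⟨hz.1, fun B hB hzB => hY B hB z hz hzB⟩)
      hmono hcont hgraph hband (fun B hB i hi => ?_)
    · simpa [fortFormat, fortDegree, a, b] using key
    · have hconst : ∀ t, graphCell B (fun _ => t) ∈ Ω a b (ℓ + 1) := fun t =>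
        hΩ.mono (hΩ.graphCell_const (hΨ₁Ω B hB) (by omega) t) (by simp only [a]; omega)
          (by simp only [b]; omega)
      rcases Nat.eq_zero_or_pos i with rfl | hi0
      · obtain ⟨t, ht⟩ := hf0 B hB
        rw [ht]
        exact hconst t
      rcases hi.eq_or_lt with rfl | hi
      · obtain ⟨t, ht⟩ := hfK B hB
        rw [ht]
        exact hconst t
      · exact hΩ.mono (hΨΩ _ (hgraph B hB i hi0 (by omega))) (by simp only [a]; omega)
          (by simp only [b]; omega)

end FortTheory

/-! ### Rescaling, and the two assertions of the theorem. -/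

namespace FortTheory

variable {L : FirstOrder.Language.{u, v}} [L.Structure ℝ]

/-- Projection commutes with unions, so no condition on the subfamily is needed. This permits
discarding the cells of the cube outside the rescaled fort. -/
theorem IsCylDecomp.subset : ∀ {ℓ : ℕ} {Φ Φ' : Set (Set (Fin ℓ → ℝ))} {X : Set (Fin ℓ → ℝ)},
    IsCylDecomp L ℓ Φ X → Φ' ⊆ Φ → IsCylDecomp L ℓ Φ' (⋃₀ Φ')
  | 0, _, _, _, h, hs => ⟨h.1.subset hs, fun C hC => h.2.1 C (hs hC), h.2.2.1.subset hs, rfl⟩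
  | ℓ + 1, _, Φ', _, h, hs => by
    refine ⟨⟨h.1.1.subset hs, fun C hC => h.1.2.1 C (hs hC), h.1.2.2.1.subset hs, rfl⟩, ?_⟩
    rw [Set.sUnion_eq_biUnion, Set.image_iUnion₂, ← Set.sUnion_image]
    exact h.2.subset (Set.image_mono hs)

/-- The map is triangular and strictly increasing in each new variable, so the coordinates are
recovered one after another. Injectivity is what bounds the number of cells of the new fort. -/
theorem PrecellularOn.injOn {ℓ : ℕ} {φ : (Fin ℓ → ℝ) → Fin ℓ → ℝ} {F : Set (Fin ℓ → ℝ)}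
    (h : PrecellularOn φ F) : Set.InjOn φ F := by
  intro x hx y hy hxy
  have : ∀ k : ℕ, ∀ i : Fin ℓ, (i : ℕ) < k → x i = y i := by
    intro k
    induction k with
    | zero => intro i hi; omega
    | succ k ih =>
      intro i hi
      have hj : ∀ j < i, x j = y j := fun j hj => ih j (by have : (j : ℕ) < i := hj; omega)
      rcases lt_trichotomy (x i) (y i) with h' | h' | h'
      · exact absurd (congrFun hxy i) (h.2 i x hx y hy hj h').ne
      · exact h'
      · exact absurd (congrFun hxy i).symm (h.2 i y hy x hx (fun j hj' => (hj j hj').symm) h').ne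
  exact funext fun i => this (i + 1) i (Nat.lt_succ_self _)

theorem IsFDCalculus.graphOn_smul {Ω : FDFamily} (hΩ : IsFDCalculus Ω) {ℓ a b : ℕ}
    {ψ : (Fin ℓ → ℝ) → Fin ℓ → ℝ} {C : Set (Fin ℓ → ℝ)} (h : graphOn ψ C ∈ Ω a b (ℓ + ℓ)) {r : ℝ}
    (hr : r ≠ 0) : graphOn (fun x => r • ψ x) C ∈ Ω (2 * a + (ℓ + ℓ) + 1) (b + a) (ℓ + ℓ) := by
  convert hΩ.preimage_smul h (Fin.append (fun _ => 1) fun _ => r⁻¹) using 1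
  ext w
  obtain ⟨x, y, rfl⟩ : ∃ x y, Fin.append x y = w := ⟨_, _, Fin.append_castAdd_natAdd⟩
  have e : (fun j => (Fin.append (fun _ => 1) fun _ => r⁻¹ : Fin (ℓ + ℓ) → ℝ) j *
      Fin.append x y j) = Fin.append x (r⁻¹ • y) := by
    ext j
    refine Fin.addCases (fun j => ?_) (fun j => ?_) j
    · simp
    · rw [Fin.append_right, Fin.append_right, Fin.append_right, Pi.smul_apply, smul_eq_mul]
  rw [Set.mem_ofPred_eq, e, append_mem_graphOn, append_mem_graphOn, inv_smul_eq_iff₀ hr]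

variable [hL : Fact (IsOMinimalExpansion L)]

/-- The cells of `Φ` inside the rescaled fort are charted by a fort, and the chart is multiplied by
`r`. All conditions on images hold because integer cells go onto cells of `Φ`. -/
theorem exists_naturalMorphism {Ω : FDFamily} (hΩ : IsFDCalculus Ω)
    (hdef : ∀ {a b ℓ : ℕ} {X : Set (Fin ℓ → ℝ)}, X ∈ Ω a b ℓ → Def L X) {ℓ : ℕ}
    {F : Set (Fin ℓ → ℝ)} (hF : IsFort ℓ F) {r : ℝ} (hr : 0 < r)
    (hFr : ∀ x ∈ F, ∀ i, 0 < x i ∧ x i < r) {Φ : Set (Set (Fin ℓ → ℝ))}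
    (hΦ : IsCylDecomp L ℓ Φ (openCube ℓ)) {c P : ℕ} (hΦΩ : ∀ C ∈ Φ, C ∈ Ω c P ℓ)
    (hcell : ∀ C ∈ Φ, ∀ D ∈ cells F, Compatible C {x | r • x ∈ D}) {J : Type w}
    {X : Set (Fin ℓ → ℝ) → J → Set (Fin ℓ → ℝ)}
    (hX : ∀ C ∈ Φ, ∀ D ∈ cells F, ∀ j, Compatible C {x | r • x ∈ X D j}) :
    ∃ (F' : Set (Fin ℓ → ℝ)) (φ : (Fin ℓ → ℝ) → (Fin ℓ → ℝ)),
      IsFort ℓ F' ∧ IsNaturalMorphism L F' F φ ∧ MorphismCompatible F' F φ X ∧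
      (cells F').ncard ≤ Φ.ncard ∧ ∀ C' ∈ cells F', graphOn φ C' ∈
        Ω (2 * fortFormat ℓ c + (ℓ + ℓ) + 1) ((fortDegree ℓ c).eval P + fortFormat ℓ c) (ℓ + ℓ) := by
  have hd := hΦ.isCellDecomp
  -- Compatibility with the integer cells shows that a cell of `Φ` meeting the rescaled fort lies in
  -- one rescaled integer cell, so `Ψ` fills the rescaled fort exactly.
  let Ψ : Set (Set (Fin ℓ → ℝ)) := {C | C ∈ Φ ∧ ∀ x ∈ C, r • x ∈ F}
  have hsub : ∀ C ∈ Φ, ∀ x ∈ C, r • x ∈ F → ∃ D ∈ cells F, ∀ y ∈ C, r • y ∈ D := by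
    intro C hC x hx hxF
    have hD := hF.intCell_mem_cells hxF
    exact ⟨_, hD, fun y hy => (hcell C hC _ hD).subset_of_mem hx (mem_intCell (r • x)) hy⟩
  have hU : ⋃₀ Ψ = {x | r • x ∈ F} := by
    ext x
    constructor
    · rintro ⟨C, hC, hx⟩
      exact hC.2 x hx
    · intro hx
      have hxc : x ∈ openCube ℓ := fun i => by
        have := hFr _ hx i
        simp only [Pi.smul_apply, smul_eq_mul] at this
        exact ⟨(mul_pos_iff_of_pos_left hr).1 this.1, by nlinarith⟩
      obtain ⟨C, hC, hxC⟩ := hd.exists_mem hxc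
      obtain ⟨D, hD, hCD⟩ := hsub C hC x hxC hx
      exact ⟨C, ⟨hC, fun y hy => hD.2 (hCD y hy)⟩, hxC⟩
  have hΨ : IsCylDecomp L ℓ Ψ {x | r • x ∈ F} := hU ▸ hΦ.subset fun C hC => hC.1
  have hΨint : ∀ C ∈ Ψ, ∃ D ∈ cells F, ∀ x ∈ C, r • x ∈ D := by
    intro C hC
    obtain ⟨x, hx⟩ := (hd.2.1 C hC.1).nonempty
    exact hsub C hC.1 x hx (hC.2 x hx)
  obtain ⟨F', ψ, h⟩ := exists_fortChart hΩ hr hF hΨ (fun C hC => hΦΩ C hC.1) hΨint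
  have hgraph : ∀ C' ∈ cells F', graphOn (fun x => r • ψ x) C' ∈ Ω _ _ (ℓ + ℓ) :=
    fun C' hC' => hΩ.graphOn_smul (h.format C' hC') hr.ne'
  refine ⟨F', fun x => r • ψ x, h.isFort, ⟨⟨?_, ?_, ?_, ?_, ?_⟩, ?_⟩, ?_, ?_, hgraph⟩
  -- The graph over the fort is the finite union of the graphs over its integer cells, which are
  -- definable through `hdef`.
  · have := h.isFort.finite_cells.to_subtype
    have hU' : graphOn (fun x => r • ψ x) F' =
        {w | ∃ C' : cells F', w ∈ graphOn (fun x => r • ψ x) C'.1} := by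
      ext w
      constructor
      · rintro ⟨x, hx, rfl⟩
        exact ⟨⟨_, h.isFort.intCell_mem_cells hx⟩, x, mem_intCell x, rfl⟩
      · rintro ⟨C', x, hx, rfl⟩
        exact ⟨x, C'.2.2 hx, rfl⟩
    rw [hU']
    exact Dfn.exists_finite (κ := cells F') (P := fun C' w => w ∈ graphOn (fun x => r • ψ x) C'.1)
      fun C' => hdef (hgraph C'.1 C'.2)
  · ext y
    constructor
    · rintro ⟨x, hx, rfl⟩
      exact h.image_eq.subset ⟨x, hx, rfl⟩
    · intro hy
      have : r⁻¹ • y ∈ {x | r • x ∈ F} := by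
        simpa [smul_smul, mul_inv_cancel₀ hr.ne'] using hy
      obtain ⟨x, hx, hxy⟩ := h.image_eq.symm.subset this
      exact ⟨x, hx, by simp [hxy, smul_smul, mul_inv_cancel₀ hr.ne']⟩
  · refine ⟨fun i x hx y hy hxy => ?_, fun i x hx y hy hxy hlt => ?_⟩
    · simp only [Pi.smul_apply, h.precellular.1 i x hx y hy hxy]
    · exact mul_lt_mul_of_pos_left (h.precellular.2 i x hx y hy hxy hlt) hr
  · intro C' hC'
    obtain ⟨D, hD, hCD⟩ := hΨint _ (h.map_cell C' hC')
    refine ⟨D, hD, ?_⟩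
    rintro _ ⟨x, hx, rfl⟩
    exact hCD _ ⟨x, hx, rfl⟩
  · exact fun C' hC' => (h.continuousOn C' hC').const_smul r
  · intro C' hC' i x hx
    obtain ⟨a, b, hab⟩ := h.natural C' hC' i x hx
    refine ⟨r * a, r * b, fun y hy hyx => ?_⟩
    simp only [Pi.smul_apply, smul_eq_mul, hab y hy hyx]
    ring
  · intro C' hC' D hD j
    rcases hX _ (h.map_cell C' hC').1 D hD j with h' | h'
    · refine Or.inl ?_
      rintro _ ⟨x, hx, rfl⟩
      exact h' ⟨x, hx, rfl⟩
    · refine Or.inr (Set.eq_empty_of_forall_notMem ?_)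
      rintro _ ⟨⟨x, hx, rfl⟩, hxX⟩
      exact h'.subset ⟨⟨x, hx, rfl⟩, hxX⟩
  -- The chart is injective on the fort, so distinct integer cells have distinct images in `Φ`.
  · refine Set.ncard_le_ncard_of_injOn (fun C' => ψ '' C') (fun C' hC' => (h.map_cell C' hC').1) ?_
      hd.1
    intro C₁ hC₁ C₂ hC₂ he
    exact (h.precellular.injOn.image_eq_image_iff hC₁.2 hC₂.2).1 he

/-- The cells of a fort together with given subsets of them, indexed by a finite type. -/
def cellFamily {ℓ : ℕ} {J : Type w} (F : Set (Fin ℓ → ℝ))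
    (X : Set (Fin ℓ → ℝ) → J → Set (Fin ℓ → ℝ)) (p : cells F × Option J) : Set (Fin ℓ → ℝ) :=
  p.2.elim p.1.1 (X p.1.1)

theorem cellFamily_subset {ℓ : ℕ} {J : Type w} {F : Set (Fin ℓ → ℝ)}
    {X : Set (Fin ℓ → ℝ) → J → Set (Fin ℓ → ℝ)} (hX : ∀ C ∈ cells F, ∀ j, X C j ⊆ C)
    (p : cells F × Option J) : cellFamily F X p ⊆ F := by
  obtain ⟨⟨C, hC⟩, _ | j⟩ := p
  · exact hC.2
  · exact (hX C hC j).trans hC.2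

theorem IsFort.exists_pos_bound {ℓ : ℕ} {F : Set (Fin ℓ → ℝ)} (hF : IsFort ℓ F) :
    ∃ r : ℝ, 0 < r ∧ ∀ x ∈ F, ∀ i, 0 < x i ∧ x i < r := by
  obtain ⟨n, hn⟩ := hF.aux.2
  exact ⟨n + 1, by positivity, fun x hx i => ⟨(hn x hx i).1, (hn x hx i).2.trans (by linarith)⟩⟩

theorem exists_morphism (L : FirstOrder.Language.{u, v}) [L.Structure ℝ]
    [hL : Fact (IsOMinimalExpansion L)] {ℓ : ℕ} {F : Set (Fin ℓ → ℝ)} (hF : IsFort ℓ F)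
    {J : Type w} [Finite J] {X : Set (Fin ℓ → ℝ) → J → Set (Fin ℓ → ℝ)}
    (hX : ∀ C ∈ cells F, ∀ j, X C j ⊆ C ∧ Def L (X C j)) :
    ∃ (F' : Set (Fin ℓ → ℝ)) (φ : (Fin ℓ → ℝ) → (Fin ℓ → ℝ)),
      IsFort ℓ F' ∧ IsNaturalMorphism L F' F φ ∧ MorphismCompatible F' F φ X := by
  obtain ⟨r, hr, hFr⟩ := hF.exists_pos_bound
  have := hF.finite_cells.to_subtype
  let e := Finite.equivFin (cells F × Option J)
  have hΩ := isFDCalculus_trivialFD (L := L)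
  have hA : ∀ k, Dfn L {x | r • x ∈ cellFamily F X (e.symm k)} := by
    intro k
    have hm : DefMap L (fun x : Fin ℓ → ℝ => r • x) := by
      have : DefMap L (fun x : Fin ℓ → ℝ => fun i => r * x i) := by fun_prop
      exact this
    refine Dfn.preimage hm ?_
    obtain ⟨⟨C, hC⟩, _ | j⟩ := e.symm k
    · rcases Nat.eq_zero_or_pos ℓ with rfl | hℓ
      · obtain ⟨x, hx⟩ := hC.1.nonempty
        have : C = {_x : Fin 0 → ℝ | True} := Set.eq_univ_of_forall fun y => Subsingleton.elim x y ▸ hx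
        simp only [cellFamily, Option.elim, this]
        exact Dfn.const True
      · exact (hΩ.intCell hℓ hC.1).2
    · exact (hX C hC j).2
  obtain ⟨Φ, hΦ, hcomp⟩ := hasCD (L := L) ℓ _ _ hA
  -- In the trivial filtration every definable subset of `ℝ^ℓ` has format `ℓ` and degree `0`. The
  -- index `none` stands for an integer cell itself and `some j` for its subset `X D j`.
  obtain ⟨F', φ, h1, h2, h3, -⟩ := exists_naturalMorphism hΩ (fun h => h.2) hF hr hFr hΦ (c := ℓ)
    (P := 0) (fun C hC => ⟨le_rfl, (hΦ.isCellDecomp.2.1 C hC).dfn⟩)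
    (fun C hC D hD => by simpa [cellFamily] using hcomp C hC (e (⟨D, hD⟩, none))) (X := X)
    (fun C hC D hD j => by simpa [cellFamily] using hcomp C hC (e (⟨D, hD⟩, some j)))
  exact ⟨F', φ, h1, h2, h3⟩

theorem exists_sharp_morphism {L : FirstOrder.Language.{u, v}} [L.Structure ℝ]
    {Ω : FDFamily} (hΩ : IsSharplyOMinimal L Ω) (hcd : HasSharpCD L Ω) :
    ∃ (N : ℕ → MvPolynomial (Fin 3) ℕ) (c : ℕ → ℕ) (P : ℕ → Polynomial ℕ),
      ∀ (ℓ 𝓕 D : ℕ), 1 ≤ ℓ → ℓ ≤ 𝓕 → ∀ (F : Set (Fin ℓ → ℝ)), IsFort ℓ F →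
      ∀ (J : Type w) [Finite J] (X : Set (Fin ℓ → ℝ) → J → Set (Fin ℓ → ℝ)),
        (∀ C ∈ cells F, ∀ j, X C j ⊆ C ∧ X C j ∈ Ω 𝓕 D ℓ) →
        ∃ (F' : Set (Fin ℓ → ℝ)) (φ : (Fin ℓ → ℝ) → (Fin ℓ → ℝ)),
          IsFort ℓ F' ∧ IsNaturalMorphism L F' F φ ∧ MorphismCompatible F' F φ X ∧
          (cells F').ncard ≤ MvPolynomial.eval ![D, (cells F).ncard, Nat.card J] (N 𝓕) ∧
          ∀ C' ∈ cells F', graphOn φ C' ∈ Ω (c 𝓕) ((P 𝓕).eval D) (ℓ + ℓ) := by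
  have : Fact (IsOMinimalExpansion L) := ⟨hΩ.toIsOMinimalExpansion⟩
  obtain ⟨N₀, c₀, P₀, h₀⟩ := hcd
  have hΩc := hΩ.isFDCalculus
  -- Rescaling an integer cell of format `ℓ + 8` and degree `7 * ℓ` gives format `3 * ℓ + 17` and
  -- degree `8 * ℓ + 8`, and rescaling `X C j` gives format at most `3 * 𝓕 + 1` and degree `D + 𝓕`.
  -- Hence format `3 * 𝓕 + 17` and degree `D + (8 * 𝓕 + 8)` suffice for all sets.
  let c₁ : ℕ → ℕ := fun 𝓕 => c₀ (3 * 𝓕 + 17)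
  let P₁ : ℕ → Polynomial ℕ := fun 𝓕 =>
    (P₀ (3 * 𝓕 + 17)).comp (Polynomial.X + Polynomial.C (8 * 𝓕 + 8))
  -- The number of sets to respect is `|C(F)| * (|J| + 1)`, which is substituted for the second
  -- variable of `N₀`. The sums over `ℓ ≤ 𝓕` remove the dependence of the bounds on `ℓ`.
  refine ⟨fun 𝓕 => MvPolynomial.bind₁ ![MvPolynomial.X 0 + MvPolynomial.C (8 * 𝓕 + 8),
      MvPolynomial.X 1 * (MvPolynomial.X 2 + 1)] (N₀ (3 * 𝓕 + 17)),
    fun 𝓕 => ∑ ℓ ∈ Finset.range (𝓕 + 1), (2 * fortFormat ℓ (c₁ 𝓕) + (ℓ + ℓ) + 1),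
    fun 𝓕 => ∑ ℓ ∈ Finset.range (𝓕 + 1), ((fortDegree ℓ (c₁ 𝓕)).comp (P₁ 𝓕) +
      Polynomial.C (fortFormat ℓ (c₁ 𝓕))), ?_⟩
  intro ℓ 𝓕 D hℓ hℓ𝓕 F hF J _ X hX
  obtain ⟨r, hr, hFr⟩ := hF.exists_pos_bound
  have := hF.finite_cells.to_subtype
  let e := Finite.equivFin (cells F × Option J)
  have hcard : Nat.card (cells F × Option J) = (cells F).ncard * (Nat.card J + 1) := by
    rw [Nat.card_prod, Finite.card_option, Nat.card_coe_set_eq]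
  have hs : 1 ≤ Nat.card (cells F × Option J) := by
    obtain ⟨x, hx⟩ := hF.nonempty
    have : Nonempty (cells F × Option J) := ⟨⟨_, hF.intCell_mem_cells hx⟩, none⟩
    exact Nat.card_pos
  have hA : ∀ k, {x | r • x ∈ cellFamily F X (e.symm k)} ⊆ openCube ℓ ∧
      {x | r • x ∈ cellFamily F X (e.symm k)} ∈ Ω (3 * 𝓕 + 17) (D + (8 * 𝓕 + 8)) ℓ := by
    intro k
    refine ⟨fun x hx i => ?_, ?_⟩
    · have := hFr _ (cellFamily_subset (fun C hC j => (hX C hC j).1) _ hx) i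
      simp only [Pi.smul_apply, smul_eq_mul] at this
      exact ⟨(mul_pos_iff_of_pos_left hr).1 this.1, by nlinarith⟩
    · obtain ⟨⟨C, hC⟩, _ | j⟩ := e.symm k
      · exact hΩc.mono (hΩc.preimage_smul (hΩc.intCell hℓ hC.1) fun _ => r) (by omega) (by omega)
      · exact hΩc.mono (hΩc.preimage_smul (hX C hC j).2 fun _ => r) (by omega) (by omega)
  obtain ⟨Φ, hΦ, hcount, hΦΩ⟩ := h₀ ℓ (3 * 𝓕 + 17) (D + (8 * 𝓕 + 8)) _ hℓ hs _ hA
  obtain ⟨F', φ, h1, h2, h3, h4, h5⟩ := exists_naturalMorphism hΩc (fun h => hΩ.definable h) hF hr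
    hFr hΦ (fun C hC => (hΦΩ C hC).1)
    (fun C hC D hD => by simpa [cellFamily] using (hΦΩ C hC).2 (e (⟨D, hD⟩, none))) (X := X)
    (fun C hC D hD j => by simpa [cellFamily] using (hΦΩ C hC).2 (e (⟨D, hD⟩, some j)))
  refine ⟨F', φ, h1, h2, h3, h4.trans (hcount.trans_eq ?_), fun C' hC' => hΩc.mono (h5 C' hC') ?_ ?_⟩
  · change _ = MvPolynomial.eval₂Hom (RingHom.id ℕ) _ (MvPolynomial.bind₁ _ (N₀ (3 * 𝓕 + 17)))
    rw [MvPolynomial.eval₂Hom_bind₁]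
    change MvPolynomial.eval _ _ = MvPolynomial.eval _ _
    congr 2
    ext i
    fin_cases i
    · change _ = MvPolynomial.eval _ _
      simp
    · change _ = MvPolynomial.eval _ _
      simp [hcard]
  · exact Finset.single_le_sum (f := fun ℓ => 2 * fortFormat ℓ (c₁ 𝓕) + (ℓ + ℓ) + 1)
      (fun _ _ => Nat.zero_le _) (Finset.mem_range.2 (Nat.lt_succ_of_le hℓ𝓕))
  · rw [Polynomial.eval_finsetSum]
    refine le_trans (le_of_eq ?_) (Finset.single_le_sum (f := fun ℓ => Polynomial.eval D
      ((fortDegree ℓ (c₁ 𝓕)).comp (P₁ 𝓕) + Polynomial.C (fortFormat ℓ (c₁ 𝓕))))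
      (fun _ _ => Nat.zero_le _) (Finset.mem_range.2 (Nat.lt_succ_of_le hℓ𝓕)))
    simp [P₁, c₁, Polynomial.eval_comp]

end FortTheory

theorem mainTheorem7 (L : FirstOrder.Language.{u, v}) [L.Structure ℝ]
    (hL : FortTheory.IsOMinimalExpansion L) :
    (∀ (ℓ : ℕ), 1 ≤ ℓ → ∀ (F : Set (Fin ℓ → ℝ)), FortTheory.IsFort ℓ F →
      ∀ (J : Type w) [Finite J] (X : Set (Fin ℓ → ℝ) → J → Set (Fin ℓ → ℝ)),
        (∀ C ∈ FortTheory.cells F, ∀ j, X C j ⊆ C ∧ FortTheory.Def L (X C j)) →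
        ∃ (F' : Set (Fin ℓ → ℝ)) (φ : (Fin ℓ → ℝ) → (Fin ℓ → ℝ)),
          FortTheory.IsFort ℓ F' ∧ FortTheory.IsNaturalMorphism L F' F φ ∧
          FortTheory.MorphismCompatible F' F φ X) ∧
    (∀ Ω : FortTheory.FDFamily, FortTheory.IsSharplyOMinimal L Ω → FortTheory.HasSharpCD L Ω →
      ∃ (N : ℕ → MvPolynomial (Fin 3) ℕ) (c : ℕ → ℕ) (P : ℕ → Polynomial ℕ),
        ∀ (ℓ 𝓕 D : ℕ), 1 ≤ ℓ → ℓ ≤ 𝓕 →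
        ∀ (F : Set (Fin ℓ → ℝ)), FortTheory.IsFort ℓ F →
        ∀ (J : Type w) [Finite J] (X : Set (Fin ℓ → ℝ) → J → Set (Fin ℓ → ℝ)),
          (∀ C ∈ FortTheory.cells F, ∀ j, X C j ⊆ C ∧ X C j ∈ Ω 𝓕 D ℓ) →
          ∃ (F' : Set (Fin ℓ → ℝ)) (φ : (Fin ℓ → ℝ) → (Fin ℓ → ℝ)),
            FortTheory.IsFort ℓ F' ∧ FortTheory.IsNaturalMorphism L F' F φ ∧
            FortTheory.MorphismCompatible F' F φ X ∧
            (FortTheory.cells F').ncard ≤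
              MvPolynomial.eval ![D, (FortTheory.cells F).ncard, Nat.card J] (N 𝓕) ∧
            ∀ C' ∈ FortTheory.cells F',
              FortTheory.graphOn φ C' ∈ Ω (c 𝓕) ((P 𝓕).eval D) (ℓ + ℓ)) := by
  have : Fact (FortTheory.IsOMinimalExpansion L) := ⟨hL⟩
  exact ⟨fun _ _ _ hF _ _ _ hX => FortTheory.exists_morphism L hF hX,
    fun _ hΩ hcd => FortTheory.exists_sharp_morphism hΩ hcd⟩
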